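/- Let $N\ge 1$, let $\mathbb{B}_N$ be the open Euclidean unit ball of $\mathbb{C}^N$ and $S_N$ the unit sphere. Let $\sigma$ be the normalized surface measure on $S_N$. The Hardy space $H^2(\mathbb{B}_N)$ consists of the holomorphic functions $f$ on $\mathbb{B}_N$ with $\|f\|^2=\sup_{0<r<1}\int_{S_N}|f(r\zeta)|^2\,d\sigma(\zeta)<\infty$. For real $\alpha>-1$, the weighted Bergman space $A^2_\alpha(\mathbb{B}_N)$ consists of the holomorphic functions $f$ on $\mathbb{B}_N$ with $\|f\|^2=c_\alpha\int_{\mathbb{B}_N}|f(z)|^2(1-|z|^2)^\alpha\,dv(z)<\infty$, where $v$ is Lebesgue measure and $c_\alpha>0$ is the constant for which $c_\alpha(1-|z|^2)^\alpha\,dv(z)$ is a probability measure. Let $\varphi$ be an automorphism (biholomorphic self-map) of $\mathbb{B}_N$ that has no fixed point in $\mathbb{B}_N$ and exactly one fixed point $a$ on $S_N$; here $b\in S_N$ is called a fixed point of $\varphi$ if $\varphi(z)\to b$ as $z\to b$, $z\in\mathbb{B}_N$. Let $\psi$ be continuous on $\overline{\mathbb{B}_N}$ and holomorphic on $\mathbb{B}_N$,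 with $\inf_{z\in\mathbb{B}_N}|\psi(z)|>0$. Then the weighted composition operator $C_{\psi,\varphi}f=\psi\cdot(f\circ\varphi)$ is bounded on $H^2(\mathbb{B}_N)$ and on $A^2_\alpha(\mathbb{B}_N)$ for every $\alpha>-1$, and on each of these spaces its spectrum is the circle $$\{\lambda\in\mathbb{C}:|\lambda|=|\psi(a)|\}.$$ -/

import Mathlib

open MeasureTheory Set Metric
open scoped ENNReal Topology

noncomputable section

/-- The complex Euclidean space `ℂ^N`. -/
abbrev CSpace (N : ℕ) : Type := EuclideanSpace ℂ (Fin N)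

/-- The open unit ball of `ℂ^N`. -/
abbrev unitBall (N : ℕ) : Set (CSpace N) := ball (0 : CSpace N) 1

/-- The unit sphere of `ℂ^N`. -/
abbrev unitSphere (N : ℕ) : Set (CSpace N) := sphere (0 : CSpace N) 1

/-- `φ` restricts to a biholomorphic self-map of the unit ball. The values of `φ` off the ball
are irrelevant. -/
def IsBallAut {N : ℕ} (φ : CSpace N → CSpace N) : Prop :=
  DifferentiableOn ℂ φ (unitBall N) ∧ MapsTo φ (unitBall N) (unitBall N) ∧
    ∃ η : CSpace N → CSpace N,
      DifferentiableOn ℂ η (unitBall N) ∧ MapsTo η (unitBall N) (unitBall N) ∧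
        LeftInvOn η φ (unitBall N) ∧ RightInvOn η φ (unitBall N)

/-- `b` is a point of the unit sphere that is fixed by the boundary extension of `φ`, that is,
`φ z → b` as `z → b` within the ball. -/
def IsBoundaryFixedPoint {N : ℕ} (φ : CSpace N → CSpace N) (b : CSpace N) : Prop :=
  b ∈ unitSphere N ∧ Filter.Tendsto φ (𝓝[unitBall N] b) (𝓝 b)

/-- The normalized surface measure on the unit sphere. -/
def surfaceMeasure (N : ℕ) : Measure (unitSphere N) :=
  ((volume : Measure (CSpace N)).toSphere univ)⁻¹ • (volume : Measure (CSpace N)).toSphere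

/-- The measure `(1 - |z|²)^α dv(z)` on the unit ball. -/
def bergmanWeight (N : ℕ) (α : ℝ) : Measure (CSpace N) :=
  (volume.restrict (unitBall N)).withDensity fun z => ENNReal.ofReal ((1 - ‖z‖ ^ 2) ^ α)

/-- The normalized measure `c_α (1 - |z|²)^α dv(z)` on the unit ball. -/
def bergmanMeasure (N : ℕ) (α : ℝ) : Measure (CSpace N) :=
  (bergmanWeight N α univ)⁻¹ • bergmanWeight N α

/-- The `H²` norm `sup_{0<r<1} (∫ |f(rζ)|² dσ(ζ))^{1/2}`, possibly infinite. -/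
def hardyENorm {N : ℕ} (f : CSpace N → ℂ) : ℝ≥0∞ :=
  ⨆ r : Ioo (0 : ℝ) 1,
    eLpNorm (fun ζ : unitSphere N => f ((r : ℝ) • (ζ : CSpace N))) 2 (surfaceMeasure N)

/-- The `A²_α` norm `(∫ |f|² dv_α)^{1/2}`, possibly infinite. -/
def bergmanENorm {N : ℕ} (α : ℝ) (f : CSpace N → ℂ) : ℝ≥0∞ :=
  eLpNorm f 2 (bergmanMeasure N α)

/-- The holomorphic functions on the unit ball. A function on the ball is represented by its
extension by zero to `ℂ^N`, so that equality of elements is equality on the ball. -/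
def holo (N : ℕ) : Submodule ℂ (CSpace N → ℂ) where
  carrier := {f | DifferentiableOn ℂ f (unitBall N) ∧ ∀ z, z ∉ unitBall N → f z = 0}
  zero_mem' := ⟨differentiableOn_const 0, fun _ _ => rfl⟩
  add_mem' hf hg := ⟨hf.1.add hg.1, fun z hz => by simp [hf.2 z hz, hg.2 z hz]⟩
  smul_mem' c f hf := ⟨hf.1.const_smul c, fun z hz => by simp [hf.2 z hz]⟩

theorem holo_slice_continuous {N : ℕ} {f : CSpace N → ℂ} (hf : f ∈ holo N) (r : Ioo (0 : ℝ) 1) :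
    Continuous fun ζ : unitSphere N => f ((r : ℝ) • (ζ : CSpace N)) := by
  refine hf.1.continuousOn.comp_continuous (by fun_prop) fun ζ => ?_
  have hζ : ‖(ζ : CSpace N)‖ = 1 := by simp
  have h0 := r.2.1
  have h1 := r.2.2
  rw [mem_ball_zero_iff, norm_smul, hζ, mul_one, Real.norm_eq_abs, abs_of_pos h0]
  exact h1

theorem hardyENorm_add_le {N : ℕ} {f g : CSpace N → ℂ} (hf : f ∈ holo N) (hg : g ∈ holo N) :
    hardyENorm (f + g) ≤ hardyENorm f + hardyENorm g := by
  refine iSup_le fun r => ?_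
  refine (eLpNorm_add_le (holo_slice_continuous hf r).aestronglyMeasurable
    (holo_slice_continuous hg r).aestronglyMeasurable (by norm_num)).trans ?_
  exact add_le_add (le_iSup (fun r : Ioo (0 : ℝ) 1 => eLpNorm (fun ζ : unitSphere N =>
      f ((r : ℝ) • (ζ : CSpace N))) 2 (surfaceMeasure N)) r)
    (le_iSup (fun r : Ioo (0 : ℝ) 1 => eLpNorm (fun ζ : unitSphere N =>
      g ((r : ℝ) • (ζ : CSpace N))) 2 (surfaceMeasure N)) r)

theorem hardyENorm_smul {N : ℕ} (c : ℂ) (f : CSpace N → ℂ) :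
    hardyENorm (c • f) = ‖c‖ₑ * hardyENorm f := by
  rw [hardyENorm, hardyENorm, ENNReal.mul_iSup]
  exact iSup_congr fun r => eLpNorm_const_smul c _ 2 _

theorem hardyENorm_zero {N : ℕ} : hardyENorm (0 : CSpace N → ℂ) = 0 := by
  simp [hardyENorm]

theorem surfaceMeasure_isOpenPos (N : ℕ) : (surfaceMeasure N).IsOpenPosMeasure where
  open_pos U hU hne h := by
    rw [surfaceMeasure, Measure.smul_apply, smul_eq_mul, mul_eq_zero] at h
    exact h.elim (ENNReal.inv_ne_zero.2 (measure_ne_top _ _)) (hU.measure_ne_zero _ hne)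

theorem eq_zero_of_hardyENorm_eq_zero {N : ℕ} [NeZero N] {f : CSpace N → ℂ} (hf : f ∈ holo N)
    (h : hardyENorm f = 0) : f = 0 := by
  have := surfaceMeasure_isOpenPos N
  have key : ∀ z ∈ unitBall N, z ≠ 0 → f z = 0 := by
    intro z hz hz0
    have hn : 0 < ‖z‖ := norm_pos_iff.2 hz0
    have hr : ‖z‖ ∈ Ioo (0 : ℝ) 1 := ⟨hn, by simpa using hz⟩
    have h1 := ENNReal.iSup_eq_zero.1 h ⟨‖z‖, hr⟩
    have hc := holo_slice_continuous hf ⟨‖z‖, hr⟩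
    rw [eLpNorm_eq_zero_iff hc.aestronglyMeasurable (by norm_num)] at h1
    have h2 := (hc.ae_eq_iff_eq _ continuous_zero).1 h1
    have hm : (‖z‖⁻¹ : ℝ) • z ∈ unitSphere N := by
      simp [norm_smul, hn.ne']
    have h3 := congrFun h2 ⟨_, hm⟩
    simpa [smul_smul, hn.ne'] using h3
  funext z
  by_cases hz : z ∈ unitBall N
  · by_cases hz0 : z = 0
    · subst hz0
      have hcont : ContinuousAt f 0 := (hf.1.continuousOn).continuousAt (isOpen_ball.mem_nhds hz)
      have hne : (𝓝[≠] (0 : CSpace N)).NeBot := Module.punctured_nhds_neBot ℂ (CSpace N) 0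
      refine tendsto_nhds_unique (l := 𝓝[≠] (0 : CSpace N))
        (hcont.tendsto.mono_left nhdsWithin_le_nhds)
        ((tendsto_const_nhds (x := (0 : ℂ))).congr' ?_)
      filter_upwards [self_mem_nhdsWithin, nhdsWithin_le_nhds (isOpen_ball.mem_nhds hz)]
        with w hw hw'
      exact (key w hw' hw).symm
    · exact key z hz hz0
  · exact hf.2 z hz

theorem bergmanWeight_univ_lt_top (N : ℕ) [NeZero N] {α : ℝ} (hα : -1 < α) :
    bergmanWeight N α univ < ∞ := by
  have hI : IntegrableOn (fun z : CSpace N => (1 - ‖z‖ ^ 2) ^ α) (unitBall N) := by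
    rw [integrableOn_fun_norm_addHaar volume (f := fun y : ℝ => (1 - y ^ 2) ^ α)]
    have h1 : IntegrableOn (fun y : ℝ => (1 - y) ^ α) (Ioo 0 1) := by
      have := (intervalIntegral.intervalIntegrable_rpow' (a := 1) (b := 0) hα).comp_sub_left 1
      simp only [sub_self, sub_zero] at this
      rw [intervalIntegrable_iff_integrableOn_Ioo_of_le zero_le_one] at this
      exact this
    have h2 : IntegrableOn
        (fun y : ℝ => (y ^ (Module.finrank ℝ (CSpace N) - 1) * (1 + y) ^ α) * (1 - y) ^ α)
        (Icc 0 1) := by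
      refine IntegrableOn.continuousOn_mul ?_ ?_ isCompact_Icc
      · refine ContinuousOn.mul (by fun_prop) ?_
        refine ContinuousOn.rpow_const (by fun_prop) fun x hx => Or.inl ?_
        have := hx.1
        positivity
      · exact (integrableOn_Icc_iff_integrableOn_Ioo).2 h1
    refine (h2.mono_set Ioo_subset_Icc_self).congr_fun ?_ measurableSet_Ioo
    intro y hy
    have e : (1 - y ^ 2 : ℝ) = (1 + y) * (1 - y) := by ring
    simp only [smul_eq_mul]
    rw [e, Real.mul_rpow (by linarith [hy.1]) (by linarith [hy.2]), mul_assoc]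
  rw [bergmanWeight, withDensity_apply _ MeasurableSet.univ, Measure.restrict_univ]
  exact hI.lintegral_lt_top

theorem bergmanENorm_smul {N : ℕ} (α : ℝ) (c : ℂ) (f : CSpace N → ℂ) :
    bergmanENorm α (c • f) = ‖c‖ₑ * bergmanENorm α f :=
  eLpNorm_const_smul c f 2 _

theorem bergmanENorm_zero {N : ℕ} (α : ℝ) : bergmanENorm α (0 : CSpace N → ℂ) = 0 := by
  simp [bergmanENorm]

theorem holo_aestronglyMeasurable {N : ℕ} (α : ℝ) {f : CSpace N → ℂ} (hf : f ∈ holo N) :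
    AEStronglyMeasurable f (bergmanMeasure N α) :=
  ((hf.1.continuousOn.aestronglyMeasurable measurableSet_ball).mono_ac
    (withDensity_absolutelyContinuous _ _)).smul_measure _

theorem bergmanENorm_add_le {N : ℕ} (α : ℝ) {f g : CSpace N → ℂ} (hf : f ∈ holo N)
    (hg : g ∈ holo N) : bergmanENorm α (f + g) ≤ bergmanENorm α f + bergmanENorm α g :=
  eLpNorm_add_le (holo_aestronglyMeasurable α hf) (holo_aestronglyMeasurable α hg) (by norm_num)

theorem eq_zero_of_bergmanENorm_eq_zero {N : ℕ} [NeZero N] {α : ℝ} (hα : -1 < α)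
    {f : CSpace N → ℂ} (hf : f ∈ holo N) (h : bergmanENorm α f = 0) : f = 0 := by
  rw [bergmanENorm, eLpNorm_eq_zero_iff (holo_aestronglyMeasurable α hf) (by norm_num),
    bergmanMeasure, Filter.EventuallyEq,
    Measure.ae_ennreal_smul_measure_iff
      (ENNReal.inv_ne_zero.2 (bergmanWeight_univ_lt_top N hα).ne),
    bergmanWeight, ae_withDensity_iff (by fun_prop)] at h
  have h' : f =ᵐ[volume.restrict (unitBall N)] 0 := by
    filter_upwards [h, ae_restrict_mem measurableSet_ball] with z hz hzb
    refine hz ?_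
    have hz1 : ‖z‖ < 1 := by simpa using hzb
    have : 0 < 1 - ‖z‖ ^ 2 := by nlinarith [norm_nonneg z]
    exact (ENNReal.ofReal_pos.2 (Real.rpow_pos_of_pos this α)).ne'
  have h2 := Measure.eqOn_open_of_ae_eq h' isOpen_ball hf.1.continuousOn continuousOn_const
  funext z
  by_cases hz : z ∈ unitBall N
  · exact h2 hz
  · exact hf.2 z hz

/-- The underlying vector space of `H²(B_N)`. -/
def hardySubmodule (N : ℕ) : Submodule ℂ (CSpace N → ℂ) where
  carrier := {f | f ∈ holo N ∧ hardyENorm f < ∞}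
  zero_mem' := ⟨(holo N).zero_mem, by simp [hardyENorm_zero]⟩
  add_mem' hf hg := ⟨(holo N).add_mem hf.1 hg.1,
    (hardyENorm_add_le hf.1 hg.1).trans_lt (ENNReal.add_lt_top.2 ⟨hf.2, hg.2⟩)⟩
  smul_mem' c f hf := ⟨(holo N).smul_mem c hf.1, by
    rw [hardyENorm_smul]; exact ENNReal.mul_lt_top enorm_lt_top hf.2⟩

/-- The underlying vector space of `A²_α(B_N)`. -/
def bergmanSubmodule (N : ℕ) (α : ℝ) : Submodule ℂ (CSpace N → ℂ) where
  carrier := {f | f ∈ holo N ∧ bergmanENorm α f < ∞}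
  zero_mem' := ⟨(holo N).zero_mem, by simp [bergmanENorm_zero]⟩
  add_mem' hf hg := ⟨(holo N).add_mem hf.1 hg.1,
    (bergmanENorm_add_le α hf.1 hg.1).trans_lt (ENNReal.add_lt_top.2 ⟨hf.2, hg.2⟩)⟩
  smul_mem' c f hf := ⟨(holo N).smul_mem c hf.1, by
    rw [bergmanENorm_smul]; exact ENNReal.mul_lt_top enorm_lt_top hf.2⟩

/-- The Hardy space `H²(B_N)`. -/
def HardySpace (N : ℕ) : Type := hardySubmodule N

/-- The weighted Bergman space `A²_α(B_N)`, `α > -1`. -/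
def BergmanSpace (N : ℕ) (α : Ioi (-1 : ℝ)) : Type := bergmanSubmodule N α

namespace HardySpace

variable {N : ℕ}

instance : AddCommGroup (HardySpace N) := inferInstanceAs (AddCommGroup (hardySubmodule N))

instance : Module ℂ (HardySpace N) := inferInstanceAs (Module ℂ (hardySubmodule N))

instance : CoeFun (HardySpace N) fun _ => CSpace N → ℂ := ⟨fun f => f.1⟩

instance [NeZero N] : NormedAddCommGroup (HardySpace N) :=
  AddGroupNorm.toNormedAddCommGroup
    { toFun := fun f => (hardyENorm f.1).toReal
      map_zero' := by
        change (hardyENorm (0 : CSpace N → ℂ)).toReal = 0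
        simp [hardyENorm_zero]
      add_le' := fun f g => by
        change (hardyENorm (f.1 + g.1)).toReal ≤ _
        rw [← ENNReal.toReal_add f.2.2.ne g.2.2.ne]
        exact ENNReal.toReal_mono (ENNReal.add_ne_top.2 ⟨f.2.2.ne, g.2.2.ne⟩)
          (hardyENorm_add_le f.2.1 g.2.1)
      neg' := fun f => by
        change (hardyENorm (-f.1)).toReal = _
        rw [← neg_one_smul ℂ f.1, hardyENorm_smul]
        simp
      eq_zero_of_map_eq_zero' := fun f hf => by
        refine Subtype.ext (eq_zero_of_hardyENorm_eq_zero f.2.1 ?_)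
        exact ((ENNReal.toReal_eq_zero_iff _).1 hf).resolve_right f.2.2.ne }

theorem norm_def [NeZero N] (f : HardySpace N) : ‖f‖ = (hardyENorm f).toReal := rfl

instance [NeZero N] : NormedSpace ℂ (HardySpace N) where
  norm_smul_le c f := by
    rw [norm_def, norm_def]
    change (hardyENorm (c • f.1)).toReal ≤ _
    rw [hardyENorm_smul, ENNReal.toReal_mul, toReal_enorm]

end HardySpace

namespace BergmanSpace

variable {N : ℕ} {α : Ioi (-1 : ℝ)}

instance : AddCommGroup (BergmanSpace N α) :=
  inferInstanceAs (AddCommGroup (bergmanSubmodule N α))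

instance : Module ℂ (BergmanSpace N α) := inferInstanceAs (Module ℂ (bergmanSubmodule N α))

instance : CoeFun (BergmanSpace N α) fun _ => CSpace N → ℂ := ⟨fun f => f.1⟩

instance [NeZero N] : NormedAddCommGroup (BergmanSpace N α) :=
  AddGroupNorm.toNormedAddCommGroup
    { toFun := fun f => (bergmanENorm α f.1).toReal
      map_zero' := by
        change (bergmanENorm α (0 : CSpace N → ℂ)).toReal = 0
        simp [bergmanENorm_zero]
      add_le' := fun f g => by
        change (bergmanENorm α (f.1 + g.1)).toReal ≤ _
        rw [← ENNReal.toReal_add f.2.2.ne g.2.2.ne]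
        exact ENNReal.toReal_mono (ENNReal.add_ne_top.2 ⟨f.2.2.ne, g.2.2.ne⟩)
          (bergmanENorm_add_le α f.2.1 g.2.1)
      neg' := fun f => by
        change (bergmanENorm α (-f.1)).toReal = _
        rw [← neg_one_smul ℂ f.1, bergmanENorm_smul]
        simp
      eq_zero_of_map_eq_zero' := fun f hf => by
        refine Subtype.ext (eq_zero_of_bergmanENorm_eq_zero α.2 f.2.1 ?_)
        exact ((ENNReal.toReal_eq_zero_iff _).1 hf).resolve_right f.2.2.ne }

theorem norm_def [NeZero N] (f : BergmanSpace N α) : ‖f‖ = (bergmanENorm α f).toReal := rfl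

instance [NeZero N] : NormedSpace ℂ (BergmanSpace N α) where
  norm_smul_le c f := by
    rw [norm_def, norm_def]
    change (bergmanENorm α (c • f.1)).toReal ≤ _
    rw [bergmanENorm_smul, ENNReal.toReal_mul, toReal_enorm]

end BergmanSpace

/-- The bounded operator `T` on `H²(B_N)` is the weighted composition operator
`C_{ψ,φ} f = ψ · (f ∘ φ)`. There is at most one such `T`. -/
def HardySpace.IsWeightedComp {N : ℕ} [NeZero N] (ψ : CSpace N → ℂ) (φ : CSpace N → CSpace N)
    (T : HardySpace N →L[ℂ] HardySpace N) : Prop :=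
  ∀ f : HardySpace N, ∀ z ∈ unitBall N, T f z = ψ z * f (φ z)

/-- The bounded operator `T` on `A²_α(B_N)` is the weighted composition operator
`C_{ψ,φ} f = ψ · (f ∘ φ)`. There is at most one such `T`. -/
def BergmanSpace.IsWeightedComp {N : ℕ} [NeZero N] {α : Ioi (-1 : ℝ)} (ψ : CSpace N → ℂ)
    (φ : CSpace N → CSpace N) (T : BergmanSpace N α →L[ℂ] BergmanSpace N α) : Prop :=
  ∀ f : BergmanSpace N α, ∀ z ∈ unitBall N, T f z = ψ z * f (φ z)

end

/-! Automorphisms of the ball are the fractional linear maps induced by linear maps of ℂ × ℂ^N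
preserving the Lorentz form (`IsBallAut.exists_isLorentz`). If D is the denominator of φ, its
Jacobian determinant has modulus |D|^{-(N+1)} and 1 - |φ|² = (1 - |z|²)/|D|². Hence, for a
holomorphic w with |w| = |D|^{-p}, the operator U f = w · (f ∘ φ) is an invertible isometry when p =
N + 1 + α on A²_α, and when p = N on H². The Hardy case is obtained from the Bergman case by letting
α decrease to -1. With h = ψ/w, the weighted composition operator is T = hU.

The vector (1, a) is an eigenvector of the linear map, with eigenvalue D(a). The hypotheses on fixed
points force |D(a)| = 1, so |h(a)| = |ψ(a)|, and they produce a solution q of the Abel equation q ∘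
φ = q + c on the closed ball without a (`exists_isAbelSystem`). As q is bounded away from a, an
orbit leaves a given neighborhood of a for only boundedly many steps, uniformly in its starting
point. So the products of h along orbits are O(r^n) for every r > |h(a)|, and the spectral radius of
T is at most |h(a)|. The same estimate for the inverse of T places the spectrum inside the circle.

Conversely, suppose that μ = h(a)θ with |θ| = 1 is not in the spectrum. The conjugate U^{-n} T U^n
equals (h ∘ φ^{-n}) U, and φ^{-n} → a pointwise on the closed ball, so on the ball algebra the
conjugates converge strongly to h(a) U. The resolvent bound survives in the limit: ‖x‖ ≤ C ‖Ux - θx‖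
(`IsInvariantSpace.exists_norm_le_of_notMem_spectrum`). This is contradicted by F = ∑_{j<n} θ^{-j}
U^j P, where P is a high power of a peak function at a point of the sphere other than a. The
summands are almost orthogonal, so ‖F‖² is at least of order n‖P‖², while UF - θF telescopes to norm
at most 2‖P‖ (`IsInvariantSpace.exists_almost_eigenvector`).

The operator theory is carried out once, for the abstract spaces of `IsInvariantSpace`; both
families of spaces are then shown to be of this kind and complete. -/

noncomputable section

/-! ### Fractional linear maps preserving the Lorentz form -/

section Lorentz

variable {N : ℕ}

/-- The Lorentz form `x̄₀ y₀ - ⟪x', y'⟫` on `ℂ × ℂ^N`. -/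
def lorentzForm (x y : ℂ × CSpace N) : ℂ := star x.1 * y.1 - inner ℂ x.2 y.2

/-- Invertible linear maps of `ℂ × ℂ^N` that preserve the Lorentz form and have a determinant
of modulus one. -/
structure IsLorentz (M : (ℂ × CSpace N) ≃ₗ[ℂ] (ℂ × CSpace N)) : Prop where
  form_map : ∀ x y, lorentzForm (M x) (M y) = lorentzForm x y
  norm_det : ‖LinearMap.det (M : (ℂ × CSpace N) →ₗ[ℂ] (ℂ × CSpace N))‖ = 1

/-- The denominator of the fractional linear map induced by `M`. -/
def mobDen (M : (ℂ × CSpace N) ≃ₗ[ℂ] (ℂ × CSpace N)) (z : CSpace N) : ℂ := (M (1, z)).1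

/-- The fractional linear map induced by `M`. -/
def mobius (M : (ℂ × CSpace N) ≃ₗ[ℂ] (ℂ × CSpace N)) (z : CSpace N) : CSpace N :=
  (mobDen M z)⁻¹ • (M (1, z)).2

theorem lorentzForm_self (x : ℂ × CSpace N) :
    lorentzForm x x = ((‖x.1‖ ^ 2 - ‖x.2‖ ^ 2 : ℝ) : ℂ) := by
  rw [lorentzForm, inner_self_eq_norm_sq_to_K]
  have : star x.1 * x.1 = ((‖x.1‖ ^ 2 : ℝ) : ℂ) := by
    simpa using Complex.conj_mul' x.1
  rw [this]
  push_cast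
  rfl

theorem lorentzForm_add_left (x y z : ℂ × CSpace N) :
    lorentzForm (x + y) z = lorentzForm x z + lorentzForm y z := by
  simp [lorentzForm]; ring

theorem lorentzForm_add_right (x y z : ℂ × CSpace N) :
    lorentzForm x (y + z) = lorentzForm x y + lorentzForm x z := by
  simp [lorentzForm]; ring

theorem lorentzForm_smul_left (c : ℂ) (x y : ℂ × CSpace N) :
    lorentzForm (c • x) y = star c * lorentzForm x y := by
  simp [lorentzForm]; ring

theorem lorentzForm_smul_right (c : ℂ) (x y : ℂ × CSpace N) :
    lorentzForm x (c • y) = c * lorentzForm x y := by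
  simp [lorentzForm]; ring

theorem lorentzForm_symm (x y : ℂ × CSpace N) :
    star (lorentzForm x y) = lorentzForm y x := by
  simp [lorentzForm, mul_comm]

/-- The linear functional `y ↦ lorentzForm x y`. -/
def lorentzDual (x : ℂ × CSpace N) : Module.Dual ℂ (ℂ × CSpace N) where
  toFun := lorentzForm x
  map_add' := lorentzForm_add_right x
  map_smul' c y := lorentzForm_smul_right c x y

@[simp] theorem lorentzDual_apply (x y : ℂ × CSpace N) : lorentzDual x y = lorentzForm x y := rfl

namespace IsLorentz

variable {M M' : (ℂ × CSpace N) ≃ₗ[ℂ] (ℂ × CSpace N)}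

theorem norm_sq_sub (hM : IsLorentz M) (x : ℂ × CSpace N) :
    ‖(M x).1‖ ^ 2 - ‖(M x).2‖ ^ 2 = ‖x.1‖ ^ 2 - ‖x.2‖ ^ 2 := by
  have := hM.form_map x x
  rw [lorentzForm_self, lorentzForm_self] at this
  exact_mod_cast this

theorem refl : IsLorentz (LinearEquiv.refl ℂ (ℂ × CSpace N)) :=
  ⟨fun _ _ => rfl, by simp⟩

theorem symm (hM : IsLorentz M) : IsLorentz M.symm where
  form_map x y := by
    have := hM.form_map (M.symm x) (M.symm y)
    simpa using this.symm
  norm_det := by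
    have h := LinearEquiv.det_mul_det_symm M
    have h2 := congrArg norm h
    rw [norm_mul, hM.norm_det] at h2
    simpa using h2

theorem trans (hM : IsLorentz M) (hM' : IsLorentz M') : IsLorentz (M.trans M') where
  form_map x y := by simp [hM.form_map, hM'.form_map]
  norm_det := by
    rw [LinearEquiv.coe_trans, LinearMap.det_comp, norm_mul, hM.norm_det, hM'.norm_det, one_mul]

/-- If the first coordinate of M (1, z) vanished, preservation of the form would force the second to
vanish too, contradicting injectivity. -/
theorem den_ne_zero (hM : IsLorentz M) {z : CSpace N} (hz : z ∈ closedBall (0 : CSpace N) 1) :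
    mobDen M z ≠ 0 := by
  intro h
  have hz' : ‖z‖ ≤ 1 := by simpa using hz
  have h1 := hM.norm_sq_sub (1, z)
  rw [mobDen] at h
  rw [h] at h1
  have h2 : ‖(M (1, z)).2‖ ^ 2 ≤ 0 := by
    simp only [norm_zero, norm_one] at h1
    nlinarith [norm_nonneg z]
  have h3 : (M (1, z)).2 = 0 := by
    rw [← norm_eq_zero]
    exact pow_eq_zero_iff (two_ne_zero) |>.1 (le_antisymm h2 (sq_nonneg _))
  have h4 : M (1, z) = 0 := Prod.ext h h3
  have h5 := M.map_eq_zero_iff.1 h4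
  simp at h5

theorem apply_eq (hM : IsLorentz M) {z : CSpace N} (hz : z ∈ closedBall (0 : CSpace N) 1) :
    M (1, z) = mobDen M z • ((1 : ℂ), mobius M z) := by
  ext1
  · simp [mobDen]
  · simp [mobius, smul_smul, hM.den_ne_zero hz]

theorem one_sub_norm_sq (hM : IsLorentz M) {z : CSpace N}
    (hz : z ∈ closedBall (0 : CSpace N) 1) :
    (1 - ‖mobius M z‖ ^ 2) * ‖mobDen M z‖ ^ 2 = 1 - ‖z‖ ^ 2 := by
  have h1 := hM.norm_sq_sub (1, z)
  rw [hM.apply_eq hz] at h1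
  simp only [Prod.smul_fst, Prod.smul_snd, norm_smul, smul_eq_mul, norm_one,
    mul_one, one_pow] at h1
  linarith [h1, mul_pow ‖mobDen M z‖ ‖mobius M z‖ 2]

theorem mapsTo_closedBall (hM : IsLorentz M) :
    MapsTo (mobius M) (closedBall (0 : CSpace N) 1) (closedBall (0 : CSpace N) 1) := by
  intro z hz
  have h1 := hM.one_sub_norm_sq hz
  have h2 : 0 < ‖mobDen M z‖ ^ 2 := by have := norm_pos_iff.2 (hM.den_ne_zero hz); positivity
  rw [mem_closedBall_zero_iff] at hz ⊢
  have h3 : 0 ≤ 1 - ‖z‖ ^ 2 := by nlinarith [norm_nonneg z]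
  rw [← h1] at h3
  have := nonneg_of_mul_nonneg_left h3 h2
  nlinarith [norm_nonneg (mobius M z)]

theorem mapsTo_ball (hM : IsLorentz M) :
    MapsTo (mobius M) (unitBall N) (unitBall N) := by
  intro z hz
  have h1 := hM.one_sub_norm_sq (ball_subset_closedBall hz)
  have h2 : 0 < ‖mobDen M z‖ ^ 2 := by
    have := norm_pos_iff.2 (hM.den_ne_zero (ball_subset_closedBall hz)); positivity
  rw [mem_ball_zero_iff] at hz ⊢
  have h3 : 0 < 1 - ‖z‖ ^ 2 := by nlinarith [norm_nonneg z]
  rw [← h1] at h3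
  have := pos_of_mul_pos_left h3 h2.le
  nlinarith [norm_nonneg (mobius M z)]

theorem den_trans (hM : IsLorentz M) {z : CSpace N} (hz : z ∈ closedBall (0 : CSpace N) 1) :
    mobDen (M.trans M') z = mobDen M z * mobDen M' (mobius M z) := by
  rw [mobDen, LinearEquiv.trans_apply, hM.apply_eq hz, map_smul]
  rfl

theorem mobius_trans (hM : IsLorentz M) {z : CSpace N} (hz : z ∈ closedBall (0 : CSpace N) 1) :
    mobius (M.trans M') z = mobius M' (mobius M z) := by
  rw [mobius, hM.den_trans hz, LinearEquiv.trans_apply, hM.apply_eq hz, map_smul, Prod.smul_snd,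
    smul_smul, mul_inv, mul_right_comm, inv_mul_cancel₀ (hM.den_ne_zero hz), one_mul,
    mobius.eq_1 M']

theorem mobius_refl (z : CSpace N) : mobius (LinearEquiv.refl ℂ (ℂ × CSpace N)) z = z := by
  simp [mobius, mobDen]

theorem symm_mobius (hM : IsLorentz M) {z : CSpace N} (hz : z ∈ closedBall (0 : CSpace N) 1) :
    mobius M.symm (mobius M z) = z := by
  rw [← hM.mobius_trans hz, LinearEquiv.self_trans_symm, mobius_refl]

theorem mobius_symm (hM : IsLorentz M) {z : CSpace N} (hz : z ∈ closedBall (0 : CSpace N) 1) :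
    mobius M (mobius M.symm z) = z := by
  rw [← hM.symm.mobius_trans hz, LinearEquiv.symm_trans_self, mobius_refl]

theorem den_mul_den_symm (hM : IsLorentz M) {z : CSpace N}
    (hz : z ∈ closedBall (0 : CSpace N) 1) : mobDen M z * mobDen M.symm (mobius M z) = 1 := by
  rw [← hM.den_trans hz, LinearEquiv.self_trans_symm]
  rfl

theorem continuous_den (M : (ℂ × CSpace N) ≃ₗ[ℂ] (ℂ × CSpace N)) : Continuous (mobDen M) := by
  have : Continuous M := LinearMap.continuous_of_finiteDimensional M.toLinearMap
  unfold mobDen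
  fun_prop

theorem continuousOn_mobius (hM : IsLorentz M) :
    ContinuousOn (mobius M) (closedBall (0 : CSpace N) 1) := by
  have : Continuous M := LinearMap.continuous_of_finiteDimensional M.toLinearMap
  unfold mobius
  refine ContinuousOn.smul ((continuous_den M).continuousOn.inv₀ fun z hz => hM.den_ne_zero hz) ?_
  fun_prop

/-- The derivative of a fractional linear map. -/
theorem hasFDerivAt_mobius (hM : IsLorentz M) {z : CSpace N} (hz : z ∈ unitBall N) :
    ∃ A : CSpace N →L[ℂ] CSpace N, HasFDerivAt (mobius M) A z ∧
      ∀ v, mobDen M z • A v = (M (0, v)).2 - (M (0, v)).1 • mobius M z := by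
  have hzK := ball_subset_closedBall hz
  let MC : (ℂ × CSpace N) →L[ℂ] (ℂ × CSpace N) := LinearMap.toContinuousLinearMap M.toLinearMap
  have hMC : ∀ x, MC x = M x := fun _ => rfl
  have h0 : HasFDerivAt (fun z : CSpace N => MC ((1 : ℂ), z))
      (MC ∘L ContinuousLinearMap.inr ℂ ℂ (CSpace N)) z :=
    MC.hasFDerivAt.comp z (hasFDerivAt_prodMk_right (1 : ℂ) z)
  have h1 : HasFDerivAt (mobDen M) ((ContinuousLinearMap.fst ℂ ℂ (CSpace N)) ∘L
      (MC ∘L ContinuousLinearMap.inr ℂ ℂ (CSpace N))) z :=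
    (ContinuousLinearMap.fst ℂ ℂ (CSpace N)).hasFDerivAt.comp z h0
  have h2 : HasFDerivAt (fun z => (M (1, z)).2) ((ContinuousLinearMap.snd ℂ ℂ (CSpace N)) ∘L
      (MC ∘L ContinuousLinearMap.inr ℂ ℂ (CSpace N))) z :=
    (ContinuousLinearMap.snd ℂ ℂ (CSpace N)).hasFDerivAt.comp z h0
  have hne := hM.den_ne_zero hzK
  have h3 := ((hasDerivAt_inv hne).comp_hasFDerivAt z h1).smul h2
  refine ⟨_, h3, fun v => ?_⟩
  have e : (M (1, z)).2 = mobDen M z • mobius M z := by rw [hM.apply_eq hzK]; rfl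
  simp only [add_apply, smul_apply, Function.comp_apply,
    ContinuousLinearMap.comp_apply, ContinuousLinearMap.inr_apply, hMC,
    ContinuousLinearMap.coe_snd', ContinuousLinearMap.coe_fst', ContinuousLinearMap.smulRight_apply,
    smul_add, e, smul_smul, smul_eq_mul]
  rw [mul_inv_cancel₀ hne, one_smul, sub_eq_add_neg, ← neg_smul]
  congr 2
  field_simp

theorem differentiableOn_mobius (hM : IsLorentz M) :
    DifferentiableOn ℂ (mobius M) (unitBall N) := fun _ hz =>
  (hM.hasFDerivAt_mobius hz).choose_spec.1.differentiableAt.differentiableWithinAt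

theorem differentiable_den (M : (ℂ × CSpace N) ≃ₗ[ℂ] (ℂ × CSpace N)) :
    Differentiable ℂ (mobDen M) := by
  let MC : (ℂ × CSpace N) →L[ℂ] (ℂ × CSpace N) := LinearMap.toContinuousLinearMap M.toLinearMap
  have : mobDen M = fun z => (MC (1, z)).1 := rfl
  rw [this]
  fun_prop

/-- The Jacobian determinant of a fractional linear map. -/
theorem norm_det_fderiv (hM : IsLorentz M) {z : CSpace N} (hz : z ∈ unitBall N)
    {A : CSpace N →L[ℂ] CSpace N} (hA : HasFDerivAt (mobius M) A z) :
    ‖LinearMap.det (A : CSpace N →ₗ[ℂ] CSpace N)‖ * ‖mobDen M z‖ ^ (N + 1) = 1 := by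
  have hzK := ball_subset_closedBall hz
  obtain ⟨A', hA', hA'v⟩ := hM.hasFDerivAt_mobius hz
  obtain rfl := hA.unique hA'
  set D := mobDen M z with hD
  have hne : D ≠ 0 := hM.den_ne_zero hzK
  -- Shears moving z and its image to the origin do not change determinants. After them M is block
  -- triangular with diagonal blocks D and D • A, so that det M = D^(N+1) det A.
  let f0 : Module.Dual ℂ (ℂ × CSpace N) := LinearMap.fst ℂ ℂ (CSpace N)
  let S (w : CSpace N) : (ℂ × CSpace N) →ₗ[ℂ] (ℂ × CSpace N) :=
    LinearMap.transvection f0 ((0 : ℂ), w)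
  have hS : ∀ w, LinearMap.det (S w) = 1 := fun w => by
    simp only [S]
    rw [LinearMap.transvection.det]
    simp [f0]
  let g : Module.Dual ℂ (ℂ × CSpace N) :=
    (D⁻¹ • (LinearMap.fst ℂ ℂ (CSpace N)) ∘ₗ M.toLinearMap) ∘ₗ
      (LinearMap.inr ℂ ℂ (CSpace N)) ∘ₗ (LinearMap.snd ℂ ℂ (CSpace N))
  have hR : LinearMap.det (LinearMap.transvection g ((1 : ℂ), (0 : CSpace N))) = 1 := by
    rw [LinearMap.transvection.det]
    have h00 : M ((0 : ℂ), (0 : CSpace N)) = 0 := map_zero M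
    simp [g, h00]
  have key : (S (-mobius M z)) ∘ₗ M.toLinearMap ∘ₗ S z =
      (LinearMap.prodMap (D • LinearMap.id) (D • (A : CSpace N →ₗ[ℂ] CSpace N))) ∘ₗ
        LinearMap.transvection g ((1 : ℂ), (0 : CSpace N)) := by
    have e1 : M (1, z) = D • ((1 : ℂ), mobius M z) := hM.apply_eq hzK
    refine LinearMap.ext fun x => ?_
    obtain ⟨t, v⟩ := x
    have e2 : S z (t, v) = t • ((1 : ℂ), z) + (0, v) := by
      simp [S, LinearMap.transvection.apply, f0, add_comm]
    have e3 := hA'v v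
    simp only [LinearMap.comp_apply, e2, LinearEquiv.coe_coe, map_add, map_smul, e1]
    simp only [S, LinearMap.transvection.apply, f0, g]
    ext1
    · simp only [LinearMap.comp_apply, LinearMap.smul_apply, LinearMap.prodMap_apply,
        LinearMap.fst_apply, LinearMap.snd_apply, LinearMap.inr_apply, LinearEquiv.coe_coe,
        LinearMap.id_apply, Prod.fst_add, Prod.smul_fst, smul_eq_mul]
      field_simp
      simp
    · simp only [LinearMap.comp_apply, LinearMap.smul_apply, LinearMap.prodMap_apply,
        LinearMap.fst_apply, LinearMap.snd_apply, LinearMap.inr_apply, LinearEquiv.coe_coe,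
        LinearMap.id_apply, Prod.snd_add, Prod.smul_snd, smul_eq_mul,
        ContinuousLinearMap.coe_coe, smul_zero, add_zero]
      rw [e3]
      simp
      module
  have hdet := congrArg LinearMap.det key
  rw [LinearMap.det_comp, LinearMap.det_comp, LinearMap.det_comp, hS, hS, hR,
    LinearMap.det_prodMap, LinearMap.det_smul, LinearMap.det_smul] at hdet
  have h4 := congrArg norm hdet
  have h5 := hM.norm_det
  simp only [one_mul, mul_one, LinearMap.det_id, norm_mul, norm_pow,
    Module.finrank_self, pow_one, finrank_euclideanSpace, Fintype.card_fin] at h4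
  rw [h5] at h4
  rw [h4, pow_succ]
  ring

/-- The real Jacobian determinant of a fractional linear map. -/
theorem abs_det_restrictScalars (hM : IsLorentz M) {z : CSpace N} (hz : z ∈ unitBall N)
    {A : CSpace N →L[ℂ] CSpace N} (hA : HasFDerivAt (mobius M) A z) :
    |(A.restrictScalars ℝ).det| = (‖mobDen M z‖ ^ (2 * (N + 1)))⁻¹ := by
  have h1 := hM.norm_det_fderiv hz hA
  have h2 : (A.restrictScalars ℝ).det = ‖LinearMap.det (A : CSpace N →ₗ[ℂ] CSpace N)‖ ^ 2 := by
    rw [ContinuousLinearMap.det, ContinuousLinearMap.coe_restrictScalars,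
      LinearMap.det_restrictScalars, Algebra.norm_complex_apply, Complex.normSq_eq_norm_sq]
  rw [h2, abs_of_nonneg (by positivity)]
  refine eq_inv_of_mul_eq_one_left ?_
  rw [mul_comm 2, pow_mul, ← mul_pow, h1, one_pow]

end IsLorentz

end Lorentz

/-! ### Automorphisms of the ball are fractional linear -/

section Classification

variable {N : ℕ}

/-- Some Lorentz map moves the origin to a given point of the ball. -/
theorem exists_isLorentz_mobius_zero {b : CSpace N} (hb : b ∈ unitBall N) :
    ∃ M, IsLorentz M ∧ mobius M (0 : CSpace N) = b := by
  rcases eq_or_ne b 0 with rfl | hb0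
  · exact ⟨_, IsLorentz.refl, IsLorentz.mobius_refl 0⟩
  have hb1 : ‖b‖ < 1 := by simpa using hb
  have hpos : 0 < 1 - ‖b‖ ^ 2 := by nlinarith [norm_nonneg b]
  -- With this normalization g(1, b) has form value 1, like (1, 0), and their pairing g is real. The
  -- reflection along their difference u therefore preserves the form and exchanges them. The form
  -- value 2(1 - g) of u is nonzero only for b ≠ 0, hence the separate treatment of b = 0.
  set g : ℝ := (Real.sqrt (1 - ‖b‖ ^ 2))⁻¹ with hg
  have hs : 0 < Real.sqrt (1 - ‖b‖ ^ 2) := Real.sqrt_pos.2 hpos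
  have hg2 : g ^ 2 * (1 - ‖b‖ ^ 2) = 1 := by
    rw [hg, inv_pow, Real.sq_sqrt hpos.le, inv_mul_cancel₀ hpos.ne']
  have hg0 : 0 < g := by positivity
  have hg1 : g ≠ 1 := by
    intro h
    rw [h] at hg2
    have := norm_pos_iff.2 hb0
    nlinarith
  have hgC : (1 - (g : ℂ)) ≠ 0 := by
    rw [sub_ne_zero]
    exact_mod_cast hg1.symm
  let e : ℂ × CSpace N := (1, 0)
  let e' : ℂ × CSpace N := (g : ℂ) • ((1 : ℂ), b)
  have hee : lorentzForm e e = 1 := by simp [lorentzForm_self, e]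
  have hee1 : lorentzForm e e' = g := by simp [lorentzForm, e, e']
  have hee2 : lorentzForm e' e = g := by simp [lorentzForm, e, e']
  have hee3 : lorentzForm e' e' = 1 := by
    rw [lorentzForm_self]
    have h1 : ‖e'.1‖ = g := by simp [e', abs_of_pos hg0]
    have h2 : ‖e'.2‖ = g * ‖b‖ := by simp [e', norm_smul, abs_of_pos hg0]
    rw [h1, h2]
    norm_cast
    rw [← hg2]; ring
  let u : ℂ × CSpace N := e + (-1 : ℂ) • e'
  let f : Module.Dual ℂ (ℂ × CSpace N) := (1 - (g : ℂ))⁻¹ • lorentzDual u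
  have hue : lorentzForm u e = 1 - g := by
    simp only [u, lorentzForm_add_left, lorentzForm_smul_left, hee, hee2]; simp; ring
  have hue' : lorentzForm u e' = g - 1 := by
    simp only [u, lorentzForm_add_left, lorentzForm_smul_left, hee1, hee3]; simp; ring
  have huu : lorentzForm u u = 2 * (1 - g) := by
    conv_lhs => rw [show u = e + (-1 : ℂ) • e' from rfl, lorentzForm_add_right,
      lorentzForm_smul_right]
    rw [hue, hue']; ring
  have hf : f u = 2 := by
    simp only [f, LinearMap.smul_apply, lorentzDual_apply, huu, smul_eq_mul]
    field_simp
  have hfe : f e = 1 := by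
    simp only [f, LinearMap.smul_apply, lorentzDual_apply, hue, smul_eq_mul]
    field_simp
  have hMe : Module.reflection hf e = e' := by
    rw [Module.reflection_apply, hfe]
    simp [u]
  refine ⟨Module.reflection hf, ⟨fun x y => ?_, ?_⟩, ?_⟩
  · have hx : lorentzForm x u = (1 - (g : ℂ)) * star (f x) := by
      simp only [f, LinearMap.smul_apply, lorentzDual_apply, smul_eq_mul, star_mul',
        lorentzForm_symm, star_inv₀, star_sub, star_one]
      have : star (g : ℂ) = g := Complex.conj_ofReal g
      rw [this]
      field_simp
    have hy : lorentzForm u y = (1 - (g : ℂ)) * f y := by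
      simp only [f, LinearMap.smul_apply, lorentzDual_apply, smul_eq_mul]
      field_simp
    rw [Module.reflection_apply, Module.reflection_apply, sub_eq_add_neg, sub_eq_add_neg,
      ← neg_smul, ← neg_smul, lorentzForm_add_left, lorentzForm_add_right, lorentzForm_add_right,
      lorentzForm_smul_left, lorentzForm_smul_left, lorentzForm_smul_right, lorentzForm_smul_right,
      huu, hx, hy, star_neg]
    ring
  · have h1 : (Module.reflection hf : (ℂ × CSpace N) →ₗ[ℂ] (ℂ × CSpace N)) ∘ₗ
        (Module.reflection hf : (ℂ × CSpace N) →ₗ[ℂ] (ℂ × CSpace N)) = LinearMap.id :=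
      LinearMap.ext fun x => Module.involutive_reflection hf x
    have h2 := congrArg (fun T => ‖LinearMap.det T‖) h1
    simp only [LinearMap.det_comp, LinearMap.det_id, norm_mul, norm_one] at h2
    nlinarith [norm_nonneg (LinearMap.det
      (Module.reflection hf : (ℂ × CSpace N) →ₗ[ℂ] (ℂ × CSpace N)))]
  · have hgC0 : (g : ℂ) ≠ 0 := by exact_mod_cast hg0.ne'
    have hMe' : Module.reflection hf ((1 : ℂ), (0 : CSpace N)) = e' := hMe
    rw [mobius, mobDen, hMe']
    change ((g : ℂ) * 1)⁻¹ • (g : ℂ) • b = b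
    rw [mul_one, smul_smul, inv_mul_cancel₀ hgC0, one_smul]

/-- A linear isometry of `ℂ^N` induces a Lorentz map. -/
theorem isLorentz_prodCongr (W : CSpace N ≃ₗᵢ[ℂ] CSpace N) :
    IsLorentz ((LinearEquiv.refl ℂ ℂ).prodCongr W.toLinearEquiv) where
  form_map x y := by simp [lorentzForm]
  norm_det := by
    have h : (((LinearEquiv.refl ℂ ℂ).prodCongr W.toLinearEquiv :
        (ℂ × CSpace N) ≃ₗ[ℂ] (ℂ × CSpace N)) : (ℂ × CSpace N) →ₗ[ℂ] (ℂ × CSpace N)) =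
        LinearMap.prodMap LinearMap.id (W.toLinearEquiv : CSpace N →ₗ[ℂ] CSpace N) := rfl
    rw [h, LinearMap.det_prodMap, LinearMap.det_id, one_mul, ← LinearMap.normDet_eq_norm_det]
    exact W.toLinearIsometry.normDet_eq_one

/-- A biholomorphic self-map of the ball that fixes the origin is a linear isometry. -/
theorem IsBallAut.exists_linearIsometryEquiv {F : CSpace N → CSpace N} (hF : IsBallAut F)
    (h0 : F 0 = 0) : ∃ W : CSpace N ≃ₗᵢ[ℂ] CSpace N, EqOn F W (unitBall N) := by
  obtain ⟨hd, hm, η, hηd, hηm, hl, hr⟩ := hF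
  have hmem : (0 : CSpace N) ∈ unitBall N := mem_ball_self one_pos
  have hη0 : η 0 = 0 := by simpa [h0] using hl hmem
  have hdF : DifferentiableAt ℂ F 0 := hd.differentiableAt (isOpen_ball.mem_nhds hmem)
  have hdη : DifferentiableAt ℂ η 0 := hηd.differentiableAt (isOpen_ball.mem_nhds hmem)
  -- The Schwarz lemma bounds both derivatives by 1, and A' ∘ A = id, so A is isometric. Then F
  -- attains equality in the Schwarz lemma on every complex line through 0, and is linear there.
  set A := fderiv ℂ F 0 with hA
  set A' := fderiv ℂ η 0 with hA'
  have nA : ‖A‖ ≤ 1 := Complex.norm_fderiv_le_one_of_mapsTo_ball hd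
    (by rw [h0]; exact hm.mono_right ball_subset_closedBall) one_pos
  have nA' : ‖A'‖ ≤ 1 := Complex.norm_fderiv_le_one_of_mapsTo_ball hηd
    (by rw [hη0]; exact hηm.mono_right ball_subset_closedBall) one_pos
  have hcomp : A' ∘L A = ContinuousLinearMap.id ℂ (CSpace N) := by
    have h1 : HasFDerivAt (η ∘ F) (A' ∘L A) 0 := by
      refine HasFDerivAt.comp (0 : CSpace N) (by rw [h0]; exact hdη.hasFDerivAt) hdF.hasFDerivAt
    have h2 : (η ∘ F) =ᶠ[𝓝 0] id := by
      filter_upwards [isOpen_ball.mem_nhds hmem] with z hz using hl hz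
    exact (h1.congr_of_eventuallyEq h2.symm).unique (hasFDerivAt_id _)
  have hnorm : ∀ v, ‖A v‖ = ‖v‖ := by
    intro v
    apply le_antisymm
    · simpa using A.le_of_opNorm_le nA v
    · have : A' (A v) = v := congrArg (fun T : CSpace N →L[ℂ] CSpace N => T v) hcomp
      calc ‖v‖ = ‖A' (A v)‖ := by rw [this]
        _ ≤ 1 * ‖A v‖ := A'.le_of_opNorm_le nA' _
        _ = ‖A v‖ := one_mul _
  let W0 : CSpace N →ₗᵢ[ℂ] CSpace N := ⟨A.toLinearMap, hnorm⟩
  refine ⟨W0.toLinearIsometryEquiv rfl, fun z hz => ?_⟩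
  change F z = A z
  rcases eq_or_ne z 0 with rfl | hz0
  · simp [h0]
  have hzn : 0 < ‖z‖ := norm_pos_iff.2 hz0
  have hz1 : ‖z‖ < 1 := by simpa using hz
  set ζ : CSpace N := ((‖z‖ : ℂ)⁻¹) • z with hζ
  have hζn : ‖ζ‖ = 1 := by
    rw [hζ, norm_smul]; simp [hzn.ne']
  have hmaps : MapsTo (fun t : ℂ => t • ζ) (ball 0 1) (unitBall N) := fun t ht => by
    rw [mem_ball_zero_iff, norm_smul, hζn, mul_one]; simpa using ht
  have hgd : DifferentiableOn ℂ (fun t : ℂ => F (t • ζ)) (ball 0 1) :=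
    hd.comp (by fun_prop) hmaps
  have hgder : HasDerivAt (fun t : ℂ => F (t • ζ)) (A ζ) 0 := by
    have h1 : HasDerivAt (fun t : ℂ => t • ζ) ζ 0 := by
      simpa using (hasDerivAt_id (0 : ℂ)).smul_const ζ
    exact HasFDerivAt.comp_hasDerivAt (0 : ℂ) (by simpa using hdF.hasFDerivAt) h1
  have hds : dslope (fun t : ℂ => F (t • ζ)) 0 0 = A ζ := by
    rw [dslope_same, hgder.deriv]
  have hEq := Complex.affine_of_mapsTo_ball_of_norm_dslope_eq_div (R₂ := 1) (z₀ := 0) hgd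
    (by
      intro t ht
      simp only [zero_smul, h0]
      exact ball_subset_closedBall (hm (hmaps ht)))
    (mem_ball_self one_pos) (by rw [hds, hnorm, hζn]; simp)
  have hz' : ((‖z‖ : ℂ)) • ζ = z := by
    rw [hζ, smul_smul, mul_inv_cancel₀ (by exact_mod_cast hzn.ne'), one_smul]
  have h3 := hEq (x := (‖z‖ : ℂ)) (by simpa using hz1)
  simp only [hds, hz', zero_smul, h0, zero_add, sub_zero] at h3
  rw [h3, ← map_smul, hz']

theorem IsLorentz.isBallAut {M : (ℂ × CSpace N) ≃ₗ[ℂ] (ℂ × CSpace N)} (hM : IsLorentz M) :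
    IsBallAut (mobius M) :=
  ⟨hM.differentiableOn_mobius, hM.mapsTo_ball, mobius M.symm, hM.symm.differentiableOn_mobius,
    hM.symm.mapsTo_ball, fun _ hz => hM.symm_mobius (ball_subset_closedBall hz),
    fun _ hz => hM.mobius_symm (ball_subset_closedBall hz)⟩

theorem IsBallAut.comp {F G : CSpace N → CSpace N} (hG : IsBallAut G) (hF : IsBallAut F) :
    IsBallAut (G ∘ F) := by
  obtain ⟨hd, hm, η, hηd, hηm, hl, hr⟩ := hF
  obtain ⟨hd', hm', η', hηd', hηm', hl', hr'⟩ := hG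
  exact ⟨hd'.comp hd hm, hm'.comp hm, η ∘ η', hηd.comp hηd' hηm', hηm.comp hηm',
    fun z hz => by simp [hl' (hm hz), hl hz], fun z hz => by simp [hr (hηm' hz), hr' hz]⟩

/-- Automorphisms of the ball are fractional linear maps. -/
theorem IsBallAut.exists_isLorentz {φ : CSpace N → CSpace N} (hφ : IsBallAut φ) :
    ∃ M, IsLorentz M ∧ EqOn φ (mobius M) (unitBall N) := by
  have hmem : (0 : CSpace N) ∈ unitBall N := mem_ball_self one_pos
  obtain ⟨M₁, hM₁, hb⟩ := exists_isLorentz_mobius_zero (hφ.2.1 hmem)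
  have h0 : (mobius M₁.symm ∘ φ) 0 = 0 := by
    rw [Function.comp_apply, ← hb, hM₁.symm_mobius (ball_subset_closedBall hmem)]
  obtain ⟨W, hW⟩ := (hM₁.symm.isBallAut.comp hφ).exists_linearIsometryEquiv h0
  refine ⟨_, (isLorentz_prodCongr W).trans hM₁, fun z hz => ?_⟩
  have hzK := ball_subset_closedBall hz
  rw [(isLorentz_prodCongr W).mobius_trans hzK]
  have h1 : mobius ((LinearEquiv.refl ℂ ℂ).prodCongr W.toLinearEquiv) z = W z := by
    simp [mobius, mobDen]
  rw [h1, ← hW hz, Function.comp_apply, hM₁.mobius_symm (ball_subset_closedBall (hφ.2.1 hz))]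

end Classification

/-! ### Dynamics of parabolic automorphisms -/

section Dynamics

variable {N : ℕ}

/-- `φ` is a continuous self-map of the closed ball that fixes `a`, and `q` is a solution of the
Abel equation `q ∘ φ = q + c` on the closed ball without `a`. -/
structure IsAbelSystem (φ : CSpace N → CSpace N) (a : CSpace N) (q : CSpace N → ℂ) (c : ℂ) :
    Prop where
  mapsTo : MapsTo φ (closedBall 0 1) (closedBall 0 1)
  continuousOn : ContinuousOn φ (closedBall 0 1)
  mem : a ∈ closedBall (0 : CSpace N) 1
  map_fixed : φ a = a
  map_ne : ∀ z ∈ closedBall (0 : CSpace N) 1, z ≠ a → φ z ≠ a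
  continuousOn_abel : ContinuousOn q (closedBall 0 1 \ {a})
  abel : ∀ z ∈ closedBall (0 : CSpace N) 1, z ≠ a → q (φ z) = q z + c
  ne_zero : c ≠ 0

/-- The fractional linear map extends φ continuously to the closed ball, which turns boundary limits
into genuine fixed points. -/
theorem IsBoundaryFixedPoint.mobius_eq {φ : CSpace N → CSpace N} {b : CSpace N}
    (hb : IsBoundaryFixedPoint φ b) {M : (ℂ × CSpace N) ≃ₗ[ℂ] (ℂ × CSpace N)} (hM : IsLorentz M)
    (hφ : EqOn φ (mobius M) (unitBall N)) : mobius M b = b := by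
  have hbK : b ∈ closedBall (0 : CSpace N) 1 := sphere_subset_closedBall hb.1
  have hcl : b ∈ closure (unitBall N) := by rwa [closure_ball _ one_ne_zero]
  have : (𝓝[unitBall N] b).NeBot := mem_closure_iff_nhdsWithin_neBot.1 hcl
  have h1 : Filter.Tendsto (mobius M) (𝓝[unitBall N] b) (𝓝 (mobius M b)) :=
    ((hM.continuousOn_mobius b hbK).mono ball_subset_closedBall)
  have h2 : Filter.Tendsto (mobius M) (𝓝[unitBall N] b) (𝓝 b) :=
    hb.2.congr' (by filter_upwards [self_mem_nhdsWithin] with z hz using hφ hz)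
  exact tendsto_nhds_unique h1 h2

theorem isBoundaryFixedPoint_of_mobius_eq {φ : CSpace N → CSpace N} {b : CSpace N}
    (hb : b ∈ unitSphere N) {M : (ℂ × CSpace N) ≃ₗ[ℂ] (ℂ × CSpace N)} (hM : IsLorentz M)
    (hφ : EqOn φ (mobius M) (unitBall N)) (h : mobius M b = b) : IsBoundaryFixedPoint φ b := by
  refine ⟨hb, ?_⟩
  have h1 : Filter.Tendsto (mobius M) (𝓝[unitBall N] b) (𝓝 (mobius M b)) :=
    ((hM.continuousOn_mobius b (sphere_subset_closedBall hb)).mono ball_subset_closedBall)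
  rw [h] at h1
  exact h1.congr' (by filter_upwards [self_mem_nhdsWithin] with z hz using (hφ hz).symm)

/-- An eigenvector that is nonnegative for the Lorentz form gives a fixed point. -/
theorem mobius_eq_of_eigenvector {M : (ℂ × CSpace N) ≃ₗ[ℂ] (ℂ × CSpace N)}
    {x : ℂ × CSpace N} {ν : ℂ} (hx : M x = ν • x) (hx0 : x.1 ≠ 0) :
    M (1, x.1⁻¹ • x.2) = ν • ((1 : ℂ), x.1⁻¹ • x.2) ∧
      mobius M (x.1⁻¹ • x.2) = x.1⁻¹ • x.2 := by
  have e : ((1 : ℂ), x.1⁻¹ • x.2) = x.1⁻¹ • x := by ext1 <;> simp [hx0]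
  have h1 : M (1, x.1⁻¹ • x.2) = ν • ((1 : ℂ), x.1⁻¹ • x.2) := by
    rw [e, map_smul, hx, smul_comm]
  refine ⟨h1, ?_⟩
  have hν : ν ≠ 0 := by
    rintro rfl
    rw [zero_smul] at hx
    exact hx0 (by rw [M.map_eq_zero_iff.1 hx]; rfl)
  rw [mobius, mobDen, h1]
  simp [smul_smul, hν]

/-- Expanding the square shows that 1 - ⟪a, z⟫ vanishes on the closed ball only at a; this serves
both the denominator of the Abel function and the peak functions. -/
theorem norm_sub_sq_le_of_mem_closedBall {a z : CSpace N} (ha : ‖a‖ = 1) (hz : ‖z‖ ≤ 1) :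
    ‖z - a‖ ^ 2 ≤ 2 * ‖1 - inner ℂ a z‖ := by
  rw [@norm_sub_sq ℂ, ha]
  have h1 : (1 - inner ℂ a z).re ≤ ‖1 - inner ℂ a z‖ := Complex.re_le_norm _
  have h2 : RCLike.re (inner ℂ z a) = (inner ℂ a z).re := by
    rw [← inner_conj_symm a z, Complex.conj_re]; rfl
  rw [h2]
  rw [Complex.sub_re, Complex.one_re] at h1
  nlinarith [norm_nonneg z]

/-- The dynamics of an automorphism without interior fixed points and with exactly one boundary
fixed point. -/
theorem exists_isAbelSystem {φ : CSpace N → CSpace N} {a : CSpace N}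
    (hfix : ∀ z ∈ unitBall N, φ z ≠ z) (ha : IsBoundaryFixedPoint φ a)
    (huniq : ∀ b, IsBoundaryFixedPoint φ b → b = a)
    {M : (ℂ × CSpace N) ≃ₗ[ℂ] (ℂ × CSpace N)} (hM : IsLorentz M)
    (hφ : EqOn φ (mobius M) (unitBall N)) :
    ‖mobDen M a‖ = 1 ∧ ∃ q c, IsAbelSystem (mobius M) a q c ∧
      IsAbelSystem (mobius M.symm) a q (-c) := by
  have haS : ‖a‖ = 1 := by simpa using ha.1
  have haK : a ∈ closedBall (0 : CSpace N) 1 := by simp [haS]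
  have hMa := ha.mobius_eq hM hφ
  set μ := mobDen M a with hμ
  have hμ0 : μ ≠ 0 := hM.den_ne_zero haK
  set α : ℂ × CSpace N := (1, a) with hα
  have hMα : M α = μ • α := by rw [hα, hM.apply_eq haK, hMa]
  -- Pairing with the eigenvector (1, a) gives an eigenfunctional, for the eigenvalue inverse to the
  -- conjugate of μ.
  have hdual : ∀ x, lorentzForm α (M x) = (star μ)⁻¹ * lorentzForm α x := by
    intro x
    have h1 := hM.form_map α x
    rw [hMα, lorentzForm_smul_left] at h1
    have : star μ ≠ 0 := star_ne_zero.2 hμ0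
    field_simp
    linear_combination h1
  -- Otherwise ν, the inverse of the conjugate of μ, has |ν| ≠ 1 and is an eigenvalue, since M - ν
  -- maps into the kernel of the eigenfunctional. Its eigenvector is null for the form and so yields
  -- a boundary fixed point. By uniqueness this point is a, whence μ = ν and |μ| = 1.
  have hμ1 : ‖μ‖ = 1 := by
    by_contra hne
    set ν := (star μ)⁻¹ with hν
    set g : (ℂ × CSpace N) →ₗ[ℂ] (ℂ × CSpace N) := M.toLinearMap - ν • LinearMap.id with hg
    have hns : ¬ Function.Surjective g := by
      intro hs
      obtain ⟨x, hx⟩ := hs (1, 0)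
      have h1 : lorentzForm α (g x) = 0 := by
        have : g x = M x + (-ν) • x := by simp [hg, sub_eq_add_neg]
        rw [this, lorentzForm_add_right, lorentzForm_smul_right, hdual]
        ring
      rw [hx] at h1
      simp [lorentzForm, hα] at h1
    have hni : ¬ Function.Injective g := fun h => hns (LinearMap.injective_iff_surjective.1 h)
    rw [← LinearMap.ker_eq_bot, Submodule.eq_bot_iff] at hni
    push Not at hni
    obtain ⟨v, hv, hv0⟩ := hni
    have hMv : M v = ν • v := by
      have : M v - ν • v = 0 := by simpa [hg] using hv
      exact sub_eq_zero.1 this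
    have hνn : ‖ν‖ ≠ 1 := by
      rw [hν, norm_inv, norm_star]
      intro h
      exact hne (by rw [← inv_inv ‖μ‖, h, inv_one])
    have h2 := hM.norm_sq_sub v
    rw [hMv] at h2
    simp only [Prod.smul_fst, Prod.smul_snd, norm_smul, smul_eq_mul, mul_pow, norm_mul] at h2
    have h3 : (‖ν‖ ^ 2 - 1) * (‖v.1‖ ^ 2 - ‖v.2‖ ^ 2) = 0 := by linarith
    have h4 : ‖ν‖ ^ 2 - 1 ≠ 0 := by
      intro h
      have : (‖ν‖ - 1) * (‖ν‖ + 1) = 0 := by linarith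
      rcases mul_eq_zero.1 this with h | h
      · exact hνn (by linarith)
      · linarith [norm_nonneg ν]
    have h5 : ‖v.1‖ ^ 2 = ‖v.2‖ ^ 2 := by
      linarith [(mul_eq_zero.1 h3).resolve_left h4]
    have h6 : ‖v.1‖ = ‖v.2‖ := by
      rwa [sq_eq_sq₀ (norm_nonneg _) (norm_nonneg _)] at h5
    have hv1 : v.1 ≠ 0 := by
      intro h
      rw [h, norm_zero] at h6
      exact hv0 (Prod.ext h (norm_eq_zero.1 h6.symm))
    obtain ⟨h7, h8⟩ := mobius_eq_of_eigenvector hMv hv1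
    have hbS : v.1⁻¹ • v.2 ∈ unitSphere N := by
      rw [mem_sphere_zero_iff_norm, norm_smul, norm_inv, h6, inv_mul_cancel₀]
      rw [← h6]; simpa using hv1
    have h9 := huniq _ (isBoundaryFixedPoint_of_mobius_eq hbS hM hφ h8)
    rw [h9] at h7
    have h10 : μ = ν := by
      have := congrArg Prod.fst (hMα.symm.trans h7)
      simpa [hα] using this
    have h11 := congrArg norm h10
    rw [hν, norm_inv, norm_star] at h11
    have h12 : ‖μ‖ * ‖μ‖ = 1 := by
      nth_rewrite 1 [h11]
      exact inv_mul_cancel₀ (norm_ne_zero_iff.2 hμ0)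
    exact hne (by nlinarith [norm_nonneg μ])
  have hstar : (star μ)⁻¹ = μ := by
    rw [inv_eq_iff_eq_inv]
    refine eq_inv_of_mul_eq_one_left ?_
    have := Complex.conj_mul' μ
    rw [hμ1] at this
    simpa using this
  rw [hstar] at hdual
  refine ⟨hμ1, ?_⟩
  set g : (ℂ × CSpace N) →ₗ[ℂ] (ℂ × CSpace N) := M.toLinearMap - μ • LinearMap.id with hg
  -- This is the solvability condition for ℓ ∘ (M - μ) = ⟨α, ·⟩. If v in the kernel paired
  -- nontrivially with the null vector α, the form at v + tα would be affine in t up to conjugation,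
  -- so some eigenvector would have positive form value and give a fixed point inside the ball.
  have hann : lorentzDual α ∈ g.ker.dualAnnihilator := by
    rw [Submodule.mem_dualAnnihilator]
    intro v hv
    by_contra hne
    rw [lorentzDual_apply] at hne
    have hMv : M v = μ • v := by
      have : M v - μ • v = 0 := by simpa [hg] using hv
      exact sub_eq_zero.1 this
    have hαα : lorentzForm α α = 0 := by simp [lorentzForm_self, hα, haS]
    set p := lorentzForm α v with hp
    have hvα : lorentzForm v α = star p := (lorentzForm_symm α v).symm
    set R : ℝ := ‖v.1‖ ^ 2 - ‖v.2‖ ^ 2 with hR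
    -- Chosen so that each of the two cross terms equals 1 + |R|, which outweighs R.
    set t : ℂ := ((1 + |R| : ℝ) : ℂ) * p / ((‖p‖ ^ 2 : ℝ) : ℂ) with ht
    have hpp : star p * p = ((‖p‖ ^ 2 : ℝ) : ℂ) := by simpa using Complex.conj_mul' p
    have hpn : ((‖p‖ ^ 2 : ℝ) : ℂ) ≠ 0 := by
      have := norm_pos_iff.2 hne
      exact_mod_cast (by positivity : ‖p‖ ^ 2 ≠ 0)
    have htp : t * star p = ((1 + |R| : ℝ) : ℂ) := by
      rw [ht, div_mul_eq_mul_div, mul_assoc, mul_comm p, hpp, mul_div_assoc, div_self hpn, mul_one]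
    have htp' : star t * p = ((1 + |R| : ℝ) : ℂ) := by
      have := congrArg star htp
      rw [star_mul', star_star] at this
      rw [this]; exact Complex.conj_ofReal _
    set x : ℂ × CSpace N := v + t • α with hx
    have hMx : M x = μ • x := by
      rw [hx, map_add, map_smul, hMv, hMα, smul_add, smul_comm]
    have hQ : lorentzForm x x = ((R + 2 * (1 + |R|) : ℝ) : ℂ) := by
      rw [hx, lorentzForm_add_left, lorentzForm_add_right, lorentzForm_add_right,
        lorentzForm_smul_left, lorentzForm_smul_left, lorentzForm_smul_right,
        lorentzForm_smul_right, hαα, hvα, ← hp, htp, htp', lorentzForm_self v, ← hR]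
      push_cast
      ring
    rw [lorentzForm_self] at hQ
    have hQ' : ‖x.1‖ ^ 2 - ‖x.2‖ ^ 2 = R + 2 * (1 + |R|) := by exact_mod_cast hQ
    have hpos : 0 < ‖x.1‖ ^ 2 - ‖x.2‖ ^ 2 := by
      rw [hQ']; nlinarith [neg_abs_le R, abs_nonneg R]
    have hx1 : x.1 ≠ 0 := by
      intro h
      rw [h, norm_zero] at hpos
      nlinarith [norm_nonneg x.2]
    obtain ⟨-, h8⟩ := mobius_eq_of_eigenvector hMx hx1
    have hxn := norm_pos_iff.2 hx1
    have hmem : x.1⁻¹ • x.2 ∈ unitBall N := by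
      rw [mem_ball_zero_iff, norm_smul, norm_inv, inv_mul_lt_iff₀ hxn, mul_one]
      nlinarith [norm_nonneg x.2]
    exact hfix _ hmem ((hφ hmem).trans h8)
  rw [← LinearMap.range_dualMap_eq_dualAnnihilator_ker] at hann
  obtain ⟨ℓ, hℓ⟩ := hann
  have hℓM : ∀ x, ℓ (M x) = μ * ℓ x + lorentzForm α x := by
    intro x
    have h1 : ℓ (g x) = lorentzForm α x := by
      rw [← lorentzDual_apply, ← hℓ]; rfl
    have h2 : g x = M x - μ • x := by simp [hg]
    rw [h2, map_sub, map_smul, smul_eq_mul] at h1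
    linear_combination h1
  have hform : ∀ z : CSpace N, lorentzForm α ((1 : ℂ), z) = 1 - inner ℂ a z := by
    intro z; simp [lorentzForm, hα]
  have hform0 : ∀ z ∈ closedBall (0 : CSpace N) 1, z ≠ a → lorentzForm α ((1 : ℂ), z) ≠ 0 := by
    intro z hz hza h0
    rw [hform] at h0
    have h1 := norm_sub_sq_le_of_mem_closedBall haS (by simpa using hz : ‖z‖ ≤ 1)
    rw [h0, norm_zero, mul_zero] at h1
    have h2 : ‖z - a‖ = 0 := pow_eq_zero_iff two_ne_zero |>.1 (le_antisymm h1 (sq_nonneg _))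
    exact hza (sub_eq_zero.1 (norm_eq_zero.1 h2))
  have hMa' : mobius M.symm a = a := by
    conv_lhs => rw [← hMa]
    exact hM.symm_mobius haK
  have hMane : ∀ z ∈ closedBall (0 : CSpace N) 1, z ≠ a → mobius M z ≠ a := by
    intro z hz hza h
    apply hza
    rw [← hM.symm_mobius hz, h, hMa']
  have hMane' : ∀ z ∈ closedBall (0 : CSpace N) 1, z ≠ a → mobius M.symm z ≠ a := by
    intro z hz hza h
    apply hza
    rw [← hM.mobius_symm hz, h, hMa]
  -- Under composition with M, the functional ℓ and the pairing with α form a Jordan block with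
  -- eigenvalue μ; on their quotient this becomes translation by μ⁻¹.
  set q : CSpace N → ℂ := fun z => ℓ (1, z) / lorentzForm α ((1 : ℂ), z) with hq
  have habel : ∀ z ∈ closedBall (0 : CSpace N) 1, z ≠ a → q (mobius M z) = q z + μ⁻¹ := by
    intro z hz hza
    have hD := hM.den_ne_zero hz
    have e1 : q (mobius M z) = ℓ (M (1, z)) / lorentzForm α (M (1, z)) := by
      rw [hM.apply_eq hz, map_smul, lorentzForm_smul_right, smul_eq_mul, mul_div_mul_left _ _ hD]
    have := hform0 z hz hza
    rw [e1, hℓM, hdual]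
    simp only [hq]
    field_simp
  have hqc : ContinuousOn q (closedBall 0 1 \ {a}) := by
    have hℓc : Continuous ℓ := LinearMap.continuous_of_finiteDimensional ℓ
    refine ContinuousOn.div (by fun_prop) ?_ fun z hz => hform0 z hz.1 (by simpa using hz.2)
    simp only [hform]
    fun_prop
  refine ⟨q, μ⁻¹, ⟨hM.mapsTo_closedBall, hM.continuousOn_mobius, haK, hMa, hMane, hqc, habel,
    inv_ne_zero hμ0⟩, ⟨hM.symm.mapsTo_closedBall, hM.symm.continuousOn_mobius, haK, hMa', hMane',
    hqc, fun z hz hza => ?_, neg_ne_zero.2 (inv_ne_zero hμ0)⟩⟩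
  have := habel _ (hM.symm.mapsTo_closedBall hz) (hMane' z hz hza)
  rw [hM.mobius_symm hz] at this
  rw [this]; ring

namespace IsAbelSystem

variable {φ : CSpace N → CSpace N} {a : CSpace N} {q : CSpace N → ℂ} {c : ℂ}

theorem mapsTo_iterate (h : IsAbelSystem φ a q c) (n : ℕ) :
    MapsTo φ^[n] (closedBall 0 1) (closedBall 0 1) := h.mapsTo.iterate n

theorem continuousOn_iterate (h : IsAbelSystem φ a q c) (n : ℕ) :
    ContinuousOn φ^[n] (closedBall 0 1) := h.continuousOn.iterate h.mapsTo n

theorem iterate_ne (h : IsAbelSystem φ a q c) {z : CSpace N}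
    (hz : z ∈ closedBall (0 : CSpace N) 1) (hza : z ≠ a) (n : ℕ) : φ^[n] z ≠ a := by
  induction n with
  | zero => exact hza
  | succ n ih =>
    rw [Function.iterate_succ_apply']
    exact h.map_ne _ (h.mapsTo_iterate n hz) ih

theorem abel_iterate (h : IsAbelSystem φ a q c) {z : CSpace N}
    (hz : z ∈ closedBall (0 : CSpace N) 1) (hza : z ≠ a) (n : ℕ) :
    q (φ^[n] z) = q z + n * c := by
  induction n with
  | zero => simp
  | succ n ih =>
    rw [Function.iterate_succ_apply', h.abel _ (h.mapsTo_iterate n hz) (h.iterate_ne hz hza n), ih]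
    push_cast
    ring

/-- The iterates of a point spend a uniformly bounded time outside a neighborhood of `a`. -/
theorem exists_gap (h : IsAbelSystem φ a q c) {V : Set (CSpace N)} (hV : IsOpen V) (ha : a ∈ V) :
    ∃ m : ℕ, ∀ z ∈ closedBall (0 : CSpace N) 1, ∀ i j : ℕ, φ^[i] z ∉ V → φ^[j] z ∉ V →
      j ≤ i + m := by
  have hK : IsCompact (closedBall (0 : CSpace N) 1 \ V) := (isCompact_closedBall (0 : CSpace N) 1).diff hV
  have hsub : closedBall (0 : CSpace N) 1 \ V ⊆ closedBall 0 1 \ {a} := fun z hz =>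
    ⟨hz.1, fun hza => hz.2 (by rw [mem_singleton_iff.1 hza]; exact ha)⟩
  obtain ⟨b, hb⟩ := hK.exists_bound_of_continuousOn (h.continuousOn_abel.mono hsub)
  -- Between times i and j the value of q changes by (j - i)c, while outside V its modulus is at
  -- most b.
  obtain ⟨m, hm⟩ := exists_nat_ge (2 * b / ‖c‖)
  refine ⟨m, fun z hz i j hi hj => ?_⟩
  have hc : 0 < ‖c‖ := norm_pos_iff.2 h.ne_zero
  have hza : z ≠ a := by
    rintro rfl
    exact hi (by rw [Function.iterate_fixed h.map_fixed]; exact ha)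
  have h1 := hb _ ⟨h.mapsTo_iterate i hz, hi⟩
  have h2 := hb _ ⟨h.mapsTo_iterate j hz, hj⟩
  have h3 : ((j : ℂ) - i) * c = q (φ^[j] z) - q (φ^[i] z) := by
    rw [h.abel_iterate hz hza, h.abel_iterate hz hza]; ring
  have h4 : ‖((j : ℂ) - i)‖ * ‖c‖ ≤ 2 * b := by
    rw [← norm_mul, h3]
    exact (norm_sub_le _ _).trans (by linarith)
  have h5 : ((j : ℝ) - i) ≤ ‖((j : ℂ) - i)‖ := by
    have := Complex.re_le_norm ((j : ℂ) - i)
    simpa using this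
  have h6 : (j : ℝ) - i ≤ m := by
    refine h5.trans (le_trans ?_ hm)
    rwa [le_div_iff₀ hc]
  have : (j : ℝ) ≤ i + m := by linarith
  exact_mod_cast this

/-- Once an orbit is outside V at time i, it cannot be outside V after time i + m. -/
theorem tendsto_iterate (h : IsAbelSystem φ a q c) {z : CSpace N}
    (hz : z ∈ closedBall (0 : CSpace N) 1) :
    Filter.Tendsto (fun n => φ^[n] z) Filter.atTop (𝓝 a) := by
  rw [_root_.tendsto_nhds]
  intro V hV ha
  obtain ⟨m, hm⟩ := h.exists_gap hV ha
  by_cases hall : ∀ i, φ^[i] z ∈ V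
  · exact Filter.Eventually.of_forall hall
  · push Not at hall
    obtain ⟨i, hi⟩ := hall
    filter_upwards [Filter.eventually_gt_atTop (i + m)] with j hj
    by_contra hjV
    exact absurd (hm z hz i j hi hjV) (by omega)

/-- The values q z + nc are pairwise distinct because c ≠ 0. -/
theorem injective_iterate (h : IsAbelSystem φ a q c) {z : CSpace N}
    (hz : z ∈ closedBall (0 : CSpace N) 1) (hza : z ≠ a) {i j : ℕ} (hij : φ^[i] z = φ^[j] z) :
    i = j := by
  have h1 := congrArg q hij
  rw [h.abel_iterate hz hza, h.abel_iterate hz hza, add_right_inj] at h1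
  exact_mod_cast mul_right_cancel₀ h.ne_zero h1

/-- Products of a continuous function along orbits grow at most like powers of its value at `a`. -/
theorem exists_prod_bound (h : IsAbelSystem φ a q c) {g : CSpace N → ℂ}
    (hg : ContinuousOn g (closedBall 0 1)) {r : ℝ} (hr : ‖g a‖ < r) :
    ∃ C : ℝ, ∀ z ∈ closedBall (0 : CSpace N) 1, ∀ n : ℕ,
      ‖∏ k ∈ Finset.range n, g (φ^[k] z)‖ ≤ C * r ^ n := by
  classical
  have hr0 : 0 < r := (norm_nonneg _).trans_lt hr
  obtain ⟨b, hb⟩ := (isCompact_closedBall (0 : CSpace N) 1).exists_bound_of_continuousOn hg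
  obtain ⟨V, hV, ha, hVr⟩ : ∃ V : Set (CSpace N), IsOpen V ∧ a ∈ V ∧
      ∀ z ∈ closedBall (0 : CSpace N) 1, z ∈ V → ‖g z‖ ≤ r := by
    have h1 : ∀ᶠ z in 𝓝[closedBall 0 1] a, ‖g z‖ < r :=
      (hg a h.mem).norm.eventually_lt_const hr
    obtain ⟨V, hV, ha, hVs⟩ := mem_nhdsWithin.1 h1
    exact ⟨V, hV, ha, fun z hz hzV => (hVs ⟨hzV, hz⟩ : ‖g z‖ < r).le⟩
  obtain ⟨m, hm⟩ := h.exists_gap hV ha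
  -- A factor is at most r inside V and at most B outside. The exceptional times lie in an interval
  -- of m + 1 integers, each costing a factor B / r; the maximum ensures B / r ≥ 1, so that the
  -- exponent may be raised to m + 1.
  set B := max b r with hB
  have hBr : 1 ≤ B / r := by rw [le_div_iff₀ hr0, one_mul]; exact le_max_right _ _
  refine ⟨(B / r) ^ (m + 1), fun z hz n => ?_⟩
  set s := (Finset.range n).filter fun k => φ^[k] z ∉ V with hs
  have hcard : s.card ≤ m + 1 := by
    rcases s.eq_empty_or_nonempty with h0 | hne
    · simp [h0]
    · have hsub : s ⊆ Finset.Icc (s.min' hne) (s.min' hne + m) := by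
        intro k hk
        rw [Finset.mem_Icc]
        refine ⟨s.min'_le _ hk, hm z hz _ _ ?_ (Finset.mem_filter.1 hk).2⟩
        exact (Finset.mem_filter.1 (s.min'_mem hne)).2
      calc s.card ≤ _ := Finset.card_le_card hsub
        _ = m + 1 := by rw [Nat.card_Icc]; omega
  rw [norm_prod]
  calc ∏ k ∈ Finset.range n, ‖g (φ^[k] z)‖
      ≤ ∏ k ∈ Finset.range n, (r * if φ^[k] z ∉ V then B / r else 1) := by
        refine Finset.prod_le_prod (fun _ _ => norm_nonneg _) fun k _ => ?_
        split_ifs with hk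
        · rw [mul_one]
          exact hVr _ (h.mapsTo_iterate k hz) hk
        · rw [mul_div_cancel₀ _ hr0.ne']
          exact (hb _ (h.mapsTo_iterate k hz)).trans (le_max_left _ _)
    _ = r ^ n * (B / r) ^ s.card := by
        rw [Finset.prod_mul_distrib, Finset.prod_const, Finset.card_range, Finset.prod_ite,
          Finset.prod_const, Finset.prod_const_one, mul_one]
    _ ≤ r ^ n * (B / r) ^ (m + 1) := by gcongr
    _ = _ := mul_comm _ _

end IsAbelSystem

end Dynamics

/-! ### Weighted composition operators on Möbius invariant Hilbert function spaces -/

section Abstract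

variable {N : ℕ} {X : Type*} [NormedAddCommGroup X] [NormedSpace ℂ X]

/-- `X` is realized through `e` as the space of holomorphic functions on the ball with finite
`E`-norm; the norm is monotone, invariant of weight `p` under automorphisms, and on the ball
algebra it is the norm of `L²(m)`. -/
structure IsInvariantSpace (e : X →ₗ[ℂ] (CSpace N → ℂ)) (E : (CSpace N → ℂ) → ℝ≥0∞) (p : ℝ)
    (m : Measure (CSpace N)) : Prop where
  mem_holo : ∀ x, e x ∈ holo N
  enorm_eq : ∀ x, ‖x‖ₑ = E (e x)
  exists_of_lt_top : ∀ f ∈ holo N, E f < ∞ → ∃ x, e x = f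
  mono : ∀ f g : CSpace N → ℂ, (∀ z ∈ unitBall N, ‖f z‖ ≤ ‖g z‖) → E f ≤ E g
  smul : ∀ (c : ℂ) (f : CSpace N → ℂ), E (c • f) = ‖c‖ₑ * E f
  mobius_le : ∀ M, IsLorentz M → ∀ f ∈ holo N,
    E (fun z => ((‖mobDen M z‖ ^ (-p) : ℝ) : ℂ) * f (mobius M z)) ≤ E f
  boundary : ∀ g, DiffContOnCl ℂ g (unitBall N) → E g = eLpNorm g 2 m
  finite : IsFiniteMeasure m
  compl_null : m (closedBall (0 : CSpace N) 1)ᶜ = 0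
  open_pos : ∀ ζ ∈ unitSphere N, ∀ O, IsOpen O → ζ ∈ O → m O ≠ 0

/-- `S` is the weighted composition operator `f ↦ w · (f ∘ φ)`. -/
def IsWComp (e : X →ₗ[ℂ] (CSpace N → ℂ)) (w : CSpace N → ℂ) (φ : CSpace N → CSpace N)
    (S : X →L[ℂ] X) : Prop :=
  ∀ x, ∀ z ∈ unitBall N, e (S x) z = w z * e x (φ z)

namespace IsInvariantSpace

variable {e : X →ₗ[ℂ] (CSpace N → ℂ)} {E : (CSpace N → ℂ) → ℝ≥0∞} {p : ℝ}
  {m : Measure (CSpace N)}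

theorem congr (hX : IsInvariantSpace e E p m) {f g : CSpace N → ℂ} (h : EqOn f g (unitBall N)) :
    E f = E g :=
  le_antisymm (hX.mono _ _ fun z hz => by rw [h hz]) (hX.mono _ _ fun z hz => by rw [h hz])

theorem ext (hX : IsInvariantSpace e E p m) {x y : X} (h : EqOn (e x) (e y) (unitBall N)) :
    x = y := by
  have h1 : ‖x - y‖ₑ = 0 := by
    rw [hX.enorm_eq, map_sub, hX.congr (g := (0 : ℂ) • (0 : CSpace N → ℂ)), hX.smul]
    · simp
    · intro z hz; simp [h hz]
  exact sub_eq_zero.1 (enorm_eq_zero.1 h1)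

theorem indicator_mem_holo {f : CSpace N → ℂ} (hf : DifferentiableOn ℂ f (unitBall N)) :
    (unitBall N).indicator f ∈ holo N :=
  ⟨hf.congr fun _ hz => indicator_of_mem hz f, fun _ hz => indicator_of_notMem hz f⟩

/-- Elements of the space vanish off the ball, so f is first cut off there; E sees only the values
on the ball. -/
theorem exists_eqOn (hX : IsInvariantSpace e E p m) {f : CSpace N → ℂ}
    (hf : DifferentiableOn ℂ f (unitBall N)) (hE : E f < ∞) :
    ∃ x, EqOn (e x) f (unitBall N) := by
  have h1 : EqOn ((unitBall N).indicator f) f (unitBall N) := fun z hz => indicator_of_mem hz f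
  obtain ⟨x, hx⟩ := hX.exists_of_lt_top _ (indicator_mem_holo hf) (by rwa [hX.congr h1])
  exact ⟨x, by rwa [hx]⟩

/-- A weighted composition operator with a norm bound on functions is a bounded operator. -/
theorem exists_isWComp (hX : IsInvariantSpace e E p m) {w : CSpace N → ℂ}
    {φ : CSpace N → CSpace N} (hw : DifferentiableOn ℂ w (unitBall N))
    (hφ : DifferentiableOn ℂ φ (unitBall N)) (hm : MapsTo φ (unitBall N) (unitBall N)) {C : ℝ}
    (hC0 : 0 ≤ C)
    (hC : ∀ f ∈ holo N, E (fun z => w z * f (φ z)) ≤ ENNReal.ofReal C * E f) :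
    ∃ S : X →L[ℂ] X, IsWComp e w φ S ∧ ∀ x, ‖S x‖ ≤ C * ‖x‖ := by
  have h1 : ∀ x, ∃ y, EqOn (e y) (fun z => w z * e x (φ z)) (unitBall N) := fun x => by
    refine hX.exists_eqOn (hw.mul ((hX.mem_holo x).1.comp hφ hm)) ?_
    refine (hC _ (hX.mem_holo x)).trans_lt (ENNReal.mul_lt_top ENNReal.ofReal_lt_top ?_)
    rw [← hX.enorm_eq]
    exact enorm_lt_top
  choose F hF using h1
  have hb : ∀ x, ‖F x‖ ≤ C * ‖x‖ := fun x => by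
    have h2 : ‖F x‖ₑ ≤ ENNReal.ofReal C * ‖x‖ₑ := by
      rw [hX.enorm_eq, hX.congr (hF x), hX.enorm_eq x]
      exact hC _ (hX.mem_holo x)
    rw [← ofReal_norm, ← ofReal_norm, ← ENNReal.ofReal_mul hC0,
      ENNReal.ofReal_le_ofReal_iff (by positivity)] at h2
    exact h2
  let S0 : X →ₗ[ℂ] X :=
    { toFun := F
      map_add' := fun x y => hX.ext fun z hz => by
        rw [hF _ hz, map_add, map_add, Pi.add_apply, hF x hz, hF y hz]
        simp only [Pi.add_apply, mul_add]
      map_smul' := fun c x => hX.ext fun z hz => by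
        rw [hF _ hz, map_smul, map_smul, RingHom.id_apply, Pi.smul_apply, hF x hz]
        simp only [Pi.smul_apply, smul_eq_mul, mul_left_comm] }
  exact ⟨S0.mkContinuous C hb, fun x z hz => hF x hz, hb⟩

theorem isWComp_comp {w₁ w₂ : CSpace N → ℂ} {φ₁ φ₂ : CSpace N → CSpace N} {S₁ S₂ : X →L[ℂ] X}
    (h₁ : IsWComp e w₁ φ₁ S₁) (h₂ : IsWComp e w₂ φ₂ S₂)
    (hm : MapsTo φ₁ (unitBall N) (unitBall N)) :
    IsWComp e (fun z => w₁ z * w₂ (φ₁ z)) (φ₂ ∘ φ₁) (S₁ * S₂) := fun x z hz => by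
  rw [mul_apply_eq_comp, h₁ _ z hz, h₂ _ _ (hm hz), mul_assoc]; rfl

theorem isWComp_pow {w : CSpace N → ℂ} {φ : CSpace N → CSpace N} {S : X →L[ℂ] X}
    (h : IsWComp e w φ S) (hm : MapsTo φ (unitBall N) (unitBall N)) (n : ℕ) :
    IsWComp e (fun z => ∏ k ∈ Finset.range n, w (φ^[k] z)) φ^[n] (S ^ n) := by
  induction n with
  | zero => intro x z hz; simp
  | succ n ih =>
    intro x z hz
    rw [pow_succ', mul_apply_eq_comp, h _ z hz, ih _ _ (hm hz)]
    simp only [Finset.prod_range_succ', Function.iterate_succ_apply, Function.iterate_zero_apply]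
    ring

theorem eq_one_of_isWComp (hX : IsInvariantSpace e E p m) {w : CSpace N → ℂ}
    {φ : CSpace N → CSpace N} {S : X →L[ℂ] X} (h : IsWComp e w φ S)
    (hw : ∀ z ∈ unitBall N, w z = 1) (hφ : ∀ z ∈ unitBall N, φ z = z) : S = 1 := by
  ext1 x
  exact hX.ext fun z hz => by rw [h x z hz, hw z hz, hφ z hz, one_mul]; rfl

theorem norm_le_of_norm_le (hX : IsInvariantSpace e E p m) {x y : X} {C : ℝ} (hC : 0 ≤ C)
    (h : ∀ z ∈ unitBall N, ‖e x z‖ ≤ C * ‖e y z‖) : ‖x‖ ≤ C * ‖y‖ := by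
  have h1 : ‖x‖ₑ ≤ ENNReal.ofReal C * ‖y‖ₑ := by
    rw [hX.enorm_eq, hX.enorm_eq y]
    refine (hX.mono _ ((C : ℂ) • e y) fun z hz => ?_).trans ?_
    · rw [Pi.smul_apply, norm_smul, Complex.norm_real, Real.norm_of_nonneg hC]
      exact h z hz
    · rw [hX.smul, ← ofReal_norm, Complex.norm_real, Real.norm_of_nonneg hC]
  rw [← ofReal_norm, ← ofReal_norm, ← ENNReal.ofReal_mul hC,
      ENNReal.ofReal_le_ofReal_iff (by positivity)] at h1
  exact h1

/-- Upper estimate of the spectral radius. -/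
theorem norm_le_of_mem_spectrum [CompleteSpace X] (hX : IsInvariantSpace e E p m)
    {φ : CSpace N → CSpace N} {a : CSpace N} {q : CSpace N → ℂ} {c : ℂ}
    (hsys : IsAbelSystem φ a q c) (hm : MapsTo φ (unitBall N) (unitBall N))
    {w h : CSpace N → ℂ} (hh : ContinuousOn h (closedBall 0 1)) {U T : X →L[ℂ] X}
    (hU : IsWComp e w φ U) (hU1 : ∀ x, ‖U x‖ ≤ ‖x‖) (hT : IsWComp e (fun z => h z * w z) φ T)
    {μ : ℂ} (hμ : μ ∈ spectrum ℂ T) : ‖μ‖ ≤ ‖h a‖ := by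
  refine le_of_forall_gt_imp_ge_of_dense fun r hr => ?_
  have hr0 : 0 < r := (norm_nonneg _).trans_lt hr
  obtain ⟨C, hC⟩ := hsys.exists_prod_bound hh hr
  have hC0 : 0 ≤ C := by
    have := hC a hsys.mem 0
    simp at this
    linarith
  have hUn : ∀ n x, ‖(U ^ n) x‖ ≤ ‖x‖ := by
    intro n
    induction n with
    | zero => intro x; simp
    | succ n ih =>
      intro x
      rw [pow_succ', mul_apply_eq_comp]
      exact (hU1 _).trans (ih x)
  -- T^n is the contraction U^n followed by multiplication by the product of h along the orbit, so
  -- the pointwise bound on products is an operator bound.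
  have hTn : ∀ n : ℕ, ‖T ^ n‖ ≤ C * r ^ n := by
    intro n
    refine ContinuousLinearMap.opNorm_le_bound _ (by positivity) fun x => ?_
    refine (hX.norm_le_of_norm_le (y := (U ^ n) x) (C := C * r ^ n) (by positivity)
      fun z hz => ?_).trans (by gcongr; exact hUn n x)
    rw [isWComp_pow hT hm n x z hz, isWComp_pow hU hm n x z hz]
    simp only [Finset.prod_mul_distrib, mul_assoc (∏ k ∈ Finset.range n, h (φ^[k] z))]
    rw [norm_mul]
    gcongr
    exact hC z (ball_subset_closedBall hz) n
  -- The norm of the identity is kept because X is not assumed nontrivial.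
  set D : ℝ := C * ‖(1 : X →L[ℂ] X)‖
  have hpow : ∀ n : ℕ, (‖μ‖ / r) ^ n ≤ D := by
    intro n
    have h1 := spectrum.norm_le_norm_mul_of_mem (spectrum.pow_mem_pow T n hμ)
    rw [norm_pow] at h1
    rw [div_pow, div_le_iff₀ (by positivity)]
    calc ‖μ‖ ^ n ≤ _ := h1
      _ ≤ (C * r ^ n) * ‖(1 : X →L[ℂ] X)‖ := by gcongr; exact hTn n
      _ = D * r ^ n := by ring
  by_contra hlt
  push Not at hlt
  have h1 : 1 < ‖μ‖ / r := by rwa [one_lt_div hr0]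
  obtain ⟨n, hn⟩ := pow_unbounded_of_one_lt D h1
  exact absurd (hpow n) (not_le.2 hn)

theorem ball_algebra_bounded {g : CSpace N → ℂ} (hg : DiffContOnCl ℂ g (unitBall N)) :
    ContinuousOn g (closedBall 0 1) := by
  have := hg.continuousOn
  rwa [closure_ball _ one_ne_zero] at this

theorem restrict_eq (hX : IsInvariantSpace e E p m) : m.restrict (closedBall 0 1) = m :=
  Measure.restrict_eq_self_of_ae_mem (by
    rw [ae_iff]; exact hX.compl_null)

theorem memLp (hX : IsInvariantSpace e E p m) {g : CSpace N → ℂ}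
    (hg : DiffContOnCl ℂ g (unitBall N)) : MemLp g 2 m := by
  have := hX.finite
  have hc := ball_algebra_bounded hg
  obtain ⟨b, hb⟩ := (isCompact_closedBall (0 : CSpace N) 1).exists_bound_of_continuousOn hc
  have hmeas : AEStronglyMeasurable g m := by
    rw [← hX.restrict_eq]
    exact hc.aestronglyMeasurable measurableSet_closedBall
  refine MemLp.of_bound hmeas b ?_
  rw [← hX.restrict_eq]
  filter_upwards [ae_restrict_mem measurableSet_closedBall] with z hz using hb z hz

theorem exists_of_diffContOnCl (hX : IsInvariantSpace e E p m) {g : CSpace N → ℂ}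
    (hg : DiffContOnCl ℂ g (unitBall N)) : ∃ x, EqOn (e x) g (unitBall N) := by
  refine hX.exists_eqOn hg.differentiableOn ?_
  rw [hX.boundary g hg]
  exact (hX.memLp hg).2

theorem norm_eq (hX : IsInvariantSpace e E p m) {g : CSpace N → ℂ}
    (hg : DiffContOnCl ℂ g (unitBall N)) {x : X} (hx : EqOn (e x) g (unitBall N)) :
    ‖x‖ₑ = eLpNorm g 2 m := by
  rw [hX.enorm_eq, hX.congr hx, hX.boundary g hg]

theorem norm_sq_eq (hX : IsInvariantSpace e E p m) {g : CSpace N → ℂ}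
    (hg : DiffContOnCl ℂ g (unitBall N)) {x : X} (hx : EqOn (e x) g (unitBall N)) :
    ‖x‖ ^ 2 = ∫ z, ‖g z‖ ^ 2 ∂m := by
  have h1 := hX.norm_eq hg hx
  have h2 := (hX.memLp hg).eLpNorm_eq_integral_rpow_norm two_ne_zero ENNReal.ofNat_ne_top
  rw [h2, ← ofReal_norm, ENNReal.ofReal_eq_ofReal_iff (norm_nonneg _) (by positivity)] at h1
  simp only [ENNReal.toReal_ofNat, Real.rpow_ofNat] at h1
  rw [h1, ← Real.rpow_natCast, ← Real.rpow_mul (integral_nonneg fun _ => by positivity)]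
  norm_num

/-- Self-maps of the closed ball act on the ball algebra by composition. -/
theorem diffContOnCl_comp {g : CSpace N → ℂ} (hg : DiffContOnCl ℂ g (unitBall N))
    {φ : CSpace N → CSpace N} (hφd : DifferentiableOn ℂ φ (unitBall N))
    (hφc : ContinuousOn φ (closedBall 0 1)) (hm : MapsTo φ (unitBall N) (unitBall N))
    (hmK : MapsTo φ (closedBall 0 1) (closedBall 0 1)) :
    DiffContOnCl ℂ (fun z => g (φ z)) (unitBall N) :=
  ⟨hg.differentiableOn.comp hφd hm, by
    rw [closure_ball _ one_ne_zero]
    exact (ball_algebra_bounded hg).comp hφc hmK⟩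

theorem _root_.DiffContOnCl.fun_mul_complex {f g : CSpace N → ℂ} {s : Set (CSpace N)}
    (hf : DiffContOnCl ℂ f s) (hg : DiffContOnCl ℂ g s) :
    DiffContOnCl ℂ (fun z => f z * g z) s :=
  ⟨hf.differentiableOn.mul hg.differentiableOn, hf.continuousOn.mul hg.continuousOn⟩

end IsInvariantSpace

end Abstract

/-! ### Limits of conjugated operators, peak functions and almost orthogonality -/

section Abstract

variable {N : ℕ} {X : Type*} [NormedAddCommGroup X] [NormedSpace ℂ X]

/-- `φ` and `η` are mutually inverse automorphisms whose orbits converge to `a`, as witnessed by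
the solution `q` of an Abel equation. -/
structure IsParabolicPair (φ η : CSpace N → CSpace N) (a : CSpace N) (q : CSpace N → ℂ) (c : ℂ) :
    Prop where
  sys : IsAbelSystem φ a q c
  sys_inv : IsAbelSystem η a q (-c)
  diff : DifferentiableOn ℂ φ (unitBall N)
  diff_inv : DifferentiableOn ℂ η (unitBall N)
  maps : MapsTo φ (unitBall N) (unitBall N)
  maps_inv : MapsTo η (unitBall N) (unitBall N)
  left_inv : LeftInvOn η φ (closedBall 0 1)
  right_inv : RightInvOn η φ (closedBall 0 1)

theorem IsParabolicPair.left_inv_iterate {φ η : CSpace N → CSpace N} {a : CSpace N}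
    {q : CSpace N → ℂ} {c : ℂ} (h : IsParabolicPair φ η a q c) (n : ℕ) :
    LeftInvOn η^[n] φ^[n] (closedBall 0 1) := by
  induction n with
  | zero => exact fun _ _ => rfl
  | succ n ih =>
    intro z hz
    rw [Function.iterate_succ_apply, Function.iterate_succ_apply',
      h.left_inv (h.sys.mapsTo_iterate n hz), ih hz]

namespace IsInvariantSpace

variable {e : X →ₗ[ℂ] (CSpace N → ℂ)} {E : (CSpace N → ℂ) → ℝ≥0∞} {p : ℝ}
  {m : Measure (CSpace N)} {φ η : CSpace N → CSpace N} {a : CSpace N} {q : CSpace N → ℂ} {c : ℂ}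
  {w h : CSpace N → ℂ} {U T : X →L[ℂ] X}

theorem norm_pow_apply (hU : ∀ x, ‖U x‖ = ‖x‖) (n : ℕ) (x : X) : ‖(U ^ n) x‖ = ‖x‖ := by
  induction n with
  | zero => simp
  | succ n ih => rw [pow_succ', mul_apply_eq_comp, hU, ih]

/-- Away from the spectrum, elements of the ball algebra obey a lower estimate for the limit of
the conjugates of `T` by powers of `U`. -/
theorem exists_norm_le_of_notMem_spectrum (hX : IsInvariantSpace e E p m)
    (hp : IsParabolicPair φ η a q c) (hw : DiffContOnCl ℂ w (unitBall N))
    (hh : DiffContOnCl ℂ h (unitBall N)) (hU : IsWComp e w φ U) (hU1 : ∀ x, ‖U x‖ = ‖x‖)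
    (hT : IsWComp e (fun z => h z * w z) φ T) {μ θ : ℂ} (hμ : μ ∉ spectrum ℂ T)
    (hθ : μ = h a * θ) :
    ∃ C : ℝ, 0 ≤ C ∧ ∀ x g, DiffContOnCl ℂ g (unitBall N) → EqOn (e x) g (unitBall N) →
      ‖x‖ ≤ C * ‖U x - θ • x‖ := by
  rw [spectrum.notMem_iff] at hμ
  obtain ⟨u, hu⟩ := hμ
  set R : X →L[ℂ] X := ↑u⁻¹ with hR
  have hRx : ∀ x, ‖x‖ ≤ ‖R‖ * ‖μ • x - T x‖ := by
    intro x
    have h1 : (R * u) x = x := by rw [hR, Units.inv_mul]; rfl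
    have h2 : (u : X →L[ℂ] X) x = μ • x - T x := by
      rw [hu]; simp [Algebra.algebraMap_eq_smul_one]
    rw [mul_apply_eq_comp, h2] at h1
    calc ‖x‖ = ‖R (μ • x - T x)‖ := by rw [h1]
      _ ≤ _ := R.le_opNorm _
  refine ⟨‖R‖ * ‖h a‖, by positivity, fun x g hg hxg => ?_⟩
  set gU : CSpace N → ℂ := fun z => w z * g (φ z) with hgU
  have hgUd : DiffContOnCl ℂ gU (unitBall N) :=
    hw.fun_mul_complex (diffContOnCl_comp hg hp.diff hp.sys.continuousOn hp.maps hp.sys.mapsTo)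
  have hxU : EqOn (e (U x)) gU (unitBall N) := fun z hz => by
    rw [hU x z hz, hxg (hp.maps hz)]
  -- This function represents U^{-n} T U^n x - h(a) Ux. Applying U^n to it and using η^n ∘ φ^n = id
  -- turns h ∘ η^n back into h.
  set k : ℕ → CSpace N → ℂ := fun n z => (h (η^[n] z) - h a) * gU z with hk
  have hkd : ∀ n, DiffContOnCl ℂ (k n) (unitBall N) := fun n =>
    ((diffContOnCl_comp hh (hp.diff_inv.iterate hp.maps_inv n)
      (hp.sys_inv.continuousOn_iterate n) (hp.maps_inv.iterate n)
      (hp.sys_inv.mapsTo_iterate n)).sub_const (h a)).fun_mul_complex hgUd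
  choose y hy using fun n => hX.exists_of_diffContOnCl (hkd n)
  have key : ∀ n, T ((U ^ n) x) = h a • (U ^ n) (U x) + (U ^ n) (y n) := by
    intro n
    refine hX.ext fun z hz => ?_
    have hzK := ball_subset_closedBall hz
    have hzn := hp.maps.iterate n hz
    have h1 : e ((U ^ n) (U x)) z = w z * e ((U ^ n) x) (φ z) := by
      rw [← hU _ z hz, ← mul_apply_eq_comp, ← mul_apply_eq_comp, ← pow_succ, ← pow_succ']
    have h2 := isWComp_pow hU hp.maps n (U x) z hz
    have h3 := isWComp_pow hU hp.maps n (y n) z hz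
    simp only at h2 h3
    rw [hy n hzn] at h3
    simp only [hk] at h3
    rw [hp.left_inv_iterate n hzK, ← hxU hzn] at h3
    rw [map_add, map_smul, Pi.add_apply, Pi.smul_apply, smul_eq_mul, hT _ z hz, mul_assoc, ← h1,
      h3, h2]
    ring
  -- The resolvent bound is applied to U^n x instead of x; as U is isometric, every power of U then
  -- drops out.
  have hn : ∀ n, ‖x‖ ≤ ‖R‖ * (‖h a‖ * ‖U x - θ • x‖ + ‖y n‖) := by
    intro n
    have h1 := hRx ((U ^ n) x)
    have h2 : μ • (U ^ n) x - T ((U ^ n) x) = (U ^ n) (-(h a • (U x - θ • x) + y n)) := by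
      rw [key, hθ]
      simp only [map_neg, map_add, map_smul, map_sub, smul_sub, mul_smul]
      abel
    rw [h2, norm_pow_apply hU1, norm_pow_apply hU1, norm_neg] at h1
    refine h1.trans ?_
    gcongr
    exact (norm_add_le _ _).trans (by rw [norm_smul])
  -- The orbits of η converge to a at every point of the closed ball, sphere included, so dominated
  -- convergence applies in L²(m) even when m lives on the sphere. Membership in the ball algebra is
  -- what makes the norm an L²(m) norm here.
  have hlim : Filter.Tendsto (fun n => ‖y n‖) Filter.atTop (𝓝 0) := by
    have hfin := hX.finite
    have hhc := ball_algebra_bounded hh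
    have hgc := ball_algebra_bounded hgUd
    obtain ⟨b, hb⟩ := (isCompact_closedBall (0 : CSpace N) 1).exists_bound_of_continuousOn hhc
    obtain ⟨b', hb'⟩ := (isCompact_closedBall (0 : CSpace N) 1).exists_bound_of_continuousOn hgc
    have haK := hp.sys.mem
    have hb0 : 0 ≤ b := (norm_nonneg _).trans (hb a haK)
    have hae : ∀ᵐ z ∂m, z ∈ closedBall (0 : CSpace N) 1 := by
      rw [ae_iff]; exact hX.compl_null
    have h1 : Filter.Tendsto (fun n => ∫ z, ‖k n z‖ ^ 2 ∂m) Filter.atTop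
        (𝓝 (∫ z, (0 : ℝ) ∂m)) := by
      refine tendsto_integral_of_dominated_convergence (fun _ => ((2 * b) * b') ^ 2)
        (fun n => ((hX.memLp (hkd n)).1.norm.pow 2)) (integrable_const _) (fun n => ?_) ?_
      · filter_upwards [hae] with z hz
        rw [Real.norm_of_nonneg (by positivity)]
        refine pow_le_pow_left₀ (norm_nonneg _) ?_ 2
        rw [norm_mul]
        refine mul_le_mul ?_ (hb' z hz) (norm_nonneg _) (by positivity)
        refine (norm_sub_le _ _).trans ?_
        linarith [hb _ (hp.sys_inv.mapsTo_iterate n hz), hb a haK]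
      · filter_upwards [hae] with z hz
        have h2 : Filter.Tendsto (fun n => h (η^[n] z)) Filter.atTop (𝓝 (h a)) := by
          refine (hhc a haK).tendsto.comp (tendsto_nhdsWithin_iff.2
            ⟨hp.sys_inv.tendsto_iterate hz, Filter.Eventually.of_forall fun n =>
              hp.sys_inv.mapsTo_iterate n hz⟩)
        have h3 := (((h2.sub_const (h a)).mul_const (gU z)).norm.pow 2)
        simpa [hk] using h3
    rw [integral_zero] at h1
    have h4 : ∀ n, ‖y n‖ = Real.sqrt (∫ z, ‖k n z‖ ^ 2 ∂m) := fun n => by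
      rw [← hX.norm_sq_eq (hkd n) (hy n), Real.sqrt_sq (norm_nonneg _)]
    simp only [h4]
    simpa using h1.sqrt
  have h5 := ((hlim.const_add (‖h a‖ * ‖U x - θ • x‖)).const_mul ‖R‖)
  rw [add_zero, ← mul_assoc] at h5
  exact ge_of_tendsto h5 (Filter.Eventually.of_forall hn)

/-- A peak function for the point `ζ` of the sphere. -/
def peak (ζ z : CSpace N) : ℂ := (1 + inner ℂ ζ z) / 2

theorem differentiable_peak (ζ : CSpace N) : Differentiable ℂ (peak ζ) := by
  have h : peak ζ = fun z => (1 + (innerSL ℂ ζ) z) / 2 := by ext z; simp [peak]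
  rw [h]
  fun_prop

theorem norm_peak_le {ζ z : CSpace N} (hζ : ‖ζ‖ = 1) (hz : ‖z‖ ≤ 1) : ‖peak ζ z‖ ≤ 1 := by
  have h1 : ‖inner ℂ ζ z‖ ≤ 1 := (norm_inner_le_norm _ _).trans (by rw [hζ, one_mul]; exact hz)
  have h2 : ‖1 + inner ℂ ζ z‖ ≤ 1 + 1 := (norm_add_le _ _).trans (by rw [norm_one]; linarith)
  rw [peak, norm_div, Complex.norm_ofNat, div_le_one two_pos]
  linarith

/-- For |s| ≤ 1 the equality |1 + s| = 2 forces s = 1, here with s = ⟪ζ, z⟫. -/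
theorem eq_of_norm_peak_eq_one {ζ z : CSpace N} (hζ : ‖ζ‖ = 1) (hz : ‖z‖ ≤ 1)
    (h : ‖peak ζ z‖ = 1) : z = ζ := by
  have h1 : ‖inner ℂ ζ z‖ ≤ 1 := (norm_inner_le_norm _ _).trans (by rw [hζ, one_mul]; exact hz)
  rw [peak, norm_div, Complex.norm_ofNat, div_eq_one_iff_eq two_ne_zero] at h
  set s := inner ℂ ζ z with hs
  have h2 : ‖1 + s‖ ^ 2 = 4 := by rw [h]; norm_num
  have h3 : ‖s‖ ^ 2 ≤ 1 := by nlinarith [norm_nonneg s]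
  rw [← Complex.normSq_eq_norm_sq, Complex.normSq_apply] at h2 h3
  simp only [Complex.add_re, Complex.one_re, Complex.add_im, Complex.one_im, zero_add] at h2
  have h4 : s.re = 1 := by nlinarith [sq_nonneg s.im, sq_nonneg (s.re - 1)]
  have h5 : s.im = 0 := by
    have : s.im * s.im ≤ 0 := by nlinarith
    nlinarith [mul_self_nonneg s.im, mul_self_eq_zero.1 (le_antisymm this (mul_self_nonneg s.im))]
  have h6 : s = 1 := Complex.ext h4 h5
  have h7 := norm_sub_sq_le_of_mem_closedBall hζ hz
  rw [← hs, h6, sub_self, norm_zero, mul_zero] at h7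
  have h8 : ‖z - ζ‖ = 0 := pow_eq_zero_iff two_ne_zero |>.1 (le_antisymm h7 (sq_nonneg _))
  exact sub_eq_zero.1 (norm_eq_zero.1 h8)

/-- If at most one of `n` complex numbers is not small, then the sum of their squared moduli is
controlled by the modulus of their sum. -/
theorem sum_norm_sq_le {n : ℕ} {u : ℕ → ℂ} {ε : ℝ} (hε : 0 ≤ ε)
    (h : ∀ i ∈ Finset.range n, ∀ j ∈ Finset.range n, i ≠ j → min ‖u i‖ ‖u j‖ ≤ ε) :
    ∑ i ∈ Finset.range n, ‖u i‖ ^ 2 ≤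
      2 * ‖∑ i ∈ Finset.range n, u i‖ ^ 2 + 3 * (n * ε) ^ 2 := by
  classical
  rcases Nat.eq_zero_or_pos n with rfl | hn
  · simp
  have hn1 : (1 : ℝ) ≤ n := by exact_mod_cast hn
  have hn2 : (n : ℝ) * ε ^ 2 ≤ (n * ε) ^ 2 := by
    rw [mul_pow]
    nlinarith [sq_nonneg ε, mul_nonneg (by linarith : (0 : ℝ) ≤ n) (sq_nonneg ε)]
  have hsmall : ∀ s : Finset ℕ, s ⊆ Finset.range n → (∀ i ∈ s, ‖u i‖ ≤ ε) →
      ∑ i ∈ s, ‖u i‖ ^ 2 ≤ n * ε ^ 2 ∧ ‖∑ i ∈ s, u i‖ ≤ n * ε := by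
    intro s hs hsε
    have hc : (s.card : ℝ) ≤ n := by
      exact_mod_cast (Finset.card_le_card hs).trans (by simp)
    constructor
    · calc ∑ i ∈ s, ‖u i‖ ^ 2 ≤ ∑ i ∈ s, ε ^ 2 := Finset.sum_le_sum fun i hi =>
            pow_le_pow_left₀ (norm_nonneg _) (hsε i hi) 2
        _ = s.card * ε ^ 2 := by simp
        _ ≤ n * ε ^ 2 := by gcongr
    · calc ‖∑ i ∈ s, u i‖ ≤ ∑ i ∈ s, ‖u i‖ := norm_sum_le _ _
        _ ≤ ∑ i ∈ s, ε := Finset.sum_le_sum hsε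
        _ = s.card * ε := by simp
        _ ≤ n * ε := by gcongr
  by_cases hall : ∀ i ∈ Finset.range n, ‖u i‖ ≤ ε
  · have := (hsmall _ subset_rfl hall).1
    nlinarith [norm_nonneg (∑ i ∈ Finset.range n, u i)]
  · push Not at hall
    obtain ⟨j, hj, hjε⟩ := hall
    have hoth := hsmall ((Finset.range n).erase j) (Finset.erase_subset _ _) fun i hi => by
      obtain ⟨hij, hi'⟩ := Finset.mem_erase.1 hi
      have := h i hi' j hj hij
      rcases min_le_iff.1 this with h1 | h1
      · exact h1
      · exact absurd h1 (not_le.2 hjε)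
    rw [← Finset.add_sum_erase _ _ hj]
    rw [← Finset.add_sum_erase _ u hj]
    set S := ∑ i ∈ (Finset.range n).erase j, u i
    -- The exceptional term contributes at most 2|∑ u|² + 2(nε)², and all the others together at
    -- most nε² ≤ (nε)², as n ≥ 1.
    have h1 : ‖u j‖ ≤ ‖u j + S‖ + n * ε := by
      calc ‖u j‖ = ‖(u j + S) - S‖ := by rw [add_sub_cancel_right]
        _ ≤ ‖u j + S‖ + ‖S‖ := norm_sub_le _ _
        _ ≤ _ := by linarith [hoth.2]
    have h2 : ‖u j‖ ^ 2 ≤ (‖u j + S‖ + n * ε) ^ 2 := pow_le_pow_left₀ (norm_nonneg _) h1 2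
    nlinarith [hoth.1, sq_nonneg (‖u j + S‖ - n * ε)]

end IsInvariantSpace

end Abstract

/-! ### Almost eigenvectors and the spectral circle -/

section Abstract

variable {N : ℕ} {X : Type*} [NormedAddCommGroup X] [NormedSpace ℂ X]

namespace IsInvariantSpace

variable {e : X →ₗ[ℂ] (CSpace N → ℂ)} {E : (CSpace N → ℂ) → ℝ≥0∞} {p : ℝ}
  {m : Measure (CSpace N)} {φ η : CSpace N → CSpace N} {a : CSpace N} {q : CSpace N → ℂ} {c : ℂ}
  {w h : CSpace N → ℂ} {U T : X →L[ℂ] X}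

/-- Two iterates of a point of the closed ball are not both close to `ζ ≠ a`. -/
theorem eventually_min_norm_peak_le (hsys : IsAbelSystem φ a q c) {ζ : CSpace N} (hζ : ‖ζ‖ = 1)
    (hζa : ζ ≠ a) {i j : ℕ} (hij : i ≠ j) :
    ∀ᶠ ρ in 𝓝[<] (1 : ℝ), ∀ z ∈ closedBall (0 : CSpace N) 1,
      min ‖peak ζ (φ^[i] z)‖ ‖peak ζ (φ^[j] z)‖ ≤ ρ := by
  have hc : ∀ k, ContinuousOn (fun z => ‖peak ζ (φ^[k] z)‖) (closedBall 0 1) := fun k =>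
    ((differentiable_peak ζ).continuous.comp_continuousOn (hsys.continuousOn_iterate k)).norm
  obtain ⟨z₀, hz₀, hmax⟩ := (isCompact_closedBall (0 : CSpace N) 1).exists_isMaxOn
    ⟨a, hsys.mem⟩ (f := fun z => min ‖peak ζ (φ^[i] z)‖ ‖peak ζ (φ^[j] z)‖) ((hc i).inf (hc j))
  have hle : ∀ k, ‖peak ζ (φ^[k] z₀)‖ ≤ 1 := fun k =>
    norm_peak_le hζ (by simpa using hsys.mapsTo_iterate k hz₀)
  -- Value 1 would mean that both iterates of z₀ equal ζ. Since ζ ≠ a, also z₀ ≠ a, and orbits off a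
  -- do not repeat.
  have hlt : min ‖peak ζ (φ^[i] z₀)‖ ‖peak ζ (φ^[j] z₀)‖ < 1 := by
    by_contra hge
    push Not at hge
    have hge' := le_min_iff.1 hge
    have h1 := eq_of_norm_peak_eq_one hζ (by simpa using hsys.mapsTo_iterate i hz₀)
      (le_antisymm (hle i) hge'.1)
    have h2 := eq_of_norm_peak_eq_one hζ (by simpa using hsys.mapsTo_iterate j hz₀)
      (le_antisymm (hle j) hge'.2)
    have hza : z₀ ≠ a := by
      rintro rfl
      rw [Function.iterate_fixed hsys.map_fixed] at h1
      exact hζa h1.symm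
    exact hij (hsys.injective_iterate hz₀ hza (h1.trans h2.symm))
  filter_upwards [nhdsWithin_le_nhds (eventually_ge_nhds hlt)] with ρ hρ z hz
  exact (hmax hz).trans hρ

theorem diffContOnCl_prod (hp : IsParabolicPair φ η a q c) (hw : DiffContOnCl ℂ w (unitBall N))
    (j : ℕ) : DiffContOnCl ℂ (fun z => ∏ k ∈ Finset.range j, w (φ^[k] z)) (unitBall N) := by
  induction j with
  | zero => simpa using diffContOnCl_const
  | succ j ih =>
    simp only [Finset.prod_range_succ]
    exact ih.fun_mul_complex (diffContOnCl_comp hw (hp.diff.iterate hp.maps j)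
      (hp.sys.continuousOn_iterate j) (hp.maps.iterate j) (hp.sys.mapsTo_iterate j))

theorem diffContOnCl_sum {ι : Type*} (s : Finset ι) {f : ι → CSpace N → ℂ}
    (hf : ∀ i ∈ s, DiffContOnCl ℂ (f i) (unitBall N)) :
    DiffContOnCl ℂ (fun z => ∑ i ∈ s, f i z) (unitBall N) :=
  ⟨DifferentiableOn.fun_sum fun i hi => (hf i hi).differentiableOn,
    continuousOn_finsetSum _ fun i hi => (hf i hi).continuousOn⟩

/-- Elements of the ball algebra that are almost eigenvectors of the isometry `U`. -/
theorem exists_almost_eigenvector (hX : IsInvariantSpace e E p m)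
    (hp : IsParabolicPair φ η a q c) (hw : DiffContOnCl ℂ w (unitBall N))
    (hU : IsWComp e w φ U) (hU1 : ∀ x, ‖U x‖ = ‖x‖) {ζ : CSpace N} (hζ : ‖ζ‖ = 1) (hζa : ζ ≠ a)
    {θ : ℂ} (hθ : ‖θ‖ = 1) (n : ℕ) :
    ∃ P F : X, P ≠ 0 ∧ (∃ g, DiffContOnCl ℂ g (unitBall N) ∧ EqOn (e F) g (unitBall N)) ∧
      ‖U F - θ • F‖ ≤ 2 * ‖P‖ ∧ n * ‖P‖ ^ 2 ≤ 4 * ‖F‖ ^ 2 := by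
  classical
  have hfin := hX.finite
  have hθ0 : θ ≠ 0 := by rw [← norm_ne_zero_iff, hθ]; exact one_ne_zero
  -- One ρ < 1 serves all finitely many pairs: at each z at most one of the n peak values along the
  -- orbit exceeds ρ.
  obtain ⟨ρ, ⟨hρ, hρ0⟩, hρ1⟩ : ∃ ρ : ℝ, ((∀ x ∈ (Finset.range n ×ˢ Finset.range n).filter
      (fun x : ℕ × ℕ => x.1 ≠ x.2), ∀ z ∈ closedBall (0 : CSpace N) 1,
      min ‖peak ζ (φ^[x.1] z)‖ ‖peak ζ (φ^[x.2] z)‖ ≤ ρ) ∧ 0 < ρ) ∧ ρ < 1 := by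
    have h1 := (Filter.eventually_all_finset ((Finset.range n ×ˢ Finset.range n).filter
      (fun x : ℕ × ℕ => x.1 ≠ x.2)) (l := 𝓝[<] (1 : ℝ)) (p := fun x ρ => ∀ z ∈ closedBall (0 : CSpace N) 1,
      min ‖peak ζ (φ^[x.1] z)‖ ‖peak ζ (φ^[x.2] z)‖ ≤ ρ)).2 fun x hx =>
      eventually_min_norm_peak_le hp.sys hζ hζa (Finset.mem_filter.1 hx).2
    have h2 : ∀ᶠ ρ in 𝓝[<] (1 : ℝ), 0 < ρ := nhdsWithin_le_nhds (eventually_gt_nhds one_pos)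
    exact ((h1.and h2).and self_mem_nhdsWithin).exists
  -- The gap between ρ and ρ' is the gain: small summands are at most Bρ^k, while ‖P‖² is at least
  -- ρ'^(2k) m(O).
  obtain ⟨ρ', hρρ', hρ'1⟩ := exists_between hρ1
  have hρ'0 : 0 < ρ' := hρ0.trans hρρ'
  set O : Set (CSpace N) := {z | ρ' < ‖peak ζ z‖} with hO
  have hOo : IsOpen O := isOpen_lt continuous_const (differentiable_peak ζ).continuous.norm
  have hζO : ζ ∈ O := by
    have h1 : peak ζ ζ = 1 := by
      rw [peak, inner_self_eq_norm_sq_to_K, hζ]; norm_num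
    simpa [hO, h1] using hρ'1
  have hmO : 0 < m.real O :=
    ENNReal.toReal_pos (hX.open_pos ζ (by simpa using hζ) O hOo hζO) (measure_ne_top _ _)
  obtain ⟨b, hb⟩ := (isCompact_closedBall (0 : CSpace N) 1).exists_bound_of_continuousOn
    (ball_algebra_bounded hw)
  set B : ℝ := max b 1 ^ n with hB
  have hB1 : 1 ≤ max b 1 := le_max_right _ _
  have hB0 : 0 < B := by positivity
  have hWb : ∀ j ∈ Finset.range n, ∀ z ∈ closedBall (0 : CSpace N) 1,
      ‖∏ k ∈ Finset.range j, w (φ^[k] z)‖ ≤ B := by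
    intro j hj z hz
    rw [norm_prod]
    calc ∏ k ∈ Finset.range j, ‖w (φ^[k] z)‖ ≤ ∏ k ∈ Finset.range j, max b 1 :=
          Finset.prod_le_prod (fun _ _ => norm_nonneg _) fun k _ =>
            (hb _ (hp.sys.mapsTo_iterate k hz)).trans (le_max_left _ _)
      _ = max b 1 ^ j := by simp
      _ ≤ B := pow_le_pow_right₀ hB1 (Finset.mem_range.1 hj).le
  -- This k makes the error in `sum_norm_sq_le`, integrated over m, at most (n/2)‖P‖². It can then
  -- be absorbed: n‖P‖² ≤ 2‖F‖² + (n/2)‖P‖² gives the factor 4.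
  obtain ⟨k, hk⟩ : ∃ k : ℕ, 3 * (n * (B * ρ ^ k)) ^ 2 * m.real univ ≤
      n / 2 * ((ρ' ^ k) ^ 2 * m.real O) := by
    rcases Nat.eq_zero_or_pos n with rfl | hn
    · exact ⟨0, by simp⟩
    have hn0 : (0 : ℝ) < n := by exact_mod_cast hn
    have hr : Filter.Tendsto (fun k : ℕ => ((ρ / ρ') ^ 2) ^ k * (3 * (n * B) ^ 2 * m.real univ))
        Filter.atTop (𝓝 (0 * (3 * (n * B) ^ 2 * m.real univ))) :=
      (tendsto_pow_atTop_nhds_zero_of_lt_one (by positivity)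
        (pow_lt_one₀ (by positivity) (by rwa [div_lt_one hρ'0]) two_ne_zero)).mul_const _
    rw [zero_mul] at hr
    have hpos : 0 < n / 2 * m.real O := by positivity
    obtain ⟨k, hk⟩ := (hr.eventually_le_const hpos).exists
    refine ⟨k, ?_⟩
    have e1 : ((ρ / ρ') ^ 2) ^ k = (ρ ^ k) ^ 2 / (ρ' ^ k) ^ 2 := by
      rw [← pow_mul, div_pow, ← pow_mul, ← pow_mul, mul_comm 2 k]
    rw [e1, div_mul_eq_mul_div, div_le_iff₀ (by positivity)] at hk
    calc _ = (ρ ^ k) ^ 2 * (3 * (n * B) ^ 2 * m.real univ) := by ring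
      _ ≤ _ := hk
      _ = _ := by ring
  have hpkd : DiffContOnCl ℂ (fun z => peak ζ z ^ k) (unitBall N) :=
    ((differentiable_peak ζ).pow k).diffContOnCl
  obtain ⟨P, hP⟩ := hX.exists_of_diffContOnCl hpkd
  have hPsq := hX.norm_sq_eq hpkd hP
  have hPlow : (ρ' ^ k) ^ 2 * m.real O ≤ ‖P‖ ^ 2 := by
    rw [hPsq]
    have hint : Integrable (fun z => ‖peak ζ z ^ k‖ ^ 2) m := (hX.memLp hpkd).integrable_norm_pow'
    calc (ρ' ^ k) ^ 2 * m.real O = ∫ z in O, (ρ' ^ k) ^ 2 ∂m := by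
          rw [setIntegral_const, smul_eq_mul, mul_comm]
      _ ≤ ∫ z in O, ‖peak ζ z ^ k‖ ^ 2 ∂m := by
          refine setIntegral_mono_on (integrable_const _).integrableOn hint.integrableOn
            hOo.measurableSet fun z hz => ?_
          rw [norm_pow]
          have : ρ' ≤ ‖peak ζ z‖ := le_of_lt hz
          gcongr
      _ ≤ ∫ z, ‖peak ζ z ^ k‖ ^ 2 ∂m :=
          setIntegral_le_integral hint (Filter.Eventually.of_forall fun _ => by positivity)
  have hP0 : P ≠ 0 := by
    rintro rfl
    have : 0 < (ρ' ^ k) ^ 2 * m.real O := by positivity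
    simp at hPlow
    linarith
  set u : ℕ → CSpace N → ℂ := fun j z =>
    θ⁻¹ ^ j * ((∏ k ∈ Finset.range j, w (φ^[k] z)) * peak ζ (φ^[j] z) ^ k) with hu
  have hud : ∀ j, DiffContOnCl ℂ (u j) (unitBall N) := fun j =>
    diffContOnCl_const.fun_mul_complex ((diffContOnCl_prod hp hw j).fun_mul_complex
      (diffContOnCl_comp hpkd (hp.diff.iterate hp.maps j) (hp.sys.continuousOn_iterate j)
        (hp.maps.iterate j) (hp.sys.mapsTo_iterate j)))
  have hue : ∀ j, EqOn (e (θ⁻¹ ^ j • (U ^ j) P)) (u j) (unitBall N) := fun j z hz => by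
    rw [map_smul, Pi.smul_apply, isWComp_pow hU hp.maps j P z hz, hP (hp.maps.iterate j hz),
      smul_eq_mul]
  have hnorm : ∀ j, ‖θ⁻¹ ^ j • (U ^ j) P‖ = ‖P‖ := fun j => by
    rw [norm_smul, norm_pow_apply hU1, norm_pow, norm_inv, hθ]; simp
  -- A truncation of the formal eigenvector ∑ θ^{-j} U^j P; in UF - θF only the two end terms
  -- survive, each of norm ‖P‖.
  set F : X := ∑ j ∈ Finset.range n, θ⁻¹ ^ j • (U ^ j) P with hF
  have hFd : DiffContOnCl ℂ (fun z => ∑ j ∈ Finset.range n, u j z) (unitBall N) :=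
    diffContOnCl_sum _ fun j _ => hud j
  have hFe : EqOn (e F) (fun z => ∑ j ∈ Finset.range n, u j z) (unitBall N) := fun z hz => by
    rw [hF, map_sum, Finset.sum_apply]
    exact Finset.sum_congr rfl fun j _ => hue j hz
  refine ⟨P, F, hP0, ⟨_, hFd, hFe⟩, ?_, ?_⟩
  · have hUF : U F - θ • F = θ • (θ⁻¹ ^ n • (U ^ n) P - P) := by
      have h1 : U F = θ • ∑ j ∈ Finset.range n, θ⁻¹ ^ (j + 1) • (U ^ (j + 1)) P := by
        rw [hF, map_sum, Finset.smul_sum]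
        refine Finset.sum_congr rfl fun j _ => ?_
        rw [map_smul, pow_succ' U, mul_apply_eq_comp, smul_smul, pow_succ', ← mul_assoc,
          mul_inv_cancel₀ hθ0, one_mul]
      rw [h1, hF, ← smul_sub, ← Finset.sum_sub_distrib,
        Finset.sum_range_sub (fun j => θ⁻¹ ^ j • (U ^ j) P)]
      simp
    rw [hUF, norm_smul, hθ, one_mul]
    refine (norm_sub_le _ _).trans ?_
    rw [hnorm]; linarith
  · have hint : ∀ {g : CSpace N → ℂ}, DiffContOnCl ℂ g (unitBall N) →
        Integrable (fun z => ‖g z‖ ^ 2) m := fun hg => (hX.memLp hg).integrable_norm_pow'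
    have hsum : n * ‖P‖ ^ 2 = ∫ z, ∑ j ∈ Finset.range n, ‖u j z‖ ^ 2 ∂m := by
      rw [integral_finsetSum _ fun j _ => hint (hud j)]
      simp only [← hX.norm_sq_eq (hud _) (hue _), hnorm]
      simp
    have hle : ∫ z, ∑ j ∈ Finset.range n, ‖u j z‖ ^ 2 ∂m ≤
        ∫ z, (2 * ‖∑ j ∈ Finset.range n, u j z‖ ^ 2 + 3 * (n * (B * ρ ^ k)) ^ 2) ∂m := by
      refine integral_mono_ae (integrable_finsetSum _ fun j _ => hint (hud j))
        (((hint hFd).const_mul 2).add (integrable_const _)) ?_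
      have hae : ∀ᵐ z ∂m, z ∈ closedBall (0 : CSpace N) 1 := by
        rw [ae_iff]; exact hX.compl_null
      filter_upwards [hae] with z hz
      refine sum_norm_sq_le (by positivity) fun i hi j hj hij => ?_
      have h1 := hρ (i, j) (Finset.mem_filter.2 ⟨Finset.mem_product.2 ⟨hi, hj⟩, hij⟩) z hz
      have hbd : ∀ l ∈ Finset.range n, ‖peak ζ (φ^[l] z)‖ ≤ ρ → ‖u l z‖ ≤ B * ρ ^ k := by
        intro l hl hlρ
        simp only [hu, norm_mul, norm_pow, norm_inv, hθ, inv_one, one_pow, one_mul]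
        exact mul_le_mul (hWb l hl z hz) (pow_le_pow_left₀ (norm_nonneg _) hlρ k) (by positivity)
          hB0.le
      rcases min_le_iff.1 h1 with h2 | h2
      · exact (min_le_left _ _).trans (hbd i hi h2)
      · exact (min_le_right _ _).trans (hbd j hj h2)
    rw [integral_add ((hint hFd).const_mul 2) (integrable_const _), integral_const_mul,
      integral_const, ← hX.norm_sq_eq hFd hFe, smul_eq_mul, ← hsum, mul_comm (m.real univ)] at hle
    have h3 : (n : ℝ) / 2 * ((ρ' ^ k) ^ 2 * m.real O) ≤ n / 2 * ‖P‖ ^ 2 := by gcongr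
    linarith

/-- The spectrum of a weighted composition operator with a parabolic symbol. -/
theorem spectrum_eq [NeZero N] [CompleteSpace X] (hX : IsInvariantSpace e E p m)
    (hp : IsParabolicPair φ η a q c) (hw : DiffContOnCl ℂ w (unitBall N))
    (hw0 : ∀ z ∈ closedBall (0 : CSpace N) 1, w z ≠ 0)
    (hh : DiffContOnCl ℂ h (unitBall N)) (hh0 : ∀ z ∈ closedBall (0 : CSpace N) 1, h z ≠ 0)
    {V : X →L[ℂ] X} (hU : IsWComp e w φ U) (hU1 : ∀ x, ‖U x‖ ≤ ‖x‖)
    (hV : IsWComp e (fun z => (w (η z))⁻¹) η V) (hV1 : ∀ x, ‖V x‖ ≤ ‖x‖) :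
    ∃ T : X →L[ℂ] X, IsWComp e (fun z => h z * w z) φ T ∧
      spectrum ℂ T = {μ : ℂ | ‖μ‖ = ‖h a‖} := by
  have hmul : ∀ g : CSpace N → ℂ, DiffContOnCl ℂ g (unitBall N) →
      ∃ S : X →L[ℂ] X, IsWComp e g id S := by
    intro g hg
    obtain ⟨b, hb⟩ := (isCompact_closedBall (0 : CSpace N) 1).exists_bound_of_continuousOn
      (ball_algebra_bounded hg)
    have hb0 : 0 ≤ b := (norm_nonneg _).trans (hb a hp.sys.mem)
    obtain ⟨S, hS, -⟩ := hX.exists_isWComp (φ := id) (C := b) hg.differentiableOn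
      differentiableOn_id (mapsTo_id _) hb0 fun f _ => by
        refine (hX.mono _ ((b : ℂ) • f) fun z hz => ?_).trans_eq ?_
        · rw [Pi.smul_apply, norm_smul, norm_mul, Complex.norm_real, Real.norm_of_nonneg hb0]
          gcongr
          · exact hb z (ball_subset_closedBall hz)
          · rfl
        · rw [hX.smul, ← ofReal_norm, Complex.norm_real, Real.norm_of_nonneg hb0]
    exact ⟨S, hS⟩
  set h' : CSpace N → ℂ := fun z => (h (η z))⁻¹ with hh'
  have hinv : ∀ g : CSpace N → ℂ, DiffContOnCl ℂ g (unitBall N) →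
      (∀ z ∈ closedBall (0 : CSpace N) 1, g z ≠ 0) →
      DiffContOnCl ℂ (fun z => (g (η z))⁻¹) (unitBall N) := by
    intro g hg hg0
    have h1 := diffContOnCl_comp hg hp.diff_inv hp.sys_inv.continuousOn hp.maps_inv
      hp.sys_inv.mapsTo
    refine ⟨h1.differentiableOn.inv fun z hz =>
      hg0 _ (ball_subset_closedBall (hp.maps_inv hz)), h1.continuousOn.inv₀ fun z hz => ?_⟩
    rw [closure_ball _ one_ne_zero] at hz
    exact hg0 _ (hp.sys_inv.mapsTo hz)
  have hh'd : DiffContOnCl ℂ h' (unitBall N) := hinv h hh hh0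
  obtain ⟨A, hA⟩ := hmul h hh
  obtain ⟨A', hA'⟩ := hmul h' hh'd
  have hT : IsWComp e (fun z => h z * w z) φ (A * U) := isWComp_comp hA hU (mapsTo_id _)
  have hS : IsWComp e (fun z => h' z * (w (η z))⁻¹) η (A' * V) :=
    isWComp_comp hA' hV (mapsTo_id _)
  set T := A * U with hTdef
  set S := A' * V with hSdef
  have hK := fun {z : CSpace N} (hz : z ∈ unitBall N) => ball_subset_closedBall hz
  have hVU : V * U = 1 := hX.eq_one_of_isWComp (isWComp_comp hV hU hp.maps_inv)
    (fun z hz => inv_mul_cancel₀ (hw0 _ (hp.sys_inv.mapsTo (hK hz))))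
    (fun z hz => hp.right_inv (hK hz))
  have hTS : T * S = 1 := hX.eq_one_of_isWComp (isWComp_comp hT hS hp.maps)
    (fun z hz => by
      have h1 := hw0 z (hK hz)
      have h2 := hh0 z (hK hz)
      simp only [hh', hp.left_inv (hK hz)]
      field_simp)
    (fun z hz => hp.left_inv (hK hz))
  have hST : S * T = 1 := hX.eq_one_of_isWComp (isWComp_comp hS hT hp.maps_inv)
    (fun z hz => by
      have h1 := hw0 _ (hp.sys_inv.mapsTo (hK hz))
      have h2 := hh0 _ (hp.sys_inv.mapsTo (hK hz))
      simp only [hh']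
      field_simp)
    (fun z hz => hp.right_inv (hK hz))
  have hUiso : ∀ x, ‖U x‖ = ‖x‖ := fun x => by
    refine le_antisymm (hU1 x) ?_
    have : V (U x) = x := by rw [← mul_apply_eq_comp, hVU]; rfl
    calc ‖x‖ = ‖V (U x)‖ := by rw [this]
      _ ≤ ‖U x‖ := hV1 _
  have ha0 : h a ≠ 0 := hh0 a hp.sys.mem
  refine ⟨T, hT, Subset.antisymm (fun μ hμ => ?_) fun μ hμ => ?_⟩
  · refine le_antisymm (hX.norm_le_of_mem_spectrum hp.sys hp.maps (ball_algebra_bounded hh) hU hU1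
      hT hμ) ?_
    -- The lower bound is the spectral radius estimate for the inverse S, whose multiplier takes the
    -- value h(a)⁻¹ at a, because η fixes a.
    let Tu : (X →L[ℂ] X)ˣ := ⟨T, S, hTS, hST⟩
    have hμ0 : μ ≠ 0 := by
      rintro rfl
      exact spectrum.zero_notMem ℂ Tu.isUnit hμ
    have h1 : μ⁻¹ ∈ spectrum ℂ S := by
      have h2 := (spectrum.inv_mem_iff (r := Units.mk0 μ hμ0) (a := Tu)).1 hμ
      rwa [Units.val_inv_eq_inv_val, Units.val_mk0] at h2
    have h3 := hX.norm_le_of_mem_spectrum hp.sys_inv hp.maps_inv (ball_algebra_bounded hh'd) hV hV1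
      hS h1
    simp only [hh', hp.sys_inv.map_fixed, norm_inv] at h3
    exact (inv_le_inv₀ (norm_pos_iff.2 hμ0) (norm_pos_iff.2 ha0)).1 h3
  · by_contra hns
    set θ := μ / h a with hθ
    have hμθ : μ = h a * θ := by rw [hθ]; field_simp
    have hθ1 : ‖θ‖ = 1 := by
      rw [hθ, norm_div, show ‖μ‖ = ‖h a‖ from hμ, div_self (norm_ne_zero_iff.2 ha0)]
    obtain ⟨C, hC0, hC⟩ := hX.exists_norm_le_of_notMem_spectrum hp hw hh hU hUiso hT hns hμθ
    -- As N ≥ 1, the sphere contains a pair of distinct antipodal points, so one of them differs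
    -- from a.
    obtain ⟨ζ, hζ, hζa⟩ : ∃ ζ : CSpace N, ‖ζ‖ = 1 ∧ ζ ≠ a := by
      obtain ⟨ζ, hζ⟩ := exists_norm_eq (CSpace N) zero_le_one
      by_cases hζa : ζ = a
      · refine ⟨-ζ, by rw [norm_neg, hζ], fun h1 => ?_⟩
        have h2 : (2 : ℂ) • ζ = 0 := by
          rw [two_smul]
          nth_rewrite 1 [hζa, ← h1]
          simp
        rw [(smul_eq_zero.1 h2).resolve_left two_ne_zero, norm_zero] at hζ
        exact zero_ne_one hζ
      · exact ⟨ζ, hζ, hζa⟩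
    -- The two estimates combine to n‖P‖² ≤ 4‖F‖² ≤ 4(2C‖P‖)² = 16C²‖P‖².
    obtain ⟨n, hn⟩ := exists_nat_gt (16 * C ^ 2)
    obtain ⟨P, F, hP0, ⟨g, hg, hFg⟩, h1, h2⟩ :=
      hX.exists_almost_eigenvector hp hw hU hUiso hζ hζa hθ1 n
    have h3 : ‖F‖ ≤ C * (2 * ‖P‖) := (hC F g hg hFg).trans (by gcongr)
    have hPpos : 0 < ‖P‖ ^ 2 := by have := norm_pos_iff.2 hP0; positivity
    have h4 : ‖F‖ ^ 2 ≤ (C * (2 * ‖P‖)) ^ 2 := pow_le_pow_left₀ (norm_nonneg _) h3 2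
    have h5 : n * ‖P‖ ^ 2 ≤ (16 * C ^ 2) * ‖P‖ ^ 2 := by nlinarith
    exact absurd (le_of_mul_le_mul_right h5 hPpos) (not_le.2 hn)

end IsInvariantSpace

end Abstract

/-! ### Holomorphic powers of the denominator and passage to ball automorphisms -/

section Abstract

variable {N : ℕ}

/-- The denominator is affine, so the quotient is 1 + t with t linear in z. If |t| ≥ 1, the point
-t⁻¹ z of the closed ball would be a zero of the denominator. -/
theorem IsLorentz.den_div_mem_slitPlane {M : (ℂ × CSpace N) ≃ₗ[ℂ] (ℂ × CSpace N)}
    (hM : IsLorentz M) {z : CSpace N} (hz : z ∈ closedBall (0 : CSpace N) 1) :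
    mobDen M z / mobDen M 0 ∈ Complex.slitPlane := by
  have h0 : mobDen M 0 ≠ 0 := hM.den_ne_zero (mem_closedBall_self zero_le_one)
  set t : ℂ := (M (0, z)).1 / mobDen M 0 with ht
  have haff : ∀ s : ℂ, mobDen M (s • z) = mobDen M 0 * (1 + s * t) := by
    intro s
    have e1 : ((1 : ℂ), s • z) = ((1 : ℂ), (0 : CSpace N)) + s • ((0 : ℂ), z) := by simp
    rw [mobDen, e1, map_add, map_smul, ht]
    simp only [Prod.fst_add, Prod.smul_fst, smul_eq_mul]
    change mobDen M 0 + _ = _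
    field_simp
  have hz1 : ‖z‖ ≤ 1 := by simpa using hz
  have ht1 : ‖t‖ < 1 := by
    by_contra hge
    push Not at hge
    have ht0 : t ≠ 0 := by
      intro h; rw [h, norm_zero] at hge; linarith
    refine hM.den_ne_zero (z := (-t⁻¹) • z) ?_ ?_
    · rw [mem_closedBall_zero_iff, norm_smul, norm_neg, norm_inv]
      exact mul_le_one₀ (inv_le_one_of_one_le₀ hge) (norm_nonneg _) hz1
    · rw [haff, neg_mul, inv_mul_cancel₀ ht0]; simp
  have h1 : mobDen M z / mobDen M 0 = 1 + t := by
    have := haff 1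
    rw [one_smul, one_mul] at this
    rw [this]; field_simp
  rw [h1]
  exact Complex.mem_slitPlane_of_norm_lt_one ht1

/-- A holomorphic function on the ball with the modulus of a real power of the denominator. -/
theorem IsLorentz.exists_branch {M : (ℂ × CSpace N) ≃ₗ[ℂ] (ℂ × CSpace N)}
    (hM : IsLorentz M) (p : ℝ) :
    ∃ w : CSpace N → ℂ, DiffContOnCl ℂ w (unitBall N) ∧
      ∀ z ∈ closedBall (0 : CSpace N) 1, ‖w z‖ = ‖mobDen M z‖ ^ (-p) := by
  have h0 : mobDen M 0 ≠ 0 := hM.den_ne_zero (mem_closedBall_self zero_le_one)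
  -- The principal branch is holomorphic on the normalized quotient; the constant factor restores
  -- the modulus.
  refine ⟨fun z => (mobDen M z / mobDen M 0) ^ ((-p : ℝ) : ℂ) * ((‖mobDen M 0‖ ^ (-p) : ℝ) : ℂ),
    ⟨?_, ?_⟩, fun z hz => ?_⟩
  · refine DifferentiableOn.mul_const (DifferentiableOn.cpow_const ?_ fun z hz =>
      hM.den_div_mem_slitPlane (ball_subset_closedBall hz)) _
    simp only [div_eq_mul_inv]
    exact ((IsLorentz.differentiable_den M).mul_const _).differentiableOn
  · rw [closure_ball _ one_ne_zero]
    refine ContinuousOn.mul (ContinuousOn.cpow_const ?_ fun z hz => hM.den_div_mem_slitPlane hz)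
      continuousOn_const
    exact ((IsLorentz.continuous_den M).div_const _).continuousOn
  · have hp : 0 < ‖mobDen M 0‖ := norm_pos_iff.2 h0
    rw [norm_mul, Complex.norm_cpow_real, Complex.norm_real,
      Real.norm_of_nonneg (by positivity), norm_div, Real.div_rpow (norm_nonneg _) hp.le]
    have : ‖mobDen M 0‖ ^ (-p) ≠ 0 := (Real.rpow_pos_of_pos hp _).ne'
    field_simp

variable {X : Type*} [NormedAddCommGroup X] [NormedSpace ℂ X]

/-- The spectrum of a weighted composition operator with a parabolic symbol. -/
theorem IsInvariantSpace.exists_weightedComp [NeZero N] [CompleteSpace X]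
    {e : X →ₗ[ℂ] (CSpace N → ℂ)} {E : (CSpace N → ℂ) → ℝ≥0∞} {p : ℝ} {m : Measure (CSpace N)}
    (hX : IsInvariantSpace e E p m) {φ : CSpace N → CSpace N} (hφ : IsBallAut φ)
    (hfix : ∀ z ∈ unitBall N, φ z ≠ z) {a : CSpace N} (ha : IsBoundaryFixedPoint φ a)
    (huniq : ∀ b, IsBoundaryFixedPoint φ b → b = a) {ψ : CSpace N → ℂ}
    (hψ : DiffContOnCl ℂ ψ (unitBall N))
    (hψ0 : ∃ c : ℝ, 0 < c ∧ ∀ z ∈ unitBall N, c ≤ ‖ψ z‖) :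
    ∃ T : X →L[ℂ] X, IsWComp e ψ φ T ∧ spectrum ℂ T = {μ : ℂ | ‖μ‖ = ‖ψ a‖} := by
  obtain ⟨M, hM, hφM⟩ := hφ.exists_isLorentz
  obtain ⟨hDa, q, c, hsys, hsys'⟩ := exists_isAbelSystem hfix ha huniq hM hφM
  have hpair : IsParabolicPair (mobius M) (mobius M.symm) a q c :=
    ⟨hsys, hsys', hM.differentiableOn_mobius, hM.symm.differentiableOn_mobius, hM.mapsTo_ball,
      hM.symm.mapsTo_ball, fun z hz => hM.symm_mobius hz, fun z hz => hM.mobius_symm hz⟩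
  obtain ⟨w, hw, hwn⟩ := hM.exists_branch p
  have hDpos : ∀ z ∈ closedBall (0 : CSpace N) 1, 0 < ‖mobDen M z‖ := fun z hz =>
    norm_pos_iff.2 (hM.den_ne_zero hz)
  have hw0 : ∀ z ∈ closedBall (0 : CSpace N) 1, w z ≠ 0 := fun z hz => by
    rw [← norm_ne_zero_iff, hwn z hz]
    exact (Real.rpow_pos_of_pos (hDpos z hz) _).ne'
  have hψK : ∀ z ∈ closedBall (0 : CSpace N) 1, ψ z ≠ 0 := by
    obtain ⟨b, hb0, hb⟩ := hψ0
    intro z hz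
    have hcl : z ∈ closure (unitBall N) := by rwa [closure_ball _ one_ne_zero]
    have : (𝓝[unitBall N] z).NeBot := mem_closure_iff_nhdsWithin_neBot.1 hcl
    have h1 : Filter.Tendsto (fun z => ‖ψ z‖) (𝓝[unitBall N] z) (𝓝 ‖ψ z‖) :=
      ((hψ.continuousOn z hcl).mono subset_closure).norm
    have h2 : b ≤ ‖ψ z‖ := ge_of_tendsto h1 (by
      filter_upwards [self_mem_nhdsWithin] with y hy using hb y hy)
    rw [← norm_ne_zero_iff]
    linarith
  obtain ⟨U, hU, hU1⟩ := hX.exists_isWComp (w := w) (φ := mobius M) (C := 1) hw.differentiableOn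
    hM.differentiableOn_mobius hM.mapsTo_ball zero_le_one fun f hf => by
      rw [ENNReal.ofReal_one, one_mul]
      refine (hX.mono _ _ fun z hz => ?_).trans (hX.mobius_le M hM f hf)
      have hzK := ball_subset_closedBall hz
      rw [norm_mul, norm_mul, hwn z hzK, Complex.norm_real, Real.norm_of_nonneg (by positivity)]
  have hη := hM.symm
  obtain ⟨V, hV, hV1⟩ := hX.exists_isWComp (w := fun z => (w (mobius M.symm z))⁻¹)
    (φ := mobius M.symm) (C := 1)
    ((hw.differentiableOn.comp hη.differentiableOn_mobius hη.mapsTo_ball).inv fun z hz =>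
      hw0 _ (hη.mapsTo_closedBall (ball_subset_closedBall hz)))
    hη.differentiableOn_mobius hη.mapsTo_ball zero_le_one fun f hf => by
      rw [ENNReal.ofReal_one, one_mul]
      refine (hX.mono _ _ fun z hz => ?_).trans (hX.mobius_le M.symm hη f hf)
      have hzK := ball_subset_closedBall hz
      -- By this relation the weight of the inverse operator has modulus |D|^{-p} for the
      -- denominator D of the inverse map, so V is a contraction for the same reason as U.
      have h1 : ‖mobDen M (mobius M.symm z)‖ = ‖mobDen M.symm z‖⁻¹ := by
        rw [← norm_inv]
        congr 1
        exact eq_inv_of_mul_eq_one_right (hη.den_mul_den_symm hzK)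
      rw [norm_mul, norm_mul, norm_inv, hwn _ (hη.mapsTo_closedBall hzK), Complex.norm_real,
        Real.norm_of_nonneg (by positivity), h1, Real.inv_rpow (norm_nonneg _), inv_inv]
  have hh : DiffContOnCl ℂ (fun z => ψ z * (w z)⁻¹) (unitBall N) :=
    hψ.fun_mul_complex ⟨hw.differentiableOn.inv fun z hz => hw0 z (ball_subset_closedBall hz),
      hw.continuousOn.inv₀ fun z hz => hw0 z (by rwa [closure_ball _ one_ne_zero] at hz)⟩
  obtain ⟨T, hT, hspec⟩ := hX.spectrum_eq hpair hw hw0 hh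
    (fun z hz => mul_ne_zero (hψK z hz) (inv_ne_zero (hw0 z hz))) hU (by simpa using hU1) hV
    (by simpa using hV1)
  refine ⟨T, fun x z hz => ?_, ?_⟩
  · rw [hT x z hz, hφM hz]
    simp only [inv_mul_cancel_right₀ (hw0 z (ball_subset_closedBall hz))]
  -- Since |D(a)| = 1, also |w(a)| = 1: dividing ψ by w does not change the radius.
  · rw [hspec, norm_mul, norm_inv, hwn a hsys.mem, hDa, Real.one_rpow, inv_one, mul_one]

end Abstract

/-! ### Completeness of spaces of holomorphic functions -/

section Limits

variable {F : Type*} [NormedAddCommGroup F] [NormedSpace ℂ F]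

/-- A locally uniform limit of holomorphic functions is holomorphic. -/
theorem differentiableOn_of_tendstoUniformlyOn_ball {f : ℕ → F → ℂ} {g : F → ℂ}
    {U : Set F} (hU : IsOpen U) (hf : ∀ n, DifferentiableOn ℂ (f n) U)
    (hloc : ∀ x ∈ U, ∃ r > 0, TendstoUniformlyOn f g Filter.atTop (ball x r)) :
    DifferentiableOn ℂ g U := by
  intro x hx
  obtain ⟨r₁, hr₁, hunif⟩ := hloc x hx
  obtain ⟨r₂, hr₂, hsub⟩ := Metric.isOpen_iff.1 hU x hx
  set r := min r₁ r₂ / 2 with hr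
  have hr0 : 0 < r := by positivity
  have hsub2 : ∀ y ∈ ball x r, ball y r ⊆ ball x (min r₁ r₂) := fun y hy =>
    ball_subset_ball' (by rw [mem_ball] at hy; linarith)
  have hU' : ball x (min r₁ r₂) ⊆ U := (ball_subset_ball (min_le_right _ _)).trans hsub
  have hun := hunif.mono (ball_subset_ball (min_le_left r₁ r₂) : ball x (min r₁ r₂) ⊆ _)
  have hxr : ball x r ⊆ ball x (min r₁ r₂) := ball_subset_ball (by linarith)
  -- Cauchy estimates on balls of the fixed radius r pass the uniform Cauchy property to
  -- derivatives. The estimate used refers to a ball about the value at y, so two bounds ε r / 4 add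
  -- up to ε r / 2.
  have hcau : UniformCauchySeqOn (fun n => fderiv ℂ (f n)) Filter.atTop (ball x r) := by
    have h1 := hun.uniformCauchySeqOn
    rw [Metric.uniformCauchySeqOn_iff] at h1 ⊢
    intro ε hε
    obtain ⟨n₀, hn₀⟩ := h1 (ε * r / 4) (by positivity)
    refine ⟨n₀, fun m hm n hn y hy => ?_⟩
    have hd : ∀ k, DifferentiableOn ℂ (f k) (ball y r) := fun k =>
      (hf k).mono ((hsub2 y hy).trans hU')
    have hdy : ∀ k, DifferentiableAt ℂ (f k) y := fun k =>
      (hd k).differentiableAt (isOpen_ball.mem_nhds (mem_ball_self hr0))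
    rw [dist_eq_norm, ← fderiv_sub (hdy m) (hdy n)]
    have h2 := Complex.norm_fderiv_le_div_of_mapsTo_ball (R₂ := ε * r / 2) ((hd m).sub (hd n))
      (fun w hw => ?_) hr0
    · refine h2.trans_lt ?_
      rw [div_lt_iff₀ hr0]
      nlinarith [mul_pos hε hr0]
    · have h3 := hn₀ m hm n hn w (hsub2 y hy hw)
      have h4 := hn₀ m hm n hn y (hxr hy)
      rw [dist_eq_norm] at h3 h4
      rw [mem_closedBall, dist_eq_norm]
      refine (norm_sub_le _ _).trans ?_
      simp only [Pi.sub_apply]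
      linarith
  have hlim : ∀ y ∈ ball x r, ∃ L, Filter.Tendsto (fun n => fderiv ℂ (f n) y) Filter.atTop (𝓝 L) :=
    fun y hy => cauchySeq_tendsto_of_complete (hcau.cauchySeq hy)
  choose! g' hg' using hlim
  have hg'u := hcau.tendstoUniformlyOn_of_tendsto hg'
  have := hasFDerivAt_of_tendstoUniformlyOn isOpen_ball hg'u
    (fun n y hy => (((hf n).mono (hxr.trans hU')).differentiableAt
      (isOpen_ball.mem_nhds hy)).hasFDerivAt)
    (fun y hy => hun.tendsto_at (hxr hy)) (mem_ball_self hr0)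
  exact this.differentiableAt.differentiableWithinAt

variable {N : ℕ} {X : Type*} [NormedAddCommGroup X] [NormedSpace ℂ X]

/-- A space of holomorphic functions with locally bounded point evaluations and a lower
semicontinuous norm is complete. -/
theorem completeSpace_of_local_bound {e : X →ₗ[ℂ] (CSpace N → ℂ)} {E : (CSpace N → ℂ) → ℝ≥0∞}
    (mem_holo : ∀ x, e x ∈ holo N) (enorm_eq : ∀ x, ‖x‖ₑ = E (e x))
    (exists_of_lt_top : ∀ f ∈ holo N, E f < ∞ → ∃ x, e x = f)
    (local_bound : ∀ z ∈ unitBall N, ∃ r > 0, ∃ C : ℝ, 0 ≤ C ∧ ball z r ⊆ unitBall N ∧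
      ∀ f ∈ holo N, ∀ y ∈ ball z r, ‖f y‖ₑ ≤ ENNReal.ofReal C * E f)
    (fatou : ∀ (f : ℕ → CSpace N → ℂ) (g : CSpace N → ℂ), (∀ n, f n ∈ holo N) →
      (∀ z ∈ unitBall N, Filter.Tendsto (fun n => f n z) Filter.atTop (𝓝 (g z))) →
      E g ≤ Filter.atTop.liminf fun n => E (f n)) : CompleteSpace X := by
  refine Metric.complete_of_cauchySeq_tendsto fun u hu => ?_
  have hcau : ∀ z ∈ unitBall N, ∃ r > 0, ball z r ⊆ unitBall N ∧
      UniformCauchySeqOn (fun n => e (u n)) Filter.atTop (ball z r) := by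
    intro z hz
    obtain ⟨r, hr, C, hC0, hsub, hC⟩ := local_bound z hz
    refine ⟨r, hr, hsub, ?_⟩
    rw [Metric.uniformCauchySeqOn_iff]
    intro ε hε
    obtain ⟨n₀, hn₀⟩ := Metric.cauchySeq_iff.1 hu (ε / (C + 1)) (by positivity)
    refine ⟨n₀, fun m hm n hn y hy => ?_⟩
    have h1 := hC (e (u m - u n)) (mem_holo _) y hy
    rw [← enorm_eq, ← ofReal_norm, ← ofReal_norm, ← ENNReal.ofReal_mul hC0,
      ENNReal.ofReal_le_ofReal_iff (by positivity), map_sub, Pi.sub_apply] at h1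
    have h2 := hn₀ m hm n hn
    rw [dist_eq_norm, lt_div_iff₀ (by positivity)] at h2
    rw [dist_eq_norm]
    nlinarith [norm_nonneg (u m - u n)]
  have hlim : ∀ z ∈ unitBall N, ∃ L, Filter.Tendsto (fun n => e (u n) z) Filter.atTop (𝓝 L) := by
    intro z hz
    obtain ⟨r, hr, -, hc⟩ := hcau z hz
    exact cauchySeq_tendsto_of_complete (hc.cauchySeq (mem_ball_self hr))
  choose! g₀ hg₀ using hlim
  set g := (unitBall N).indicator g₀ with hgdef
  have hg : ∀ z ∈ unitBall N, Filter.Tendsto (fun n => e (u n) z) Filter.atTop (𝓝 (g z)) :=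
    fun z hz => by rw [hgdef, indicator_of_mem hz]; exact hg₀ z hz
  have hgh : g ∈ holo N := by
    refine ⟨differentiableOn_of_tendstoUniformlyOn_ball isOpen_ball (fun n => (mem_holo (u n)).1)
      fun z hz => ?_, fun z hz => indicator_of_notMem hz _⟩
    obtain ⟨r, hr, hsub, hc⟩ := hcau z hz
    exact ⟨r, hr, hc.tendstoUniformlyOn_of_tendsto fun y hy => hg y (hsub hy)⟩
  have hE : ∀ ε > 0, ∃ n₀, ∀ n ≥ n₀, E (g - e (u n)) ≤ ENNReal.ofReal ε := by
    intro ε hε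
    obtain ⟨n₀, hn₀⟩ := Metric.cauchySeq_iff.1 hu ε hε
    refine ⟨n₀, fun n hn => ?_⟩
    refine (fatou (fun k => e (u k - u n)) (g - e (u n)) (fun k => mem_holo _) fun z hz => ?_).trans
      ?_
    · simp only [map_sub, Pi.sub_apply]
      exact (hg z hz).sub_const _
    · refine Filter.liminf_le_of_frequently_le' (Filter.Eventually.frequently ?_)
      filter_upwards [Filter.eventually_ge_atTop n₀] with k hk
      rw [← enorm_eq, ← ofReal_norm]
      refine ENNReal.ofReal_le_ofReal ?_
      rw [← dist_eq_norm]
      exact (hn₀ k hk n hn).le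
  -- Finite norm is so far known only for differences g - e (u n), so the limit is recovered as such
  -- a difference plus u n₁.
  obtain ⟨n₁, hn₁⟩ := hE 1 one_pos
  obtain ⟨y, hy⟩ := exists_of_lt_top (g - e (u n₁)) ((holo N).sub_mem hgh (mem_holo _))
    ((hn₁ n₁ le_rfl).trans_lt ENNReal.ofReal_lt_top)
  refine ⟨y + u n₁, ?_⟩
  have hx : e (y + u n₁) = g := by rw [map_add, hy, sub_add_cancel]
  rw [Metric.tendsto_atTop]
  intro ε hε
  obtain ⟨n₀, hn₀⟩ := hE (ε / 2) (by positivity)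
  refine ⟨n₀, fun n hn => ?_⟩
  have h1 := hn₀ n hn
  rw [← hx, ← map_sub, ← enorm_eq, ← ofReal_norm,
    ENNReal.ofReal_le_ofReal_iff (by positivity)] at h1
  rw [dist_comm, dist_eq_norm]
  linarith

/-- Multiplication by a unimodular complex number as a real linear isometry. -/
def unitSmul (N : ℕ) (u : Circle) : CSpace N ≃ₗᵢ[ℝ] CSpace N :=
  { LinearEquiv.restrictScalars ℝ (LinearEquiv.smulOfNeZero ℂ (CSpace N) (u : ℂ) u.coe_ne_zero) with
    norm_map' := fun x => by
      change ‖(u : ℂ) • x‖ = ‖x‖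
      rw [norm_smul, Circle.norm_coe, one_mul] }

@[simp] theorem unitSmul_apply (u : Circle) (x : CSpace N) : unitSmul N u x = (u : ℂ) • x := rfl

/-- The sub-mean value inequality on balls. -/
theorem enorm_mul_volume_ball_le {f : CSpace N → ℂ} {y : CSpace N} {r : ℝ}
    (hf : DifferentiableOn ℂ f (ball y r)) :
    ‖f y‖ₑ * volume (ball (0 : CSpace N) r) ≤ ∫⁻ w in ball (0 : CSpace N) r, ‖f (y + w)‖ₑ := by
  set I : Set ℝ := Ioc 0 (2 * Real.pi) with hI
  have hIv : volume I = ENNReal.ofReal (2 * Real.pi) := by simp [hI]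
  have hpi : 0 < 2 * Real.pi := by positivity
  have hmem : ∀ (t : ℝ) (w : CSpace N), w ∈ ball (0 : CSpace N) r →
      y + (Circle.exp t : ℂ) • w ∈ ball y r := fun t w hw => by
    rw [mem_ball, dist_eq_norm, add_sub_cancel_left, norm_smul, Circle.norm_coe, one_mul]
    simpa using hw
  -- The mean value property on each circle e^{it}w is integrated over w; after exchanging the
  -- integrals, rotation invariance of volume removes t.
  have hcirc : ∀ w ∈ ball (0 : CSpace N) r,
      ‖f y‖ₑ * volume I ≤ ∫⁻ t in I, ‖f (y + (Circle.exp t : ℂ) • w)‖ₑ := by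
    intro w hw
    have hw' : ‖w‖ < r := by simpa using hw
    obtain ⟨s, hs1, hs⟩ : ∃ s : ℝ, 1 < s ∧ s * ‖w‖ < r := by
      rcases eq_or_ne ‖w‖ 0 with h0 | h0
      · exact ⟨2, one_lt_two, by rw [h0, mul_zero]; rwa [h0] at hw'⟩
      · have hwp : 0 < ‖w‖ := lt_of_le_of_ne (norm_nonneg _) h0.symm
        obtain ⟨s, hs, hs'⟩ := exists_between ((one_lt_div hwp).2 hw')
        exact ⟨s, hs, (lt_div_iff₀ hwp).1 hs'⟩
    have hg : DifferentiableOn ℂ (fun t : ℂ => f (y + t • w)) (ball 0 s) := by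
      refine hf.comp (by fun_prop) fun t ht => ?_
      rw [mem_ball, dist_eq_norm, add_sub_cancel_left, norm_smul]
      have : ‖t‖ < s := by simpa using ht
      nlinarith [norm_nonneg w]
    have hdc : DiffContOnCl ℂ (fun t : ℂ => f (y + t • w)) (ball 0 |(1 : ℝ)|) := by
      rw [abs_one]
      exact (hg.mono (closedBall_subset_ball hs1)).diffContOnCl_ball subset_rfl
    have hav := hdc.circleAverage
    rw [Real.circleAverage_def, zero_smul, add_zero] at hav
    have e1 : ‖f y‖ * (2 * Real.pi) ≤ ∫ t in I, ‖f (y + (Circle.exp t : ℂ) • w)‖ := by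
      rw [← hav, norm_smul, norm_inv, Real.norm_of_nonneg hpi.le, mul_comm, ← mul_assoc,
        mul_inv_cancel₀ hpi.ne', one_mul]
      rw [intervalIntegral.integral_of_le hpi.le]
      refine (norm_integral_le_integral_norm _).trans_eq ?_
      simp [circleMap, Circle.coe_exp, hI]
    have hcont : Continuous fun t : ℝ => f (y + (Circle.exp t : ℂ) • w) :=
      hf.continuousOn.comp_continuous (by fun_prop) fun t => hmem t w hw
    have hint : IntegrableOn (fun t : ℝ => f (y + (Circle.exp t : ℂ) • w)) I :=
      hcont.integrableOn_Ioc
    rw [hIv, ← ofReal_norm, ← ENNReal.ofReal_mul (norm_nonneg _)]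
    refine (ENNReal.ofReal_le_ofReal e1).trans_eq ?_
    rw [ofReal_integral_norm_eq_lintegral_enorm hint]
  have hmeas : AEMeasurable (fun x : CSpace N × ℝ => ‖f (y + (Circle.exp x.2 : ℂ) • x.1)‖ₑ)
      ((volume.restrict (ball (0 : CSpace N) r)).prod (volume.restrict I)) := by
    rw [Measure.prod_restrict]
    have hc : ContinuousOn (fun x : CSpace N × ℝ => f (y + (Circle.exp x.2 : ℂ) • x.1))
        (ball (0 : CSpace N) r ×ˢ I) :=
      hf.continuousOn.comp (by fun_prop) fun x hx => hmem x.2 x.1 hx.1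
    exact (hc.aestronglyMeasurable (measurableSet_ball.prod measurableSet_Ioc)).enorm
  have h1 : ‖f y‖ₑ * volume I * volume (ball (0 : CSpace N) r) ≤
      ∫⁻ w in ball (0 : CSpace N) r, ∫⁻ t in I, ‖f (y + (Circle.exp t : ℂ) • w)‖ₑ := by
    rw [← setLIntegral_const]
    exact setLIntegral_mono_ae' measurableSet_ball (Filter.Eventually.of_forall fun w hw =>
      hcirc w hw)
  rw [lintegral_lintegral_swap hmeas] at h1
  have h2 : ∀ t : ℝ, ∫⁻ w in ball (0 : CSpace N) r, ‖f (y + (Circle.exp t : ℂ) • w)‖ₑ =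
      ∫⁻ w in ball (0 : CSpace N) r, ‖f (y + w)‖ₑ := by
    intro t
    have hmp := (unitSmul N (Circle.exp t)).measurePreserving
    have hpre : (unitSmul N (Circle.exp t)) ⁻¹' ball (0 : CSpace N) r = ball 0 r := by
      ext w; simp
    have := hmp.setLIntegral_comp_preimage_emb
      (unitSmul N (Circle.exp t)).toHomeomorph.measurableEmbedding
      (fun w => ‖f (y + w)‖ₑ) (ball 0 r)
    rw [hpre] at this
    exact this
  simp only [h2] at h1
  rw [setLIntegral_const, hIv, mul_right_comm] at h1
  exact (ENNReal.mul_le_mul_iff_left (by simpa using hpi) ENNReal.ofReal_ne_top).1 h1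

end Limits

/-! ### Weighted Bergman spaces -/

section Bergman

variable {N : ℕ}

theorem one_sub_norm_sq_pos {z : CSpace N} (hz : z ∈ unitBall N) : 0 < 1 - ‖z‖ ^ 2 := by
  have : ‖z‖ < 1 := by simpa using hz
  nlinarith [norm_nonneg z]

theorem bergmanWeight_ae_mem (N : ℕ) (α : ℝ) : ∀ᵐ z ∂(bergmanWeight N α), z ∈ unitBall N :=
  (withDensity_absolutelyContinuous _ _).ae_le (ae_restrict_mem measurableSet_ball)

theorem bergmanMeasure_ae_mem (N : ℕ) (α : ℝ) : ∀ᵐ z ∂(bergmanMeasure N α), z ∈ unitBall N :=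
  Measure.ae_smul_measure (bergmanWeight_ae_mem N α) _

theorem lintegral_bergmanWeight (α : ℝ) (g : CSpace N → ℝ≥0∞) :
    ∫⁻ z, g z ∂(bergmanWeight N α) =
      ∫⁻ z in unitBall N, ENNReal.ofReal ((1 - ‖z‖ ^ 2) ^ α) * g z := by
  rw [bergmanWeight, lintegral_withDensity_eq_lintegral_mul_non_measurable _ (by fun_prop)
    (Filter.Eventually.of_forall fun _ => ENNReal.ofReal_lt_top)]
  rfl

theorem bergmanENorm_sq (α : ℝ) (f : CSpace N → ℂ) :
    bergmanENorm α f ^ 2 = (bergmanWeight N α univ)⁻¹ *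
      ∫⁻ z, ‖f z‖ₑ ^ 2 ∂(bergmanWeight N α) := by
  rw [bergmanENorm, eLpNorm_eq_lintegral_rpow_enorm_toReal two_ne_zero ENNReal.ofNat_ne_top,
    bergmanMeasure, lintegral_smul_measure]
  simp only [ENNReal.toReal_ofNat, ENNReal.rpow_ofNat, smul_eq_mul]
  rw [← ENNReal.rpow_ofNat, ← ENNReal.rpow_mul]
  norm_num

theorem bergmanWeight_open_ne_zero (α : ℝ) {O : Set (CSpace N)} (hO : IsOpen O)
    (hne : (O ∩ unitBall N).Nonempty) : bergmanWeight N α O ≠ 0 := by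
  intro h
  rw [bergmanWeight, withDensity_apply_eq_zero' (by fun_prop)] at h
  have h1 : O ∩ unitBall N ⊆ ({z | ENNReal.ofReal ((1 - ‖z‖ ^ 2) ^ α) ≠ 0} ∩ O) ∩ unitBall N :=
    fun z hz => ⟨⟨(ENNReal.ofReal_pos.2 (Real.rpow_pos_of_pos (one_sub_norm_sq_pos hz.2) α)).ne',
      hz.1⟩, hz.2⟩
  rw [Measure.restrict_apply' measurableSet_ball] at h
  exact (hO.inter isOpen_ball).measure_ne_zero volume hne (measure_mono_null h1 h)

theorem bergmanWeight_univ_ne_zero (N : ℕ) (α : ℝ) : bergmanWeight N α univ ≠ 0 :=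
  bergmanWeight_open_ne_zero α isOpen_univ ⟨0, mem_univ _, mem_ball_self one_pos⟩

theorem bergmanENorm_mono (α : ℝ) {f g : CSpace N → ℂ}
    (h : ∀ z ∈ unitBall N, ‖f z‖ ≤ ‖g z‖) : bergmanENorm α f ≤ bergmanENorm α g :=
  eLpNorm_mono_ae (by filter_upwards [bergmanMeasure_ae_mem N α] with z hz using h z hz)

/-- Change of variables for an automorphism of the ball. -/
theorem IsLorentz.lintegral_comp {M : (ℂ × CSpace N) ≃ₗ[ℂ] (ℂ × CSpace N)} (hM : IsLorentz M)
    (g : CSpace N → ℝ≥0∞) :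
    ∫⁻ z in unitBall N, g z = ∫⁻ z in unitBall N,
      ENNReal.ofReal ((‖mobDen M z‖ ^ (2 * (N + 1)))⁻¹) * g (mobius M z) := by
  have himg : mobius M '' unitBall N = unitBall N := by
    refine Subset.antisymm hM.mapsTo_ball.image_subset fun z hz => ?_
    exact ⟨_, hM.symm.mapsTo_ball hz, hM.mobius_symm (ball_subset_closedBall hz)⟩
  have hinj : InjOn (mobius M) (unitBall N) := fun x hx y hy hxy => by
    rw [← hM.symm_mobius (ball_subset_closedBall hx), hxy,
      hM.symm_mobius (ball_subset_closedBall hy)]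
  have hder : ∀ z ∈ unitBall N, HasFDerivAt (mobius M) (fderiv ℂ (mobius M) z) z := fun z hz =>
    (hM.differentiableOn_mobius.differentiableAt (isOpen_ball.mem_nhds hz)).hasFDerivAt
  have h1 := lintegral_image_eq_lintegral_abs_det_fderiv_mul volume measurableSet_ball
    (fun z hz => ((hder z hz).restrictScalars ℝ).hasFDerivWithinAt) hinj g
  rw [himg] at h1
  rw [h1]
  exact setLIntegral_congr_fun measurableSet_ball fun z hz => by
    rw [hM.abs_det_restrictScalars hz (hder z hz)]

/-- The invariance of the weighted Bergman norm. -/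
theorem IsLorentz.bergmanENorm_comp {M : (ℂ × CSpace N) ≃ₗ[ℂ] (ℂ × CSpace N)} (hM : IsLorentz M)
    (α : ℝ) (f : CSpace N → ℂ) :
    bergmanENorm α (fun z => ((‖mobDen M z‖ ^ (-(N + 1 + α)) : ℝ) : ℂ) * f (mobius M z)) =
      bergmanENorm α f := by
  have hinj : Function.Injective fun x : ℝ≥0∞ => x ^ 2 :=
    (ENNReal.pow_right_strictMono two_ne_zero).injective
  apply hinj
  simp only
  rw [bergmanENorm_sq, bergmanENorm_sq, lintegral_bergmanWeight, lintegral_bergmanWeight,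
    hM.lintegral_comp (fun z => ENNReal.ofReal ((1 - ‖z‖ ^ 2) ^ α) * ‖f z‖ₑ ^ 2)]
  congr 1
  refine setLIntegral_congr_fun measurableSet_ball fun z hz => ?_
  have hzK := ball_subset_closedBall hz
  have hD : 0 < ‖mobDen M z‖ := norm_pos_iff.2 (hM.den_ne_zero hzK)
  have h1 := hM.one_sub_norm_sq hzK
  -- The weight at the image contributes |D|^{-2α} and the Jacobian |D|^{-2(N+1)}; their product is
  -- the square of |D|^{-(N+1+α)}.
  have h2 : (1 - ‖mobius M z‖ ^ 2) = (1 - ‖z‖ ^ 2) * (‖mobDen M z‖ ^ 2)⁻¹ := by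
    rw [← h1]; field_simp
  rw [enorm_mul, mul_pow, ← mul_assoc, ← mul_assoc]
  congr 1
  rw [← ofReal_norm, Complex.norm_real, Real.norm_of_nonneg (by positivity), ← ENNReal.ofReal_pow
    (by positivity), ← ENNReal.ofReal_mul (Real.rpow_nonneg (one_sub_norm_sq_pos hz).le _),
    ← ENNReal.ofReal_mul (by positivity), h2, Real.mul_rpow (one_sub_norm_sq_pos hz).le
      (by positivity)]
  congr 1
  have e1 : (‖mobDen M z‖ ^ (-(N + 1 + α))) ^ 2 = ‖mobDen M z‖ ^ (-(2 * (N + 1 + α))) := by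
    rw [← Real.rpow_natCast, ← Real.rpow_mul hD.le]; congr 1; push_cast; ring
  have e2 : ((‖mobDen M z‖ ^ 2)⁻¹) ^ α = ‖mobDen M z‖ ^ (-(2 * α)) := by
    rw [← Real.rpow_natCast, ← Real.rpow_neg hD.le, ← Real.rpow_mul hD.le]
    congr 1; push_cast; ring
  have e3 : (‖mobDen M z‖ ^ (2 * (N + 1)))⁻¹ = ‖mobDen M z‖ ^ (-(2 * ((N : ℝ) + 1))) := by
    rw [← Real.rpow_natCast, ← Real.rpow_neg hD.le]; congr 1; push_cast; ring
  rw [e1, e2, e3, mul_left_comm, ← Real.rpow_add hD]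
  congr 2; ring

/-- Point evaluations are locally bounded on weighted Bergman spaces. -/
theorem bergman_local_bound [NeZero N] {α : ℝ} (hα : -1 < α) {z : CSpace N} (hz : z ∈ unitBall N) :
    ∃ r > 0, ∃ C : ℝ, 0 ≤ C ∧ ball z r ⊆ unitBall N ∧
      ∀ f ∈ holo N, ∀ y ∈ ball z r, ‖f y‖ₑ ≤ ENNReal.ofReal C * bergmanENorm α f := by
  have hz1 : ‖z‖ < 1 := by simpa using hz
  set s := (1 + ‖z‖) / 2 with hs
  have hs0 : 0 ≤ s := by positivity
  have hs1 : s < 1 := by linarith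
  set r := (1 - ‖z‖) / 4 with hr
  have hr0 : 0 < r := by linarith
  have hsub : ∀ y ∈ ball z r, ball y r ⊆ closedBall 0 s := fun y hy w hw => by
    rw [mem_ball, dist_eq_norm] at hy hw
    rw [mem_closedBall_zero_iff]
    calc ‖w‖ = ‖(w - y) + (y - z) + z‖ := by congr 1; abel
      _ ≤ ‖w - y‖ + ‖y - z‖ + ‖z‖ := norm_add₃_le
      _ ≤ s := by linarith
  have hsB : closedBall (0 : CSpace N) s ⊆ unitBall N := closedBall_subset_ball hs1
  have hcont : ContinuousOn (fun w : CSpace N => (1 - ‖w‖ ^ 2) ^ α) (closedBall 0 s) := by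
    refine ContinuousOn.rpow_const (by fun_prop) fun w hw => Or.inl ?_
    exact (one_sub_norm_sq_pos (hsB hw)).ne'
  -- Compactness gives a positive lower bound of the weight whatever the sign of α.
  obtain ⟨w₀, hw₀, hmin⟩ := (isCompact_closedBall (0 : CSpace N) s).exists_isMinOn
    ⟨0, by simpa using hs0⟩ hcont
  set k := (1 - ‖w₀‖ ^ 2) ^ α with hk
  have hk0 : 0 < k := Real.rpow_pos_of_pos (one_sub_norm_sq_pos (hsB hw₀)) α
  set v := volume (ball (0 : CSpace N) r) with hv
  have hv0 : v ≠ 0 := (measure_ball_pos volume _ hr0).ne'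
  have hvt : v ≠ ∞ := measure_ball_lt_top.ne
  set Q := bergmanWeight N α univ with hQ
  have hQ0 : Q ≠ 0 := bergmanWeight_univ_ne_zero N α
  have hQt : Q ≠ ∞ := (bergmanWeight_univ_lt_top N hα).ne
  have hkE : ENNReal.ofReal k ≠ 0 := (ENNReal.ofReal_pos.2 hk0).ne'
  set A : ℝ≥0∞ := v⁻¹ * (ENNReal.ofReal k)⁻¹ * Q with hA
  have hAt : A ≠ ∞ := ENNReal.mul_ne_top (ENNReal.mul_ne_top (ENNReal.inv_ne_top.2 hv0)
    (ENNReal.inv_ne_top.2 hkE)) hQt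
  refine ⟨r, hr0, (A ^ (1 / 2 : ℝ)).toReal, ENNReal.toReal_nonneg,
    fun y hy => hsB (hsub y hy (mem_ball_self hr0)), fun f hf y hy => ?_⟩
  rw [ENNReal.ofReal_toReal (ENNReal.rpow_ne_top_of_nonneg (by positivity) hAt)]
  have hyB := (hsub y hy).trans hsB
  -- The sub-mean value inequality is applied to the holomorphic function f², which yields L² means.
  have h1 := enorm_mul_volume_ball_le ((hf.1.mono hyB).pow 2)
  simp only [Pi.pow_apply, enorm_pow] at h1
  have h2 : ∫⁻ w in ball (0 : CSpace N) r, ‖f (y + w)‖ₑ ^ 2 = ∫⁻ w in ball y r, ‖f w‖ₑ ^ 2 := by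
    have hmp := measurePreserving_add_left (volume : Measure (CSpace N)) y
    have hpre : (fun w => y + w) ⁻¹' ball y r = ball 0 r := by
      ext w; simp [mem_ball, dist_eq_norm]
    have := hmp.setLIntegral_comp_preimage_emb (measurableEmbedding_addLeft y)
      (fun w => ‖f w‖ₑ ^ 2) (ball y r)
    rw [hpre] at this
    exact this
  have h3 : ENNReal.ofReal k * ∫⁻ w in ball y r, ‖f w‖ₑ ^ 2 ≤ Q * bergmanENorm α f ^ 2 := by
    rw [bergmanENorm_sq, ← mul_assoc, ENNReal.mul_inv_cancel hQ0 hQt, one_mul,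
      lintegral_bergmanWeight, ← lintegral_const_mul' _ _ ENNReal.ofReal_ne_top]
    refine (setLIntegral_mono_ae' measurableSet_ball (Filter.Eventually.of_forall fun w hw => ?_)).trans
      (lintegral_mono_set hyB)
    gcongr
    exact hmin (hsub y hy hw)
  have h4 : ‖f y‖ₑ ^ 2 ≤ A * bergmanENorm α f ^ 2 := by
    rw [h2] at h1
    calc ‖f y‖ₑ ^ 2 = v⁻¹ * (‖f y‖ₑ ^ 2 * v) := by
          rw [mul_comm _ v, ← mul_assoc, ENNReal.inv_mul_cancel hv0 hvt, one_mul]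
      _ ≤ v⁻¹ * ∫⁻ w in ball y r, ‖f w‖ₑ ^ 2 := by gcongr
      _ = v⁻¹ * ((ENNReal.ofReal k)⁻¹ * (ENNReal.ofReal k * ∫⁻ w in ball y r, ‖f w‖ₑ ^ 2)) := by
          rw [← mul_assoc (ENNReal.ofReal k)⁻¹, ENNReal.inv_mul_cancel hkE ENNReal.ofReal_ne_top,
            one_mul]
      _ ≤ v⁻¹ * ((ENNReal.ofReal k)⁻¹ * (Q * bergmanENorm α f ^ 2)) := by gcongr
      _ = _ := by rw [hA]; ring
  have h5 : (A ^ (1 / 2 : ℝ)) ^ 2 = A := by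
    rw [← ENNReal.rpow_ofNat, ← ENNReal.rpow_mul]; norm_num
  rw [← h5, ← mul_pow] at h4
  exact (ENNReal.pow_le_pow_left_iff two_ne_zero).1 h4

/-- Elements of a weighted Bergman space as functions. -/
def bergmanCoe (N : ℕ) (α : Ioi (-1 : ℝ)) : BergmanSpace N α →ₗ[ℂ] (CSpace N → ℂ) :=
  (bergmanSubmodule N α).subtype

theorem bergman_enorm_eq [NeZero N] {α : Ioi (-1 : ℝ)} (x : BergmanSpace N α) :
    ‖x‖ₑ = bergmanENorm α (bergmanCoe N α x) := by
  rw [← ofReal_norm, BergmanSpace.norm_def, ENNReal.ofReal_toReal x.2.2.ne]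
  rfl

/-- The change of variables dictates the exponent N + 1 + α; here m is the normalized volume measure
defining the norm, so the boundary condition holds by definition. -/
theorem isInvariantSpace_bergman [NeZero N] (α : Ioi (-1 : ℝ)) :
    IsInvariantSpace (bergmanCoe N α) (bergmanENorm α) (N + 1 + α) (bergmanMeasure N α) where
  mem_holo x := x.2.1
  enorm_eq := bergman_enorm_eq
  exists_of_lt_top f hf hE := ⟨⟨f, hf, hE⟩, rfl⟩
  mono f g h := bergmanENorm_mono α h
  smul c f := bergmanENorm_smul α c f
  mobius_le M hM f _ := (hM.bergmanENorm_comp α f).le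
  boundary g _ := rfl
  finite := by
    have hfin : IsFiniteMeasure (bergmanWeight N α) := ⟨bergmanWeight_univ_lt_top N α.2⟩
    exact Measure.smul_finite _ (ENNReal.inv_ne_top.2 (bergmanWeight_univ_ne_zero N α))
  compl_null := by
    refine mem_ae_iff.1 ?_
    filter_upwards [bergmanMeasure_ae_mem N α] with z hz using ball_subset_closedBall hz
  open_pos ζ hζ O hO hζO := by
    rw [bergmanMeasure, Measure.smul_apply, smul_eq_mul]
    refine mul_ne_zero (ENNReal.inv_ne_zero.2 (bergmanWeight_univ_lt_top N α.2).ne)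
      (bergmanWeight_open_ne_zero α hO ?_)
    have hcl : ζ ∈ closure (unitBall N) := by
      rw [closure_ball _ one_ne_zero]; exact sphere_subset_closedBall hζ
    exact mem_closure_iff.1 hcl O hO hζO

instance [NeZero N] (α : Ioi (-1 : ℝ)) : CompleteSpace (BergmanSpace N α) :=
  completeSpace_of_local_bound (isInvariantSpace_bergman α).mem_holo
    (isInvariantSpace_bergman α).enorm_eq (isInvariantSpace_bergman α).exists_of_lt_top
    (fun _ hz => bergman_local_bound α.2 hz) fun f g hf hlim =>
      Lp.eLpNorm_lim_le_liminf_eLpNorm (fun n => holo_aestronglyMeasurable α (hf n)) g (by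
        filter_upwards [bergmanMeasure_ae_mem N α] with z hz using hlim z hz)

end Bergman

/-! ### Means over spheres -/

section Sphere

variable {N : ℕ}

/-- Rotation of the unit sphere by a unimodular number. -/
def sphereRot (N : ℕ) (u : Circle) (ζ : unitSphere N) : unitSphere N :=
  ⟨(u : ℂ) • (ζ : CSpace N), by
    rw [mem_sphere_zero_iff_norm, norm_smul, Circle.norm_coe, one_mul]; simp⟩

@[simp] theorem coe_sphereRot (u : Circle) (ζ : unitSphere N) :
    (sphereRot N u ζ : CSpace N) = (u : ℂ) • (ζ : CSpace N) := rfl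

theorem continuous_sphereRot (u : Circle) : Continuous (sphereRot N u) :=
  Continuous.subtype_mk (by fun_prop) _

open scoped Pointwise in
theorem measurePreserving_sphereRot_toSphere (u : Circle) :
    MeasurePreserving (sphereRot N u) (volume : Measure (CSpace N)).toSphere
      (volume : Measure (CSpace N)).toSphere := by
  refine ⟨(continuous_sphereRot u).measurable, Measure.ext fun s hs => ?_⟩
  have hm := (continuous_sphereRot (N := N) u).measurable
  rw [Measure.map_apply hm hs, Measure.toSphere_apply' _ (hm hs), Measure.toSphere_apply' _ hs]
  congr 1
  have hpre : Ioo (0 : ℝ) 1 • (((↑) : unitSphere N → CSpace N) '' (sphereRot N u ⁻¹' s)) =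
      unitSmul N u ⁻¹' (Ioo (0 : ℝ) 1 • (((↑) : unitSphere N → CSpace N) '' s)) := by
    ext z
    simp only [mem_preimage, mem_smul, mem_image]
    constructor
    · rintro ⟨r, hr, _, ⟨ζ, hζ, rfl⟩, rfl⟩
      exact ⟨r, hr, _, ⟨_, hζ, rfl⟩, by simp⟩
    · rintro ⟨r, hr, _, ⟨ζ, hζ, rfl⟩, h⟩
      refine ⟨r, hr, _, ⟨sphereRot N u⁻¹ ζ, ?_, rfl⟩, ?_⟩
      · have : sphereRot N u (sphereRot N u⁻¹ ζ) = ζ := by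
          ext1; simp [smul_smul]
        rwa [this]
      · apply (unitSmul N u).injective
        rw [← h]
        simp [smul_comm r, smul_smul]
  rw [hpre]
  exact (unitSmul N u).measurePreserving.measure_preimage_emb
    (unitSmul N u).toHomeomorph.measurableEmbedding _

theorem measurePreserving_sphereRot (u : Circle) :
    MeasurePreserving (sphereRot N u) (surfaceMeasure N) (surfaceMeasure N) :=
  (measurePreserving_sphereRot_toSphere u).smul_measure _

theorem toSphere_univ_ne_zero (N : ℕ) [NeZero N] :
    (volume : Measure (CSpace N)).toSphere univ ≠ 0 := by
  rw [Ne, Measure.measure_univ_eq_zero]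
  exact Measure.toSphere_ne_zero _

instance [NeZero N] : IsProbabilityMeasure (surfaceMeasure N) := ⟨by
  rw [surfaceMeasure, Measure.smul_apply, smul_eq_mul,
    ENNReal.inv_mul_cancel (toSphere_univ_ne_zero N) (measure_ne_top _ _)]⟩

theorem norm_smul_sphere (t : ℂ) (ζ : unitSphere N) : ‖t • (ζ : CSpace N)‖ = ‖t‖ := by
  simp [norm_smul]

theorem smul_sphere_mem_ball {t : ℂ} (ht : ‖t‖ < 1) (ζ : unitSphere N) :
    t • (ζ : CSpace N) ∈ unitBall N := by
  rw [mem_ball_zero_iff, norm_smul_sphere]; exact ht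

theorem continuous_slice {f : CSpace N → ℂ} (hf : ContinuousOn f (unitBall N)) {t : ℂ}
    (ht : ‖t‖ < 1) : Continuous fun ζ : unitSphere N => f (t • (ζ : CSpace N)) :=
  hf.comp_continuous (by fun_prop) fun ζ => smul_sphere_mem_ball ht ζ

theorem differentiableOn_slice {f : CSpace N → ℂ} (hf : DifferentiableOn ℂ f (unitBall N))
    (ζ : unitSphere N) : DifferentiableOn ℂ (fun t : ℂ => f (t • (ζ : CSpace N))) (ball 0 1) :=
  hf.comp (by fun_prop) fun t ht => smul_sphere_mem_ball (by simpa using ht) ζ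

/-- Integrals of the dilates of a holomorphic function depend holomorphically on the dilation. -/
theorem differentiableOn_integral_slice [NeZero N] {f : CSpace N → ℂ}
    (hf : DifferentiableOn ℂ f (unitBall N)) {v : unitSphere N → ℂ} (hv : Continuous v) :
    DifferentiableOn ℂ (fun t : ℂ => ∫ ζ, v ζ * f (t • (ζ : CSpace N)) ∂(surfaceMeasure N))
      (ball 0 1) := by
  intro t₀ ht₀
  have ht₀' : ‖t₀‖ < 1 := by simpa using ht₀
  set s := (1 - ‖t₀‖) / 4 with hs
  have hs0 : 0 < s := by linarith
  have hsub : ∀ t ∈ ball t₀ s, closedBall t s ⊆ closedBall 0 ((1 + ‖t₀‖) / 2) := by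
    intro t ht y hy
    rw [mem_ball, dist_eq_norm] at ht
    rw [mem_closedBall, dist_eq_norm] at hy
    rw [mem_closedBall_zero_iff]
    calc ‖y‖ = ‖(y - t) + (t - t₀) + t₀‖ := by congr 1; abel
      _ ≤ ‖y - t‖ + ‖t - t₀‖ + ‖t₀‖ := norm_add₃_le
      _ ≤ _ := by linarith
  have hlt : (1 + ‖t₀‖) / 2 < 1 := by linarith
  have hsub1 : ∀ t ∈ ball t₀ s, closedBall t s ⊆ ball 0 1 := fun t ht =>
    (hsub t ht).trans (closedBall_subset_ball hlt)
  have hball : ∀ t ∈ ball t₀ s, ‖t‖ < 1 := fun t ht => by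
    simpa using hsub1 t ht (mem_closedBall_self hs0.le)
  obtain ⟨b, hb⟩ := (isCompact_closedBall (0 : CSpace N) ((1 + ‖t₀‖) / 2)).exists_bound_of_continuousOn
    (hf.continuousOn.mono (closedBall_subset_ball hlt))
  obtain ⟨b', hb'⟩ := isCompact_univ.exists_bound_of_continuousOn hv.continuousOn
  have hder : ∀ ζ : unitSphere N, ∀ t ∈ ball t₀ s,
      HasDerivAt (fun t : ℂ => f (t • (ζ : CSpace N)))
        (deriv (fun t : ℂ => f (t • (ζ : CSpace N))) t) t := fun ζ t ht =>
    ((differentiableOn_slice hf ζ).differentiableAt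
      (isOpen_ball.mem_nhds (by simpa using hball t ht))).hasDerivAt
  have hmeas : ∀ t ∈ ball t₀ s,
      Continuous fun ζ : unitSphere N => v ζ * f (t • (ζ : CSpace N)) := fun t ht =>
    hv.mul (continuous_slice hf.continuousOn (hball t ht))
  have h0 : t₀ ∈ ball t₀ s := mem_ball_self hs0
  refine (hasDerivAt_integral_of_dominated_loc_of_deriv_le
    (F := fun t (ζ : unitSphere N) => v ζ * f (t • (ζ : CSpace N)))
    (F' := fun t ζ => v ζ * deriv (fun t : ℂ => f (t • (ζ : CSpace N))) t)
    (bound := fun _ => b' * (b / s)) (ball_mem_nhds t₀ hs0) ?_ ?_ ?_ ?_ ?_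
    ?_).2.differentiableAt.differentiableWithinAt
  · filter_upwards [ball_mem_nhds t₀ hs0] with t ht using (hmeas t ht).aestronglyMeasurable
  · exact (hmeas t₀ h0).integrable_of_hasCompactSupport (HasCompactSupport.of_compactSpace _)
  -- The derivative is measurable in ζ as a pointwise limit of difference quotients, which are
  -- continuous in ζ. The increments s/(n + 2) are nonzero and smaller than s.
  · refine hv.aestronglyMeasurable.mul ?_
    have hx : Filter.Tendsto (fun n : ℕ => t₀ + (s / (n + 2) : ℝ)) Filter.atTop (𝓝[≠] t₀) := by
      refine tendsto_nhdsWithin_iff.2 ⟨?_, Filter.Eventually.of_forall fun n => ?_⟩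
      · have h1 : Filter.Tendsto (fun n : ℕ => (s / ((n : ℝ) + 2))) Filter.atTop (𝓝 0) :=
          (tendsto_const_nhds (x := s)).div_atTop (Filter.tendsto_atTop_add_const_right _ _
            tendsto_natCast_atTop_atTop)
        have h2 := (Complex.continuous_ofReal.tendsto 0).comp h1
        simpa using h2.const_add t₀
      · have : s / ((n : ℝ) + 2) ≠ 0 := by positivity
        rw [mem_compl_iff, mem_singleton_iff, add_eq_left]
        exact Complex.ofReal_ne_zero.2 this
    have hxb : ∀ n : ℕ, t₀ + ((s / (n + 2) : ℝ) : ℂ) ∈ ball t₀ s := fun n => by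
      rw [mem_ball, dist_eq_norm, add_sub_cancel_left, Complex.norm_real,
        Real.norm_of_nonneg (by positivity)]
      exact div_lt_self hs0 (by linarith [(Nat.cast_nonneg n : (0 : ℝ) ≤ n)])
    refine aestronglyMeasurable_of_tendsto_ae Filter.atTop
      (f := fun (n : ℕ) (ζ : unitSphere N) => slope (fun t : ℂ => f (t • (ζ : CSpace N))) t₀
        (t₀ + (s / (n + 2) : ℝ))) (fun n => ?_) (Filter.Eventually.of_forall fun ζ => ?_)
    · simp only [slope_def_field]
      exact (((continuous_slice hf.continuousOn (hball _ (hxb n))).sub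
        (continuous_slice hf.continuousOn (hball _ h0))).div_const _).aestronglyMeasurable
    · exact (hasDerivAt_iff_tendsto_slope.1 (hder ζ t₀ h0)).comp hx
  · refine Filter.Eventually.of_forall fun ζ t ht => ?_
    rw [norm_mul]
    refine mul_le_mul (hb' ζ (mem_univ _)) ?_ (norm_nonneg _)
      ((norm_nonneg _).trans (hb' ζ (mem_univ _)))
    refine Complex.norm_deriv_le_of_forall_mem_sphere_norm_le hs0
      (((differentiableOn_slice hf ζ).mono (hsub1 t ht)).diffContOnCl_ball subset_rfl) fun y hy => ?_
    refine hb _ ?_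
    rw [mem_closedBall_zero_iff, norm_smul_sphere]
    simpa using hsub t ht (sphere_subset_closedBall hy)
  · exact integrable_const _
  · exact Filter.Eventually.of_forall fun ζ t ht => (hder ζ t ht).const_mul (v ζ)

/-- Rotation invariance makes the square mean depend only on |t|, as needed on the circle |t| = R in
the maximum principle. -/
theorem integral_norm_sq_rotate {f : CSpace N → ℂ} (R : ℝ) (u : Circle) :
    ∫ ζ : unitSphere N, ‖f (((R : ℂ) * u) • (ζ : CSpace N))‖ ^ 2 ∂(surfaceMeasure N) =
      ∫ ζ : unitSphere N, ‖f ((R : ℂ) • (ζ : CSpace N))‖ ^ 2 ∂(surfaceMeasure N) := by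
  have hemb : MeasurableEmbedding (sphereRot N u) := by
    refine (continuous_sphereRot u).measurableEmbedding fun x y hxy => ?_
    have h1 := congrArg (Subtype.val) hxy
    simp only [coe_sphereRot] at h1
    exact Subtype.ext (smul_right_injective _ u.coe_ne_zero h1)
  have h := (measurePreserving_sphereRot u).integral_comp hemb
    (fun ζ : unitSphere N => ‖f ((R : ℂ) • (ζ : CSpace N))‖ ^ 2)
  simpa only [coe_sphereRot, smul_smul] using h

/-- The square means of a holomorphic function over spheres increase with the radius. -/
theorem integral_norm_sq_mono [NeZero N] {f : CSpace N → ℂ}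
    (hf : DifferentiableOn ℂ f (unitBall N)) {r R : ℝ} (hr : 0 ≤ r) (hrR : r ≤ R) (hR : R < 1) :
    ∫ ζ : unitSphere N, ‖f ((r : ℂ) • (ζ : CSpace N))‖ ^ 2 ∂(surfaceMeasure N) ≤
      ∫ ζ : unitSphere N, ‖f ((R : ℂ) • (ζ : CSpace N))‖ ^ 2 ∂(surfaceMeasure N) := by
  rcases hrR.eq_or_lt with rfl | hlt
  · rfl
  have hR0 : 0 < R := hr.trans_lt hlt
  have hrn : ‖(r : ℂ)‖ < 1 := by
    rw [Complex.norm_real, Real.norm_of_nonneg hr]; linarith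
  have hci : ∀ {g : unitSphere N → ℝ}, Continuous g → Integrable g (surfaceMeasure N) := fun hg =>
    hg.integrable_of_hasCompactSupport (HasCompactSupport.of_compactSpace _)
  have hc : ∀ t : ℂ, ‖t‖ < 1 → Integrable (fun ζ : unitSphere N => ‖f (t • (ζ : CSpace N))‖ ^ 2)
      (surfaceMeasure N) := fun t ht => hci ((continuous_slice hf.continuousOn ht).norm.pow 2)
  -- The holomorphic function Φ pairs the dilate f(tζ) with the fixed dilate f(rζ). Then Φ(r) =
  -- I(r), and |Φ| ≤ (I(r) + I(R))/2 on |t| = R, so the maximum principle gives I(r) ≤ I(R).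
  set v : unitSphere N → ℂ := fun ζ => star (f ((r : ℂ) • (ζ : CSpace N))) with hv
  have hvc : Continuous v := (continuous_slice hf.continuousOn hrn).star
  set Φ : ℂ → ℂ := fun t => ∫ ζ, v ζ * f (t • (ζ : CSpace N)) ∂(surfaceMeasure N) with hΦ
  set I : ℝ → ℝ := fun r =>
    ∫ ζ : unitSphere N, ‖f ((r : ℂ) • (ζ : CSpace N))‖ ^ 2 ∂(surfaceMeasure N) with hI
  have hd : DiffContOnCl ℂ Φ (ball 0 R) :=
    ((differentiableOn_integral_slice hf hvc).mono (closedBall_subset_ball hR)).diffContOnCl_ball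
      subset_rfl
  have hbound : ∀ t ∈ frontier (ball (0 : ℂ) R), ‖Φ t‖ ≤ (I r + I R) / 2 := by
    intro t ht
    rw [frontier_ball _ hR0.ne', mem_sphere_zero_iff_norm] at ht
    have htR : ‖t‖ < 1 := by rw [ht]; exact hR
    set u : Circle := ⟨t / R, by
      rw [Submonoid.unitSphere, Submonoid.mem_mk, Subsemigroup.mem_mk, mem_sphere_zero_iff_norm,
        norm_div, ht, Complex.norm_real,
        Real.norm_of_nonneg hR0.le, div_self hR0.ne']⟩ with hu
    have htu : t = (R : ℂ) * u := by
      rw [hu]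
      have : (R : ℂ) ≠ 0 := by exact_mod_cast hR0.ne'
      simp only
      field_simp
    have h1 : I R = ∫ ζ : unitSphere N, ‖f (t • (ζ : CSpace N))‖ ^ 2 ∂(surfaceMeasure N) := by
      rw [htu, integral_norm_sq_rotate]
    calc ‖Φ t‖ ≤ ∫ ζ, ‖v ζ * f (t • (ζ : CSpace N))‖ ∂(surfaceMeasure N) :=
          norm_integral_le_integral_norm _
      _ ≤ ∫ ζ : unitSphere N, (‖f ((r : ℂ) • (ζ : CSpace N))‖ ^ 2 +
            ‖f (t • (ζ : CSpace N))‖ ^ 2) / 2 ∂(surfaceMeasure N) := by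
          refine integral_mono (hci (hvc.mul (continuous_slice hf.continuousOn htR)).norm)
            (((hc _ hrn).add (hc _ htR)).div_const 2) fun ζ => ?_
          simp only [norm_mul, hv, norm_star]
          nlinarith [sq_nonneg (‖f ((r : ℂ) • (ζ : CSpace N))‖ - ‖f (t • (ζ : CSpace N))‖)]
      _ = (I r + I R) / 2 := by
          rw [integral_div, integral_add (hc _ hrn) (hc _ htR), h1]
  have h2 := Complex.norm_le_of_forall_mem_frontier_norm_le isBounded_ball hd hbound
    (z := (r : ℂ)) (subset_closure (by
      rw [mem_ball_zero_iff, Complex.norm_real, Real.norm_of_nonneg hr]; exact hlt))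
  have h3 : Φ r = (I r : ℂ) := by
    rw [hΦ, hI]
    simp only
    rw [← integral_complex_ofReal]
    refine integral_congr_ae (Filter.Eventually.of_forall fun ζ => ?_)
    simpa [hv] using Complex.conj_mul' (f ((r : ℂ) • (ζ : CSpace N)))
  have hI0 : 0 ≤ I r := integral_nonneg fun _ => by positivity
  rw [h3, Complex.norm_real, Real.norm_of_nonneg hI0] at h2
  change I r ≤ I R
  linarith

theorem eLpNorm_two_sq_eq {β : Type*} [MeasurableSpace β] {μ : Measure β} (f : β → ℂ) :
    eLpNorm f 2 μ ^ 2 = ∫⁻ x, ‖f x‖ₑ ^ 2 ∂μ := by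
  rw [eLpNorm_eq_lintegral_rpow_enorm_toReal two_ne_zero ENNReal.ofNat_ne_top]
  simp only [ENNReal.toReal_ofNat, ENNReal.rpow_ofNat]
  rw [← ENNReal.rpow_ofNat, ← ENNReal.rpow_mul]
  norm_num

/-- Monotonicity of the means over spheres, in terms of `L²` norms. -/
theorem eLpNorm_slice_mono [NeZero N] {f : CSpace N → ℂ}
    (hf : DifferentiableOn ℂ f (unitBall N)) {r R : ℝ} (hr : 0 ≤ r) (hrR : r ≤ R) (hR : R < 1) :
    eLpNorm (fun ζ : unitSphere N => f (r • (ζ : CSpace N))) 2 (surfaceMeasure N) ≤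
      eLpNorm (fun ζ : unitSphere N => f (R • (ζ : CSpace N))) 2 (surfaceMeasure N) := by
  have key : ∀ s : ℝ, 0 ≤ s → s < 1 →
      eLpNorm (fun ζ : unitSphere N => f (s • (ζ : CSpace N))) 2 (surfaceMeasure N) ^ 2 =
        ENNReal.ofReal (∫ ζ : unitSphere N, ‖f ((s : ℂ) • (ζ : CSpace N))‖ ^ 2
          ∂(surfaceMeasure N)) := by
    intro s hs0 hs1
    have hsn : ‖(s : ℂ)‖ < 1 := by rwa [Complex.norm_real, Real.norm_of_nonneg hs0]
    have hint : Integrable (fun ζ : unitSphere N => ‖f ((s : ℂ) • (ζ : CSpace N))‖ ^ 2)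
        (surfaceMeasure N) :=
      ((continuous_slice hf.continuousOn hsn).norm.pow 2).integrable_of_hasCompactSupport
        (HasCompactSupport.of_compactSpace _)
    rw [eLpNorm_two_sq_eq, ofReal_integral_eq_lintegral_ofReal hint
      (Filter.Eventually.of_forall fun _ => sq_nonneg _)]
    refine lintegral_congr fun ζ => ?_
    rw [ENNReal.ofReal_pow (norm_nonneg _), ofReal_norm]
    rfl
  refine (ENNReal.pow_le_pow_left_iff two_ne_zero).1 ?_
  rw [key r hr (hrR.trans_lt hR), key R (hr.trans hrR) hR]
  exact ENNReal.ofReal_le_ofReal (integral_norm_sq_mono hf hr hrR hR)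

end Sphere

/-! ### The Hardy space -/

section Hardy

variable {N : ℕ}

theorem lintegral_eq_lintegral_polar [NeZero N] {g : CSpace N → ℝ≥0∞} (hg : Measurable g) :
    ∫⁻ z, g z = ∫⁻ r, ∫⁻ ζ : unitSphere N, g ((r : ℝ) • (ζ : CSpace N))
      ∂(volume : Measure (CSpace N)).toSphere
      ∂(Measure.volumeIoiPow (Module.finrank ℝ (CSpace N) - 1)) := by
  have hmp := (volume : Measure (CSpace N)).measurePreserving_homeomorphUnitSphereProd
  have h1 : ∫⁻ z, g z = ∫⁻ z in ({0}ᶜ : Set (CSpace N)), g z := by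
    rw [restrict_compl_singleton]
  have h2 := hmp.lintegral_comp_emb (homeomorphUnitSphereProd (CSpace N)).measurableEmbedding
    (fun x : unitSphere N × Ioi (0 : ℝ) => g ((x.2 : ℝ) • (x.1 : CSpace N)))
  have h3 : ∀ z : ({0}ᶜ : Set (CSpace N)), (((homeomorphUnitSphereProd (CSpace N) z).2 : ℝ) •
      ((homeomorphUnitSphereProd (CSpace N) z).1 : CSpace N)) = z := fun z => by
    rw [← homeomorphUnitSphereProd_symm_apply_coe, Homeomorph.symm_apply_apply]
  simp only [h3] at h2
  rw [h1, ← lintegral_subtype_comap (measurableSet_singleton _).compl, h2,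
    lintegral_prod_symm _ (by fun_prop)]

theorem lintegral_surfaceMeasure (g : unitSphere N → ℝ≥0∞) :
    ∫⁻ ζ, g ζ ∂(surfaceMeasure N) = ((volume : Measure (CSpace N)).toSphere univ)⁻¹ *
      ∫⁻ ζ, g ζ ∂(volume : Measure (CSpace N)).toSphere := by
  rw [surfaceMeasure, lintegral_smul_measure, smul_eq_mul]

/-- Comparison of means over spheres gives comparison of weighted volume integrals. -/
theorem lintegral_bergmanWeight_mono [NeZero N] (α : ℝ) {g₁ g₂ : CSpace N → ℝ≥0∞}
    (h₁ : Measurable g₁) (h₂ : Measurable g₂)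
    (h : ∀ r ∈ Ioo (0 : ℝ) 1, ∫⁻ ζ : unitSphere N, g₁ (r • (ζ : CSpace N)) ∂(surfaceMeasure N) ≤
      ∫⁻ ζ : unitSphere N, g₂ (r • (ζ : CSpace N)) ∂(surfaceMeasure N)) :
    ∫⁻ z, g₁ z ∂(bergmanWeight N α) ≤ ∫⁻ z, g₂ z ∂(bergmanWeight N α) := by
  have hw : Measurable fun z : CSpace N => ENNReal.ofReal ((1 - ‖z‖ ^ 2) ^ α) := by fun_prop
  have hm₁ : Measurable fun z => ENNReal.ofReal ((1 - ‖z‖ ^ 2) ^ α) * g₁ z := hw.mul h₁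
  have hm₂ : Measurable fun z => ENNReal.ofReal ((1 - ‖z‖ ^ 2) ^ α) * g₂ z := hw.mul h₂
  rw [lintegral_bergmanWeight, lintegral_bergmanWeight, ← lintegral_indicator measurableSet_ball,
    ← lintegral_indicator measurableSet_ball,
    lintegral_eq_lintegral_polar (hm₁.indicator measurableSet_ball),
    lintegral_eq_lintegral_polar (hm₂.indicator measurableSet_ball)]
  -- The weight is radial, hence constant on each sphere, and factors out of the inner integral.
  refine lintegral_mono fun r => ?_
  have hr0 : (0 : ℝ) < r := r.2
  have hn : ∀ ζ : unitSphere N, ‖(r : ℝ) • (ζ : CSpace N)‖ = r := fun ζ => by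
    rw [norm_smul, Real.norm_of_nonneg hr0.le]; simp
  by_cases hr1 : (r : ℝ) < 1
  · have hmem : ∀ ζ : unitSphere N, (r : ℝ) • (ζ : CSpace N) ∈ unitBall N := fun ζ => by
      rw [mem_ball_zero_iff, hn]; exact hr1
    have h3 := h r ⟨hr0, hr1⟩
    rw [lintegral_surfaceMeasure, lintegral_surfaceMeasure, ENNReal.mul_le_mul_iff_right
      (ENNReal.inv_ne_zero.2 (measure_ne_top _ _))
      (ENNReal.inv_ne_top.2 (toSphere_univ_ne_zero N))] at h3
    simp only [indicator_of_mem (hmem _), hn]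
    rw [lintegral_const_mul' _ _ ENNReal.ofReal_ne_top,
      lintegral_const_mul' _ _ ENNReal.ofReal_ne_top]
    gcongr
  · have hmem : ∀ ζ : unitSphere N, (r : ℝ) • (ζ : CSpace N) ∉ unitBall N := fun ζ => by
      rw [mem_ball_zero_iff, hn]; exact hr1
    simp only [indicator_of_notMem (hmem _), le_refl]

theorem measurable_of_mem_holo {f : CSpace N → ℂ} (hf : f ∈ holo N) : Measurable f := by
  classical
  have h1 : f = (unitBall N).piecewise f 0 := by
    ext z
    by_cases hz : z ∈ unitBall N
    · simp [Set.piecewise, hz]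
    · rw [Set.piecewise_eq_of_notMem _ _ _ hz, hf.2 z hz]; rfl
  rw [h1]
  exact hf.1.continuousOn.measurable_piecewise continuousOn_const measurableSet_ball

theorem eLpNorm_slice_le_hardyENorm (f : CSpace N → ℂ) {r : ℝ} (hr : r ∈ Ioo (0 : ℝ) 1) :
    eLpNorm (fun ζ : unitSphere N => f (r • (ζ : CSpace N))) 2 (surfaceMeasure N) ≤
      hardyENorm f :=
  le_iSup (fun r : Ioo (0 : ℝ) 1 => eLpNorm (fun ζ : unitSphere N =>
    f ((r : ℝ) • (ζ : CSpace N))) 2 (surfaceMeasure N)) ⟨r, hr⟩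

/-- The normalized weighted volume is a probability average of the spherical means, each bounded by
the Hardy norm. -/
theorem bergmanENorm_le_hardyENorm [NeZero N] {α : ℝ} (hα : -1 < α) {f : CSpace N → ℂ}
    (hf : f ∈ holo N) : bergmanENorm α f ≤ hardyENorm f := by
  refine (ENNReal.pow_le_pow_left_iff two_ne_zero).1 ?_
  have h1 : ∫⁻ z, ‖f z‖ₑ ^ 2 ∂(bergmanWeight N α) ≤
      ∫⁻ _, hardyENorm f ^ 2 ∂(bergmanWeight N α) := by
    refine lintegral_bergmanWeight_mono α ((measurable_of_mem_holo hf).enorm.pow_const 2)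
      measurable_const fun r hr => ?_
    rw [← eLpNorm_two_sq_eq (fun ζ : unitSphere N => f (r • (ζ : CSpace N))), lintegral_const,
      measure_univ, mul_one]
    gcongr
    exact eLpNorm_slice_le_hardyENorm f hr
  rw [lintegral_const] at h1
  rw [bergmanENorm_sq]
  calc _ ≤ (bergmanWeight N α univ)⁻¹ * (hardyENorm f ^ 2 * bergmanWeight N α univ) := by gcongr
    _ = hardyENorm f ^ 2 := by
      rw [mul_left_comm, ENNReal.inv_mul_cancel (bergmanWeight_univ_ne_zero N α)
        (bergmanWeight_univ_lt_top N hα).ne, mul_one]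

/-- A mean over a sphere is dominated by the weighted Bergman norm, up to the mass inside. -/
theorem eLpNorm_slice_sq_le [NeZero N] {α : ℝ} (hα : -1 < α) {f : CSpace N → ℂ}
    (hf : f ∈ holo N) {r : ℝ} (hr : r ∈ Ioo (0 : ℝ) 1) :
    eLpNorm (fun ζ : unitSphere N => f (r • (ζ : CSpace N))) 2 (surfaceMeasure N) ^ 2 ≤
      bergmanENorm α f ^ 2 +
      eLpNorm (fun ζ : unitSphere N => f (r • (ζ : CSpace N))) 2 (surfaceMeasure N) ^ 2 *
        ((bergmanWeight N α univ)⁻¹ * bergmanWeight N α (closedBall 0 r)) := by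
  set Q := bergmanWeight N α univ with hQ
  set L := eLpNorm (fun ζ : unitSphere N => f (r • (ζ : CSpace N))) 2 (surfaceMeasure N) with hL
  -- Beyond radius r the means are at least L², so the Bergman norm controls L² times the mass of
  -- the shell; the mass inside remains as the error.
  have h1 : ∫⁻ z, (closedBall (0 : CSpace N) r)ᶜ.indicator (fun _ => L ^ 2) z ∂(bergmanWeight N α) ≤
      ∫⁻ z, ‖f z‖ₑ ^ 2 ∂(bergmanWeight N α) := by
    refine lintegral_bergmanWeight_mono α
      (measurable_const.indicator measurableSet_closedBall.compl)
      ((measurable_of_mem_holo hf).enorm.pow_const 2) fun s hs => ?_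
    rw [← eLpNorm_two_sq_eq (fun ζ : unitSphere N => f (s • (ζ : CSpace N)))]
    have hn : ∀ ζ : unitSphere N, s • (ζ : CSpace N) ∈ (closedBall (0 : CSpace N) r)ᶜ ↔ r < s :=
      fun ζ => by
        rw [mem_compl_iff, mem_closedBall_zero_iff, norm_smul, Real.norm_of_nonneg hs.1.le]; simp
    by_cases hrs : r < s
    · simp only [indicator_of_mem ((hn _).2 hrs)]
      rw [lintegral_const, measure_univ, mul_one]
      gcongr
      exact eLpNorm_slice_mono hf.1 hr.1.le hrs.le hs.2
    · simp only [indicator_of_notMem (fun h => hrs ((hn _).1 h))]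
      simp
  rw [lintegral_indicator measurableSet_closedBall.compl, setLIntegral_const] at h1
  have hQ0 : Q ≠ 0 := bergmanWeight_univ_ne_zero N α
  have hQt : Q ≠ ∞ := (bergmanWeight_univ_lt_top N hα).ne
  calc L ^ 2 = Q⁻¹ * (L ^ 2 * Q) := by
        rw [mul_left_comm, ENNReal.inv_mul_cancel hQ0 hQt, mul_one]
    _ = Q⁻¹ * (L ^ 2 * bergmanWeight N α (closedBall 0 r)ᶜ) +
        L ^ 2 * (Q⁻¹ * bergmanWeight N α (closedBall 0 r)) := by
        rw [hQ, ← measure_add_measure_compl (measurableSet_closedBall (x := (0 : CSpace N)) (ε := r))]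
        ring
    _ ≤ _ := by
        rw [bergmanENorm_sq]
        gcongr

/-- The real dimension is at least 2, so the ball of radius r has at most r² of the volume. The
factor 1 - r² is what the density (1 - |z|²)⁻¹ compensates. -/
theorem volume_shell_ge [NeZero N] {r : ℝ} (hr : r ∈ Ioo (0 : ℝ) 1) :
    ENNReal.ofReal (1 - r ^ 2) * volume (unitBall N) ≤
      volume ((closedBall (0 : CSpace N) r)ᶜ ∩ unitBall N) := by
  have hsub : closedBall (0 : CSpace N) r ⊆ unitBall N := closedBall_subset_ball hr.2
  have hrank : 2 ≤ Module.finrank ℝ (CSpace N) := by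
    rw [← Module.finrank_mul_finrank ℝ ℂ (CSpace N), Complex.finrank_real_complex,
      finrank_euclideanSpace_fin]
    have := NeZero.one_le (n := N)
    lia
  have h1 : volume (closedBall (0 : CSpace N) r) ≤
      ENNReal.ofReal (r ^ 2) * volume (unitBall N) := by
    rw [Measure.addHaar_closedBall _ _ hr.1.le]
    refine mul_le_mul_left (ENNReal.ofReal_le_ofReal ?_) _
    exact pow_le_pow_of_le_one hr.1.le hr.2.le hrank
  rw [inter_comm, ← sdiff_eq, measure_sdiff hsub measurableSet_closedBall.nullMeasurableSet
    measure_closedBall_lt_top.ne]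
  refine le_trans ?_ (tsub_le_tsub_left h1 _)
  rw [ENNReal.ofReal_sub _ (sq_nonneg r), ENNReal.sub_mul (fun _ _ => measure_ball_lt_top.ne),
    ENNReal.ofReal_one, one_mul]

/-- Every shell next to the sphere has mass at least the volume of the ball, although the shells
decrease to the empty set; a finite measure cannot do this. -/
theorem bergmanWeight_neg_one_univ (N : ℕ) [NeZero N] : bergmanWeight N (-1) univ = ∞ := by
  by_contra hfin
  set r : ℕ → ℝ := fun n => 1 - 1 / ((n : ℝ) + 2) with hrdef
  have hr : ∀ n, r n ∈ Ioo (0 : ℝ) 1 := fun n => by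
    have h2 : (0 : ℝ) < (n : ℝ) + 2 := by positivity
    refine ⟨sub_pos.2 ?_, sub_lt_self _ (by positivity)⟩
    rw [div_lt_one h2]
    linarith [(Nat.cast_nonneg n : (0 : ℝ) ≤ n)]
  have hmono : Monotone r := fun m n hmn => by
    simp only [hrdef]
    gcongr
  have hlow : ∀ n, volume (unitBall N) ≤
      bergmanWeight N (-1) ((closedBall (0 : CSpace N) (r n))ᶜ ∩ unitBall N) := fun n => by
    have hm : MeasurableSet ((closedBall (0 : CSpace N) (r n))ᶜ ∩ unitBall N) :=
      measurableSet_closedBall.compl.inter measurableSet_ball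
    have hp : 0 < 1 - r n ^ 2 := by nlinarith [(hr n).1, (hr n).2]
    rw [bergmanWeight, withDensity_apply _ hm, Measure.restrict_restrict hm, inter_assoc,
      inter_self]
    calc volume (unitBall N) = ENNReal.ofReal ((1 - r n ^ 2)⁻¹) *
          (ENNReal.ofReal (1 - r n ^ 2) * volume (unitBall N)) := by
          rw [← mul_assoc, ← ENNReal.ofReal_mul (by positivity), inv_mul_cancel₀ hp.ne',
            ENNReal.ofReal_one, one_mul]
      _ ≤ ENNReal.ofReal ((1 - r n ^ 2)⁻¹) *
          volume ((closedBall (0 : CSpace N) (r n))ᶜ ∩ unitBall N) := by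
          gcongr
          exact volume_shell_ge (hr n)
      _ = ∫⁻ _ in (closedBall (0 : CSpace N) (r n))ᶜ ∩ unitBall N,
          ENNReal.ofReal ((1 - r n ^ 2)⁻¹) := by rw [setLIntegral_const]
      _ ≤ _ := by
          refine setLIntegral_mono' hm fun z hz => ?_
          have hz1 : r n < ‖z‖ := by simpa using hz.1
          have hz2 := one_sub_norm_sq_pos hz.2
          rw [Real.rpow_neg_one]
          refine ENNReal.ofReal_le_ofReal (inv_anti₀ hz2 ?_)
          have := (hr n).1
          gcongr
  have hlim := tendsto_measure_iInter_atTop (μ := bergmanWeight N (-1))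
    (s := fun n => (closedBall (0 : CSpace N) (r n))ᶜ ∩ unitBall N)
    (fun n => (measurableSet_closedBall.compl.inter measurableSet_ball).nullMeasurableSet)
    (fun m n hmn => inter_subset_inter_left _
      (compl_subset_compl.2 (closedBall_subset_closedBall (hmono hmn))))
    ⟨0, measure_ne_top_of_subset (subset_univ _) hfin⟩
  have hempty : ⋂ n, ((closedBall (0 : CSpace N) (r n))ᶜ ∩ unitBall N) = ∅ := by
    refine eq_empty_of_forall_notMem fun z hz => ?_
    rw [mem_iInter] at hz
    have hz1 : ‖z‖ < 1 := by simpa using (hz 0).2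
    obtain ⟨n, hn⟩ := exists_nat_one_div_lt (sub_pos.2 hz1)
    have h2 : r n < ‖z‖ := by simpa using (hz n).1
    have h3 : 1 / ((n : ℝ) + 2) ≤ 1 / ((n : ℝ) + 1) := by gcongr; norm_num
    simp only [hrdef] at h2
    linarith
  rw [hempty, measure_empty] at hlim
  exact (measure_ball_pos volume (0 : CSpace N) one_pos).ne' (le_antisymm
    (ge_of_tendsto' hlim hlow) zero_le)

/-- Exponents decreasing to `-1`. -/
def hardyExponent (n : ℕ) : ℝ := -1 + 1 / ((n : ℝ) + 1)

theorem hardyExponent_gt (n : ℕ) : -1 < hardyExponent n :=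
  lt_add_of_pos_right _ (by positivity)

theorem hardyExponent_anti : Antitone hardyExponent := fun m n hmn => by
  unfold hardyExponent
  gcongr

theorem tendsto_hardyExponent : Filter.Tendsto hardyExponent Filter.atTop (𝓝 (-1)) := by
  unfold hardyExponent
  simpa using (tendsto_one_div_add_atTop_nhds_zero_nat (𝕜 := ℝ)).const_add (-1)

/-- Monotone convergence as the exponent decreases to -1. It makes the normalized measures
concentrate at the sphere. -/
theorem tendsto_bergmanWeight_univ (N : ℕ) [NeZero N] :
    Filter.Tendsto (fun n => bergmanWeight N (hardyExponent n) univ) Filter.atTop (𝓝 ∞) := by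
  have h0 : ∀ α, bergmanWeight N α univ =
      ∫⁻ z in unitBall N, ENNReal.ofReal ((1 - ‖z‖ ^ 2) ^ α) := fun α => by
    rw [bergmanWeight, withDensity_apply _ MeasurableSet.univ, Measure.restrict_univ]
  rw [← bergmanWeight_neg_one_univ N]
  simp only [h0]
  refine lintegral_tendsto_of_tendsto_of_monotone (fun n => by fun_prop) ?_ ?_
  · filter_upwards [ae_restrict_mem measurableSet_ball] with z hz m n hmn
    exact ENNReal.ofReal_le_ofReal (Real.rpow_le_rpow_of_exponent_ge (one_sub_norm_sq_pos hz)
      (by nlinarith [norm_nonneg z]) (hardyExponent_anti hmn))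
  · filter_upwards [ae_restrict_mem measurableSet_ball] with z hz
    exact ENNReal.tendsto_ofReal
      (tendsto_const_nhds.rpow tendsto_hardyExponent (Or.inl (one_sub_norm_sq_pos hz).ne'))

/-- The point is that the bound does not depend on α: after normalization the mass inside radius r
tends to 0. -/
theorem bergmanWeight_closedBall_le {α : ℝ} (hα : -1 < α) (hα0 : α ≤ 0) {r : ℝ}
    (hr : r ∈ Ioo (0 : ℝ) 1) : bergmanWeight N α (closedBall 0 r) ≤
      ENNReal.ofReal ((1 - r ^ 2)⁻¹) * volume (unitBall N) := by
  have hp : 0 < 1 - r ^ 2 := by nlinarith [hr.1, hr.2]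
  have hsub : closedBall (0 : CSpace N) r ⊆ unitBall N := closedBall_subset_ball hr.2
  rw [bergmanWeight, withDensity_apply _ measurableSet_closedBall,
    Measure.restrict_restrict measurableSet_closedBall, inter_eq_left.2 hsub]
  calc _ ≤ ∫⁻ _ in closedBall (0 : CSpace N) r, ENNReal.ofReal ((1 - r ^ 2)⁻¹) := by
        refine setLIntegral_mono' measurableSet_closedBall fun z hz => ENNReal.ofReal_le_ofReal ?_
        have hz' : ‖z‖ ≤ r := by simpa using hz
        rw [← Real.rpow_neg_one]
        calc (1 - ‖z‖ ^ 2) ^ α ≤ (1 - r ^ 2) ^ α :=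
              Real.rpow_le_rpow_of_nonpos hp (by gcongr) hα0
          _ ≤ _ := Real.rpow_le_rpow_of_exponent_ge hp (by nlinarith) hα.le
    _ ≤ _ := by
        rw [setLIntegral_const]
        gcongr

/-- The Hardy norm is controlled by the limit of the weighted Bergman norms as the exponent
decreases to `-1`. -/
theorem hardyENorm_le_of_tendsto [NeZero N] {f : CSpace N → ℂ} (hf : f ∈ holo N) {A : ℕ → ℝ≥0∞}
    {H : ℝ≥0∞} (hA : ∀ n, bergmanENorm (hardyExponent n) f ≤ A n)
    (hlim : Filter.Tendsto A Filter.atTop (𝓝 H)) : hardyENorm f ≤ H := by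
  refine iSup_le fun r => (ENNReal.pow_le_pow_left_iff two_ne_zero).1 ?_
  have hmem : MemLp (fun ζ : unitSphere N => f ((r : ℝ) • (ζ : CSpace N))) 2 (surfaceMeasure N) :=
    (holo_slice_continuous hf r).memLp_of_hasCompactSupport (HasCompactSupport.of_compactSpace _)
  set L := eLpNorm (fun ζ : unitSphere N => f ((r : ℝ) • (ζ : CSpace N))) 2 (surfaceMeasure N)
    with hL
  -- Finiteness of L is what lets the error L² · (mass inside) tend to 0 in extended arithmetic.
  have hLt : L ≠ ∞ := hmem.2.ne
  set K := ENNReal.ofReal ((1 - (r : ℝ) ^ 2)⁻¹) * volume (unitBall N) with hK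
  have hKt : K ≠ ∞ := ENNReal.mul_ne_top ENNReal.ofReal_ne_top measure_ball_lt_top.ne
  have h1 : ∀ n, L ^ 2 ≤
      A n ^ 2 + L ^ 2 * ((bergmanWeight N (hardyExponent n) univ)⁻¹ * K) := fun n => by
    refine (eLpNorm_slice_sq_le (hardyExponent_gt n) hf r.2).trans ?_
    gcongr
    · exact hA n
    · refine bergmanWeight_closedBall_le (hardyExponent_gt n) ?_ r.2
      have : 1 / ((n : ℝ) + 1) ≤ 1 := by
        rw [div_le_one (by positivity)]
        linarith [(Nat.cast_nonneg n : (0 : ℝ) ≤ n)]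
      unfold hardyExponent
      linarith
  have h2 : Filter.Tendsto (fun n => (bergmanWeight N (hardyExponent n) univ)⁻¹) Filter.atTop
      (𝓝 0) := by
    simpa using (tendsto_bergmanWeight_univ N).inv
  have h3 := (ENNReal.Tendsto.pow (n := 2) hlim).add (ENNReal.Tendsto.const_mul
    (ENNReal.Tendsto.mul_const h2 (Or.inr hKt)) (Or.inr (ENNReal.pow_ne_top (n := 2) hLt)))
  simp only [zero_mul, mul_zero, add_zero] at h3
  exact ge_of_tendsto' h3 h1

theorem hardyENorm_mono {f g : CSpace N → ℂ} (h : ∀ z ∈ unitBall N, ‖f z‖ ≤ ‖g z‖) :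
    hardyENorm f ≤ hardyENorm g := by
  refine iSup_mono fun r => eLpNorm_mono fun ζ => h _ ?_
  rw [mem_ball_zero_iff, norm_smul, Real.norm_of_nonneg r.2.1.le]
  simpa using r.2.2

/-- Automorphisms of the ball act contractively on the Hardy space. -/
theorem IsLorentz.hardyENorm_comp_le [NeZero N] {M : (ℂ × CSpace N) ≃ₗ[ℂ] (ℂ × CSpace N)}
    (hM : IsLorentz M) {f : CSpace N → ℂ} (hf : f ∈ holo N) :
    hardyENorm (fun z => ((‖mobDen M z‖ ^ (-(N : ℝ)) : ℝ) : ℂ) * f (mobius M z)) ≤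
      hardyENorm f := by
  obtain ⟨w, hw, hwn⟩ := hM.exists_branch N
  obtain ⟨C₀, hC₀⟩ := (isCompact_closedBall (0 : CSpace N) 1).exists_bound_of_continuousOn
    (IsLorentz.differentiable_den M).continuous.continuousOn
  set C := max C₀ 1 with hC
  have hC1 : 0 < C := lt_max_of_lt_right one_pos
  -- The comparison with Bergman norms needs a holomorphic function, so |D|^{-N} is replaced by a
  -- holomorphic weight of the same modulus.
  set g : CSpace N → ℂ := (unitBall N).indicator fun z => w z * f (mobius M z) with hg
  have hgh : g ∈ holo N := IsInvariantSpace.indicator_mem_holo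
    (hw.differentiableOn.mul (hf.1.comp hM.differentiableOn_mobius hM.mapsTo_ball))
  have hgn : ∀ z ∈ unitBall N, ‖g z‖ = ‖mobDen M z‖ ^ (-(N : ℝ)) * ‖f (mobius M z)‖ :=
    fun z hz => by
      rw [hg, indicator_of_mem hz, norm_mul, hwn z (ball_subset_closedBall hz)]
  -- The weight |D|^{-N} differs from the Bergman weight |D|^{-(N+1+α)} by |D|^{1+α} ≤ C^{1+α}, and
  -- this constant tends to 1 as α decreases to -1.
  have h1 : ∀ n, bergmanENorm (hardyExponent n) g ≤
      ENNReal.ofReal (C ^ (1 + hardyExponent n)) * hardyENorm f := fun n => by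
    set α := hardyExponent n with hα
    have hα1 : -1 < α := hardyExponent_gt n
    calc bergmanENorm α g ≤ bergmanENorm α (((C ^ (1 + α) : ℝ) : ℂ) • fun z =>
          ((‖mobDen M z‖ ^ (-(N + 1 + α)) : ℝ) : ℂ) * f (mobius M z)) := by
          refine bergmanENorm_mono α fun z hz => ?_
          have hzK := ball_subset_closedBall hz
          have hD : 0 < ‖mobDen M z‖ := norm_pos_iff.2 (hM.den_ne_zero hzK)
          rw [hgn z hz, Pi.smul_apply, smul_eq_mul, norm_mul, norm_mul, Complex.norm_real,
            Complex.norm_real, Real.norm_of_nonneg (by positivity),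
            Real.norm_of_nonneg (by positivity), ← mul_assoc]
          refine mul_le_mul_of_nonneg_right ?_ (norm_nonneg _)
          calc ‖mobDen M z‖ ^ (-(N : ℝ)) =
              ‖mobDen M z‖ ^ (1 + α) * ‖mobDen M z‖ ^ (-(N + 1 + α)) := by
                rw [← Real.rpow_add hD]; congr 1; ring
            _ ≤ _ := by
                gcongr
                · linarith
                · exact (hC₀ z hzK).trans (le_max_left _ _)
      _ = ENNReal.ofReal (C ^ (1 + α)) * bergmanENorm α f := by
          rw [bergmanENorm_smul, hM.bergmanENorm_comp, ← ofReal_norm, Complex.norm_real,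
            Real.norm_of_nonneg (by positivity)]
      _ ≤ _ := by
          gcongr
          exact bergmanENorm_le_hardyENorm hα1 hf
  have h2 : Filter.Tendsto (fun n => ENNReal.ofReal (C ^ (1 + hardyExponent n)) * hardyENorm f)
      Filter.atTop (𝓝 (hardyENorm f)) := by
    have h3 : Filter.Tendsto (fun n => C ^ (1 + hardyExponent n)) Filter.atTop (𝓝 1) := by
      have := (tendsto_const_nhds (x := C)).rpow (tendsto_hardyExponent.const_add 1)
        (Or.inl hC1.ne')
      simpa using this
    have h4 := ENNReal.Tendsto.mul_const (b := hardyENorm f) (ENNReal.tendsto_ofReal h3)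
      (Or.inl (by simp))
    simpa using h4
  refine (hardyENorm_mono fun z hz => ?_).trans (hardyENorm_le_of_tendsto hgh h1 h2)
  rw [hgn z hz, norm_mul, Complex.norm_real, Real.norm_of_nonneg (by positivity)]

/-- For functions in the ball algebra the Hardy norm is the norm of the boundary values. -/
theorem hardyENorm_eq_of_diffContOnCl [NeZero N] {g : CSpace N → ℂ}
    (hg : DiffContOnCl ℂ g (unitBall N)) :
    hardyENorm g = eLpNorm g 2 ((surfaceMeasure N).map Subtype.val) := by
  have hc := IsInvariantSpace.ball_algebra_bounded hg
  have hsm : ∀ r ∈ Icc (0 : ℝ) 1, ∀ ζ : unitSphere N,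
      r • (ζ : CSpace N) ∈ closedBall (0 : CSpace N) 1 := fun r hr ζ => by
    rw [mem_closedBall_zero_iff, norm_smul, Real.norm_of_nonneg hr.1]
    simpa using hr.2
  have hslice : ∀ r ∈ Icc (0 : ℝ) 1,
      Continuous fun ζ : unitSphere N => g (r • (ζ : CSpace N)) := fun r hr =>
    hc.comp_continuous (by fun_prop) fun ζ => hsm r hr ζ
  have hemb : MeasurableEmbedding (Subtype.val : unitSphere N → CSpace N) :=
    MeasurableEmbedding.subtype_coe isClosed_sphere.measurableSet
  rw [hemb.eLpNorm_map_measure]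
  set r : ℕ → ℝ := fun n => 1 - 1 / ((n : ℝ) + 2) with hrdef
  have hr : ∀ n, r n ∈ Ioo (0 : ℝ) 1 := fun n => by
    have h2 : (0 : ℝ) < (n : ℝ) + 2 := by positivity
    refine ⟨sub_pos.2 ?_, sub_lt_self _ (by positivity)⟩
    rw [div_lt_one h2]
    linarith [(Nat.cast_nonneg n : (0 : ℝ) ≤ n)]
  have hr1 : Filter.Tendsto r Filter.atTop (𝓝 1) := by
    have h1 : Filter.Tendsto (fun n : ℕ => 1 / ((n : ℝ) + 2)) Filter.atTop (𝓝 0) :=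
      tendsto_const_nhds.div_atTop (Filter.tendsto_atTop_add_const_right _ _
        tendsto_natCast_atTop_atTop)
    simpa [hrdef] using h1.const_sub 1
  have hpt : ∀ ζ : unitSphere N, Filter.Tendsto (fun n => g (r n • (ζ : CSpace N))) Filter.atTop
      (𝓝 (g ζ)) := fun ζ => by
    have h1 : Filter.Tendsto (fun n => r n • (ζ : CSpace N)) Filter.atTop
        (𝓝[closedBall 0 1] (ζ : CSpace N)) := by
      refine tendsto_nhdsWithin_iff.2 ⟨?_, Filter.Eventually.of_forall fun n =>
        hsm _ (Ioo_subset_Icc_self (hr n)) ζ⟩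
      simpa using hr1.smul_const (ζ : CSpace N)
    exact (hc ζ (sphere_subset_closedBall ζ.2)).tendsto.comp h1
  -- For the upper bound the means increase to the boundary mean, by dominated convergence; the
  -- lower bound is Fatou's lemma.
  refine le_antisymm (iSup_le fun s => ?_) ?_
  · obtain ⟨b, hb⟩ := (isCompact_closedBall (0 : CSpace N) 1).exists_bound_of_continuousOn hc
    refine (ENNReal.pow_le_pow_left_iff two_ne_zero).1 ?_
    have h2 : Filter.Tendsto (fun n => ∫⁻ ζ : unitSphere N, ‖g (r n • (ζ : CSpace N))‖ₑ ^ 2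
        ∂(surfaceMeasure N)) Filter.atTop (𝓝 (∫⁻ ζ : unitSphere N, ‖g (ζ : CSpace N)‖ₑ ^ 2
          ∂(surfaceMeasure N))) := by
      refine tendsto_lintegral_of_dominated_convergence (fun _ => ENNReal.ofReal b ^ 2)
        (fun n => (hslice _ (Ioo_subset_Icc_self (hr n))).enorm.measurable.pow_const 2)
        (fun n => Filter.Eventually.of_forall fun ζ => ?_) ?_
        (Filter.Eventually.of_forall fun ζ => ENNReal.Tendsto.pow (hpt ζ).enorm)
      · simp only
        gcongr
        rw [← ofReal_norm]
        exact ENNReal.ofReal_le_ofReal (hb _ (hsm _ (Ioo_subset_Icc_self (hr n)) ζ))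
      · rw [lintegral_const, measure_univ, mul_one]
        exact ENNReal.pow_ne_top ENNReal.ofReal_ne_top
    rw [eLpNorm_two_sq_eq (g ∘ _)]
    refine ge_of_tendsto h2 ?_
    filter_upwards [hr1.eventually (eventually_ge_nhds s.2.2)] with n hn
    rw [← eLpNorm_two_sq_eq (fun ζ : unitSphere N => g (r n • (ζ : CSpace N)))]
    gcongr
    exact eLpNorm_slice_mono hg.differentiableOn s.2.1.le hn (hr n).2
  · refine (Lp.eLpNorm_lim_le_liminf_eLpNorm
      (fun n => (hslice _ (Ioo_subset_Icc_self (hr n))).aestronglyMeasurable) _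
      (Filter.Eventually.of_forall hpt)).trans ?_
    exact Filter.liminf_le_of_le (by isBoundedDefault) fun b hb => by
      obtain ⟨n, hn⟩ := hb.exists
      exact hn.trans (eLpNorm_slice_le_hardyENorm g (hr n))

/-- Elements of the Hardy space as functions. -/
def hardyCoe (N : ℕ) : HardySpace N →ₗ[ℂ] (CSpace N → ℂ) :=
  (hardySubmodule N).subtype

/-- Here m is the surface measure pushed forward to ℂ^N. Only functions of the ball algebra are
compared with L²(m), so no boundary values of general Hardy functions are needed. -/
theorem isInvariantSpace_hardy (N : ℕ) [NeZero N] :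
    IsInvariantSpace (hardyCoe N) hardyENorm N ((surfaceMeasure N).map Subtype.val) where
  mem_holo x := x.2.1
  enorm_eq x := by
    rw [← ofReal_norm, HardySpace.norm_def, ENNReal.ofReal_toReal x.2.2.ne]
    rfl
  exists_of_lt_top f hf hE := ⟨⟨f, hf, hE⟩, rfl⟩
  mono f g h := hardyENorm_mono h
  smul c f := hardyENorm_smul c f
  mobius_le M hM f hf := hM.hardyENorm_comp_le hf
  boundary g hg := hardyENorm_eq_of_diffContOnCl hg
  finite := Measure.isFiniteMeasure_map _ _
  compl_null := by
    rw [Measure.map_apply measurable_subtype_coe measurableSet_closedBall.compl]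
    convert measure_empty (μ := surfaceMeasure N)
    exact eq_empty_of_forall_notMem fun ζ hζ => hζ (sphere_subset_closedBall ζ.2)
  open_pos ζ hζ O hO hζO := by
    have := surfaceMeasure_isOpenPos N
    rw [Measure.map_apply measurable_subtype_coe hO.measurableSet]
    exact (hO.preimage continuous_subtype_val).measure_ne_zero _ ⟨⟨ζ, hζ⟩, hζO⟩

/-- Point evaluations are controlled through the unweighted Bergman norm, and Fatou's lemma is
applied on each sphere separately. -/
instance [NeZero N] : CompleteSpace (HardySpace N) := by
  refine completeSpace_of_local_bound (isInvariantSpace_hardy N).mem_holo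
    (isInvariantSpace_hardy N).enorm_eq (isInvariantSpace_hardy N).exists_of_lt_top
    (fun z hz => ?_) fun f g hf hlim => iSup_le fun r => ?_
  · obtain ⟨r, hr, C, hC0, hsub, hC⟩ := bergman_local_bound (α := 0) (by norm_num) hz
    refine ⟨r, hr, C, hC0, hsub, fun f hf y hy => (hC f hf y hy).trans ?_⟩
    gcongr
    exact bergmanENorm_le_hardyENorm (by norm_num) hf
  · refine (Lp.eLpNorm_lim_le_liminf_eLpNorm
      (fun n => (holo_slice_continuous (hf n) r).aestronglyMeasurable) _
      (Filter.Eventually.of_forall fun ζ => hlim _ ?_)).trans ?_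
    · rw [mem_ball_zero_iff, norm_smul, Real.norm_of_nonneg r.2.1.le]
      simpa using r.2.2
    · exact Filter.liminf_le_liminf
        (Filter.Eventually.of_forall fun n => eLpNorm_slice_le_hardyENorm (f n) r.2)

end Hardy

theorem theorem4p7 (N : ℕ) [NeZero N]
    (φ : CSpace N → CSpace N) (hφ : IsBallAut φ)
    (hfix : ∀ z ∈ unitBall N, φ z ≠ z)
    (a : CSpace N) (ha : IsBoundaryFixedPoint φ a)
    (huniq : ∀ b, IsBoundaryFixedPoint φ b → b = a)
    (ψ : CSpace N → ℂ) (hψ : DiffContOnCl ℂ ψ (unitBall N))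
    (hψ0 : ∃ c : ℝ, 0 < c ∧ ∀ z ∈ unitBall N, c ≤ ‖ψ z‖) :
    (∃ T : HardySpace N →L[ℂ] HardySpace N, HardySpace.IsWeightedComp ψ φ T ∧
      spectrum ℂ T = {μ : ℂ | ‖μ‖ = ‖ψ a‖}) ∧
    ∀ α : Ioi (-1 : ℝ),
      ∃ T : BergmanSpace N α →L[ℂ] BergmanSpace N α, BergmanSpace.IsWeightedComp ψ φ T ∧
        spectrum ℂ T = {μ : ℂ | ‖μ‖ = ‖ψ a‖} :=
  ⟨(isInvariantSpace_hardy N).exists_weightedComp hφ hfix ha huniq hψ hψ0,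
    fun α => (isInvariantSpace_bergman α).exists_weightedComp hφ hfix ha huniq hψ hψ0⟩

end
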